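/- Conventions. For $A,D\subseteq\mathbb N$, $A\oplus D=\{2n:n\in A\}\cup\{2n+1:n\in D\}$; $\emptyset'=\{e:\varphi_e(e)\downarrow\}$ is the halting problem, where $(\varphi_e)_{e\in\mathbb N}$ is a standard numbering of the partial computable functions. A function $f:\mathbb N\to\mathbb N$ is $\Delta^0_2$ if there is a computable $h:\mathbb N^2\to\mathbb N$ with $f(n)=\lim_{s} h(n,s)$ for all $n$; a set is $\Delta^0_2$ if its characteristic function is. A set $D$ is DNR if it computes a function $g:\mathbb N\to\mathbb N$ such that $g(e)\neq\varphi_e(e)$ whenever $\varphi_e(e)$ is defined. $K^A(\sigma)$ is the prefix-free Kolmogorov complexity of the binary string $\sigma$ relative to the oracle $A$. A set $A$ is LR-hard if every infinite binary sequence that is Martin-Löf random relative to $A$ is Martin-Löf random relative to $\emptyset'$. A set $A$ joins every $\Delta^0_2$ DNR set above $\emptyset'$ if $\emptyset'\le_T A\oplus D$ for every $\Delta^0_2$ DNR set $D$. Theorem. (1) Let $A$ be a c.e. set for which there are a $\Delta^0_2$ function $f:\mathbb N\to\mathbb N$ and a constant $c\in\mathbb N$ such that $K^A(\sigma)\le f(K^{\emptyset'}(\sigma))+c$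 for all binary strings $\sigma$. Then $A$ joins every $\Delta^0_2$ DNR set above $\emptyset'$. (2) In particular, every LR-hard c.e. set joins every $\Delta^0_2$ DNR set above $\emptyset'$. (3) In particular, there is a Turing incomplete such set: there is an LR-hard c.e. set $A$ with $\emptyset'\not\le_T A$ that joins every $\Delta^0_2$ DNR set above $\emptyset'$. -/

import Mathlib

namespace Cupping

open scoped Computability

open MeasureTheory Filter

section TuringReducibility

open Classical in
/-- The characteristic function of a set of natural numbers. -/
noncomputable def charFun (A : Set ℕ) (n : ℕ) : ℕ := if n ∈ A then 1 else 0

/-- The characteristic function of `A`, in the form in which it is used as an oracle. -/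
noncomputable def chi (A : Set ℕ) : ℕ →. ℕ := fun n => Part.some (charFun A n)

/-- `A ≤_T B` for sets of natural numbers. -/
def TuringLE (A B : Set ℕ) : Prop := chi A ≤ᵀ chi B

/-- The join `A ⊕ B = {2n : n ∈ A} ∪ {2n + 1 : n ∈ B}`. -/
def join (A B : Set ℕ) : Set ℕ :=
  {m | (∃ n ∈ A, m = 2 * n) ∨ (∃ n ∈ B, m = 2 * n + 1)}

/-- The `e`-th partial computable function `φ_e`. -/
def phi (e : ℕ) : ℕ →. ℕ := (Denumerable.ofNat Nat.Partrec.Code e).eval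

/-- The halting problem `∅' = {e : φ_e(e) converges}`. -/
def haltingSet : Set ℕ := {e | (phi e e).Dom}

/-- `A` is computably enumerable. -/
def IsCE (A : Set ℕ) : Prop := REPred fun n => n ∈ A

/-- `f` is `Δ⁰₂`: it is the pointwise limit of a computable approximation. -/
def IsDelta2Fun (f : ℕ → ℕ) : Prop :=
  ∃ h : ℕ → ℕ → ℕ, Computable₂ h ∧ ∀ n, ∀ᶠ s in atTop, h n s = f n

/-- `D` is a `Δ⁰₂` set. -/
def IsDelta2 (D : Set ℕ) : Prop := IsDelta2Fun (charFun D)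

/-- `g` is diagonally noncomputable: `g(e) ≠ φ_e(e)` whenever `φ_e(e)` converges. -/
def IsDNRFun (g : ℕ → ℕ) : Prop := ∀ e, g e ∉ phi e e

/-- `D` is a DNR set (a set of DNR degree): it computes a diagonally noncomputable function. -/
def IsDNR (D : Set ℕ) : Prop :=
  ∃ g : ℕ → ℕ, IsDNRFun g ∧ (fun n => Part.some (g n)) ≤ᵀ chi D

/-- `A` joins every `Δ⁰₂` DNR set above `∅'`. -/
def JoinsDelta2DNR (A : Set ℕ) : Prop :=
  ∀ D : Set ℕ, IsDelta2 D → IsDNR D → TuringLE haltingSet (join A D)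

end TuringReducibility

section KolmogorovComplexity

/-- Programs for partial computable functionals: the operations are those of `Nat.RecursiveIn`. -/
inductive OracleCode : Type
  | zero : OracleCode
  | succ : OracleCode
  | left : OracleCode
  | right : OracleCode
  | oracle : OracleCode
  | pair : OracleCode → OracleCode → OracleCode
  | comp : OracleCode → OracleCode → OracleCode
  | prec : OracleCode → OracleCode → OracleCode
  | rfind : OracleCode → OracleCode

/-- The partial function computed by a program with oracle `g`. -/
def OracleCode.eval (g : ℕ →. ℕ) : OracleCode → (ℕ →. ℕ)
  | .zero => fun _ => Part.some 0
  | .succ => fun n => Part.some (n + 1)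
  | .left => fun n => Part.some n.unpair.1
  | .right => fun n => Part.some n.unpair.2
  | .oracle => g
  | .pair c d => fun n => Nat.pair <$> c.eval g n <*> d.eval g n
  | .comp c d => fun n => d.eval g n >>= c.eval g
  | .prec c d => fun p =>
      let (a, n) := Nat.unpair p
      n.rec (c.eval g a) fun y IH => do
        let i ← IH
        d.eval g (Nat.pair a (Nat.pair y i))
  | .rfind c => fun a => Nat.rfind fun n => (fun m => decide (m = 0)) <$> c.eval g (Nat.pair a n)

/-- An effective numbering of the programs. -/
def OracleCode.index : OracleCode → ℕ
  | .zero => 0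
  | .succ => 1
  | .left => 2
  | .right => 3
  | .oracle => 4
  | .pair c d => 4 * Nat.pair c.index d.index + 5
  | .comp c d => 4 * Nat.pair c.index d.index + 6
  | .prec c d => 4 * Nat.pair c.index d.index + 7
  | .rfind c => 4 * c.index + 8

/-- The self-delimiting machine given by the program `c` and the oracle `A`, as a relation
"on input `σ` the output is `x`". Having read the bits `τ` of its input, the machine runs `c` on
`τ`; the value `0` means "read one more bit", the value `x + 1` means "halt with output `x`", and
`σ` is the string of bits read when the machine halts. So the domain is prefix-free for every
oracle (`OracleCode.machine_prefixFree`), and every partial `A`-computable function with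
prefix-free domain is of this form: having read `τ`, search for an element of the domain that is
comparable with `τ`, ask for another bit if it properly extends `τ`, and otherwise halt. -/
def OracleCode.Machine (c : OracleCode) (A : Set ℕ) (σ x : List Bool) : Prop :=
  (∀ τ, τ <+: σ → τ ≠ σ → 0 ∈ c.eval (chi A) (Encodable.encode τ)) ∧
    Encodable.encode x + 1 ∈ c.eval (chi A) (Encodable.encode σ)

theorem OracleCode.machine_prefixFree {c : OracleCode} {A : Set ℕ} {σ τ x y : List Bool}
    (hσ : c.Machine A σ x) (hτ : c.Machine A τ y) (h : τ <+: σ) : τ = σ ∧ y = x := by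
  have h1 : τ = σ := by
    by_contra hne
    have := Part.mem_unique (hσ.1 τ h hne) hτ.2
    omega
  subst h1
  have := Part.mem_unique hσ.2 hτ.2
  exact ⟨rfl, Encodable.encode_injective (by omega)⟩

/-- The universal prefix-free oracle machine: `U^A(1^e 0 σ)` is the output on `σ` of the
self-delimiting machine with number `e` and oracle `A`. -/
def Universal (A : Set ℕ) (ρ x : List Bool) : Prop :=
  ∃ (c : OracleCode) (σ : List Bool),
    ρ = List.replicate c.index true ++ false :: σ ∧ c.Machine A σ x

/-- Prefix-free Kolmogorov complexity relative to `A`: the length of a shortest `U^A`-description.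
Every string has a description (`exists_description`). -/
noncomputable def K (A : Set ℕ) (x : List Bool) : ℕ :=
  sInf {n | ∃ ρ : List Bool, ρ.length = n ∧ Universal A ρ x}

theorem exists_description (A : Set ℕ) (x : List Bool) : ∃ ρ, Universal A ρ x := by
  have hc : ∀ m : ℕ, ∃ c : OracleCode, ∀ n, c.eval (chi A) n = Part.some m := by
    intro m
    induction m with
    | zero => exact ⟨.zero, fun n => rfl⟩
    | succ m ih =>
      obtain ⟨c, hc⟩ := ih
      exact ⟨.comp .succ c, fun n => by simp [OracleCode.eval, hc]⟩
  obtain ⟨c, hc⟩ := hc (Encodable.encode x + 1)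
  refine ⟨_, c, [], rfl, ?_, ?_⟩
  · intro τ h hne
    exact absurd (List.prefix_nil.1 h) hne
  · rw [hc]
    exact Part.mem_some _

end KolmogorovComplexity

section Randomness

/-- The predicate `p` is computably enumerable relative to `A`. -/
def IsCEIn {α : Type*} [Primcodable α] (A : Set ℕ) (p : α → Prop) : Prop :=
  RecursiveIn {chi A} fun a => Part.assert (p a) fun _ => Part.some ()

/-- The uniform measure on Cantor space. -/
noncomputable def coinMeasure : Measure (ℕ → Bool) :=
  Measure.infinitePi fun _ => (PMF.uniformOfFintype Bool).toMeasure

/-- The basic clopen set of all infinite sequences that extend `σ`. -/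
def cylinder (σ : List Bool) : Set (ℕ → Bool) :=
  {Z | ∀ (i : ℕ) (h : i < σ.length), Z i = σ[i]}

/-- The open set generated by a set of strings. -/
def openSet (W : Set (List Bool)) : Set (ℕ → Bool) := ⋃ σ ∈ W, cylinder σ

/-- A Martin-Löf test relative to `A`: a uniformly `A`-c.e. sequence of open sets such that the
`n`-th one has measure at most `2^{-n}`. -/
def IsMLTest (A : Set ℕ) (W : ℕ → Set (List Bool)) : Prop :=
  IsCEIn A (fun p : ℕ × List Bool => p.2 ∈ W p.1) ∧
    ∀ n, coinMeasure (openSet (W n)) ≤ (2 : ENNReal)⁻¹ ^ n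

/-- `Z` is Martin-Löf random relative to `A`. -/
def IsMLRandom (A : Set ℕ) (Z : ℕ → Bool) : Prop :=
  ∀ W : ℕ → Set (List Bool), IsMLTest A W → Z ∉ ⋂ n, openSet (W n)

/-- `A ≤_LR B`: every sequence that is random relative to `B` is random relative to `A`. -/
def LRLE (A B : Set ℕ) : Prop := ∀ Z, IsMLRandom B Z → IsMLRandom A Z

/-- `A` is LR-hard: `∅' ≤_LR A`. -/
def LRHard (A : Set ℕ) : Prop := LRLE haltingSet A

end Randomness

end Cupping

/-! (1) and (2) rest on a tracing property of `A`: for every `∅'`-computable `p` there are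
infinitely many `N` such that `p N` is read off from the result of an `A`-computation whose program
and input are bounded computably in `N`. By `joinsDelta2DNR_of_trace` this suffices. From a DNR set
`D` one computes a function `G` that avoids the following partial computable `Q`: on a pair `(z,
k)`, wait until `k` enters `∅'`, run computation `z` with the approximation to `A` at that stage,
and output the coordinate numbered `(z, k)` of the list so obtained. As `D` is `Δ⁰₂`, the function
sending `N` to a long initial segment of `G` is `∅'`-computable, hence traced infinitely often. With
oracle `A ⊕ D` one can search for some `N ≥ k` and a stage `s` at which a tracing computation `z`
already has its correct use of `A`. If `k` is outside `∅'` at stage `s`, it never enters: since `A`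
is c.e., that use would still be correct at the stage of entry, so `Q (z, k)` would equal `G (z,
k)`.

For (1), `1^(p (F m))` has complexity at most `m + O(1)` relative to `∅'` whenever `p` and `F` are
`∅'`-computable. If `F m` dominates `f` on `[0, 2m]`, the hypothesis gives a description relative to
`A` of length at most `F m + c`, which is a trace of `p` at `N = F m`.

For (2), consider the event that a sequence vanishes on the block `[m * p m, m * p m + m)`. Lying in
infinitely many of these events violates randomness relative to `∅'`. If `A` is LR-hard, forcing
with closed sets of positive measure that are `Π⁰₁` in `A` cannot yield an `A`-random sequence of
this kind. So some such closed set `P` misses, up to measure zero, the block of `p m` for all large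
`m`. For fixed `m` the blocks are independent, so fewer than `C * 2 ^ m` of them have very small
intersection with `P`. These are enumerable from `A`, which traces `p` (`exists_trace`).

For (3), a relativized cost construction gives an operator taking `X` to a set `W` that is c.e. in
`X`, not computable from `X`, and such that randomness relative to `X` implies randomness relative
to `X ⊕ W` (`not_funIn_charFun_opLim`, `lrle_of_funIn_limJoin`). Pseudojump inversion gives a c.e.
set `A` for which the corresponding `A ⊕ W` is Turing equivalent to `∅'`. Then `∅'` is LR-below `A`.
If `A` computed `∅'`, it would compute `W`, which is impossible. -/

namespace Cupping
open Nat.Partrec (Code)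

/-! ### Automation for primitive recursion -/

section Primrec

attribute [fun_prop] Primrec PrimrecPred
attribute [fun_prop] Primrec.id Primrec.const Primrec.comp Primrec.pair
attribute [fun_prop] Primrec.encode Primrec.decode Primrec.unpair Primrec.list_length
  Primrec.ofNat Primrec.list_range Primrec.option_isSome Primrec.list_reverse Primrec.list_tail
  Primrec.option_some Primrec.succ

variable {α β γ δ : Type*} [Primcodable α] [Primcodable β] [Primcodable γ] [Primcodable δ]

namespace PR

@[fun_prop] theorem fst {f : α → β × γ} (hf : Primrec f) : Primrec fun a => (f a).1 :=
  Primrec.fst.comp hf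

@[fun_prop] theorem snd {f : α → β × γ} (hf : Primrec f) : Primrec fun a => (f a).2 :=
  Primrec.snd.comp hf

@[fun_prop] theorem add {f g : α → ℕ} (hf : Primrec f) (hg : Primrec g) :
    Primrec fun a => f a + g a := Primrec.nat_add.comp hf hg

@[fun_prop] theorem sub {f g : α → ℕ} (hf : Primrec f) (hg : Primrec g) :
    Primrec fun a => f a - g a := Primrec.nat_sub.comp hf hg

@[fun_prop] theorem mul {f g : α → ℕ} (hf : Primrec f) (hg : Primrec g) :
    Primrec fun a => f a * g a := Primrec.nat_mul.comp hf hg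

@[fun_prop] theorem div {f g : α → ℕ} (hf : Primrec f) (hg : Primrec g) :
    Primrec fun a => f a / g a := Primrec.nat_div.comp hf hg

@[fun_prop] theorem mod {f g : α → ℕ} (hf : Primrec f) (hg : Primrec g) :
    Primrec fun a => f a % g a := Primrec.nat_mod.comp hf hg

@[fun_prop] theorem natPair {f g : α → ℕ} (hf : Primrec f) (hg : Primrec g) :
    Primrec fun a => Nat.pair (f a) (g a) := Primrec₂.natPair.comp hf hg

@[fun_prop] theorem natRec {f : α → ℕ} {z : α → β} {s : α → ℕ → β → β}
    (hf : Primrec f) (hz : Primrec z) (hs : Primrec fun q : α × ℕ × β => s q.1 q.2.1 q.2.2) :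
    Primrec fun a => Nat.rec (motive := fun _ => β) (z a) (fun n b => s a n b) (f a) :=
  Primrec.nat_rec' hf hz (show Primrec₂ fun a (p : ℕ × β) => s a p.1 p.2 from hs)

@[fun_prop] theorem pow {f g : α → ℕ} (hf : Primrec f) (hg : Primrec g) :
    Primrec fun a => f a ^ g a := by
  have : Primrec fun a => Nat.rec (motive := fun _ => ℕ) 1 (fun _ b => b * f a) (g a) := by
    fun_prop
  refine this.of_eq fun a => ?_
  induction g a with
  | zero => rfl
  | succ n ih => rw [pow_succ, ← ih]

@[fun_prop] theorem decide {p : α → Prop} [DecidablePred p] (hp : PrimrecPred p) :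
    Primrec fun a => decide (p a) := hp.decide

@[fun_prop] theorem lt {f g : α → ℕ} (hf : Primrec f) (hg : Primrec g) :
    PrimrecPred fun a => f a < g a := Primrec.nat_lt.comp hf hg

@[fun_prop] theorem le {f g : α → ℕ} (hf : Primrec f) (hg : Primrec g) :
    PrimrecPred fun a => f a ≤ g a := Primrec.nat_le.comp hf hg

@[fun_prop] theorem eq {f g : α → β} (hf : Primrec f) (hg : Primrec g) :
    PrimrecPred fun a => f a = g a := Primrec.eq.comp hf hg

@[fun_prop] theorem and {p q : α → Prop} (hp : PrimrecPred p) (hq : PrimrecPred q) :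
    PrimrecPred fun a => p a ∧ q a := PrimrecPred.and hp hq

@[fun_prop] theorem not {p : α → Prop} (hp : PrimrecPred p) :
    PrimrecPred fun a => ¬ p a := PrimrecPred.not hp

@[fun_prop] theorem imp {p q : α → Prop} (hp : PrimrecPred p) (hq : PrimrecPred q) :
    PrimrecPred fun a => p a → q a :=
  ((PrimrecPred.not hp).or hq).of_eq fun a => by tauto

@[fun_prop] theorem ite {p : α → Prop} [DecidablePred p] {f g : α → β}
    (hp : PrimrecPred p) (hf : Primrec f) (hg : Primrec g) :
    Primrec fun a => if p a then f a else g a := Primrec.ite hp hf hg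

@[fun_prop] theorem exists_mem {l : α → List β} {p : α → β → Prop} (hl : Primrec l)
    (hp : PrimrecPred fun q : α × β => p q.1 q.2) :
    PrimrecPred fun a => ∃ x ∈ l a, p a x := by
  have hR : PrimrecRel fun (x : β) (a : α) => p a x :=
    hp.comp (Primrec.pair Primrec.snd Primrec.fst)
  exact hR.exists_mem_list.comp hl Primrec.id

@[fun_prop] theorem forall_mem {l : α → List β} {p : α → β → Prop} (hl : Primrec l)
    (hp : PrimrecPred fun q : α × β => p q.1 q.2) :
    PrimrecPred fun a => ∀ x ∈ l a, p a x := by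
  have hR : PrimrecRel fun (x : β) (a : α) => p a x :=
    hp.comp (Primrec.pair Primrec.snd Primrec.fst)
  exact hR.forall_mem_list.comp hl Primrec.id

@[fun_prop] theorem exists_lt {f : α → ℕ} {p : α → ℕ → Prop} (hf : Primrec f)
    (hp : PrimrecPred fun q : α × ℕ => p q.1 q.2) : PrimrecPred fun a => ∃ x < f a, p a x :=
  (exists_mem (Primrec.list_range.comp hf) hp).of_eq fun a => by simp

@[fun_prop] theorem forall_lt {f : α → ℕ} {p : α → ℕ → Prop} (hf : Primrec f)
    (hp : PrimrecPred fun q : α × ℕ => p q.1 q.2) : PrimrecPred fun a => ∀ x < f a, p a x :=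
  (forall_mem (Primrec.list_range.comp hf) hp).of_eq fun a => by simp

@[fun_prop] theorem map {f : α → List β} {g : α → β → γ} (hf : Primrec f)
    (hg : Primrec fun q : α × β => g q.1 q.2) :
    Primrec fun a => (f a).map fun b => g a b := Primrec.list_map hf hg

@[fun_prop] theorem filter {f : α → List β} {p : α → β → Bool} (hf : Primrec f)
    (hp : Primrec fun q : α × β => p q.1 q.2) :
    Primrec fun a => (f a).filter fun b => p a b := by
  have : Primrec fun a => (f a).filterMap fun b => if p a b = true then some b else none :=
    Primrec.listFilterMap hf (by unfold Primrec₂; fun_prop)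
  refine this.of_eq fun a => ?_
  rw [← List.filterMap_eq_filter]
  rfl

@[fun_prop] theorem append {f g : α → List β} (hf : Primrec f) (hg : Primrec g) :
    Primrec fun a => f a ++ g a := Primrec.list_append.comp hf hg

@[fun_prop] theorem cons {f : α → β} {g : α → List β} (hf : Primrec f) (hg : Primrec g) :
    Primrec fun a => f a :: g a := Primrec.list_cons.comp hf hg

@[fun_prop] theorem take {f : α → ℕ} {g : α → List β} (hf : Primrec f) (hg : Primrec g) :
    Primrec fun a => (g a).take (f a) := Primrec.list_take.comp hf hg

@[fun_prop] theorem getD {l : α → List β} {n : α → ℕ} {d : β} (hl : Primrec l) (hn : Primrec n) :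
    Primrec fun a => (l a).getD (n a) d := (Primrec.list_getD d).comp hl hn

@[fun_prop] theorem getElem? {l : α → List β} {n : α → ℕ} (hl : Primrec l) (hn : Primrec n) :
    Primrec fun a => (l a)[n a]? := Primrec.list_getElem?.comp hl hn

@[fun_prop] theorem optGetD {f : α → Option β} {g : α → β} (hf : Primrec f) (hg : Primrec g) :
    Primrec fun a => (f a).getD (g a) := Primrec.option_getD.comp hf hg

@[fun_prop] theorem evaln {k : α → ℕ} {c : α → Code} {n : α → ℕ} (hk : Primrec k)
    (hc : Primrec c) (hn : Primrec n) : Primrec fun a => Code.evaln (k a) (c a) (n a) :=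
  Code.primrec_evaln.comp ((hk.pair hc).pair hn)

@[fun_prop] theorem codePair {f g : α → Code} (hf : Primrec f) (hg : Primrec g) :
    Primrec fun a => Code.pair (f a) (g a) := Code.primrec₂_pair.comp hf hg

@[fun_prop] theorem codeComp {f g : α → Code} (hf : Primrec f) (hg : Primrec g) :
    Primrec fun a => Code.comp (f a) (g a) := Code.primrec₂_comp.comp hf hg

@[fun_prop] theorem codePrec {f g : α → Code} (hf : Primrec f) (hg : Primrec g) :
    Primrec fun a => Code.prec (f a) (g a) := Code.primrec₂_prec.comp hf hg

@[fun_prop] theorem codeRfind {f : α → Code} (hf : Primrec f) :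
    Primrec fun a => Code.rfind' (f a) := Code.primrec_rfind'.comp hf

end PR

end Primrec

/-! ### Finite oracles, the use principle and elimination of the oracle -/

section OracleCode

/-- A total function, as an oracle. -/
def tot (g : ℕ → ℕ) : ℕ →. ℕ := fun n => Part.some (g n)

/-- The finite oracle given by a list. -/
def pfn (l : List ℕ) : ℕ →. ℕ := fun n => Part.ofOption l[n]?

/-- The restriction of `g` to `{0, …, k - 1}`, as a list. -/
def pre (g : ℕ → ℕ) (k : ℕ) : List ℕ := (List.range k).map g

@[simp] theorem length_pre (g : ℕ → ℕ) (k : ℕ) : (pre g k).length = k := by simp [pre]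

theorem mem_pfn_pre {g : ℕ → ℕ} {k n x : ℕ} : x ∈ pfn (pre g k) n ↔ n < k ∧ x = g n := by
  by_cases h : n < k <;> simp [pfn, pre, h]

theorem pre_succ (g : ℕ → ℕ) (k : ℕ) : pre g (k + 1) = pre g k ++ [g k] := by
  simp [pre, List.range_succ]

theorem take_pre (g : ℕ → ℕ) {i k : ℕ} (h : i ≤ k) : (pre g k).take i = pre g i := by
  simp [pre, ← List.map_take, List.take_range, min_eq_left h]

theorem pre_congr {g g' : ℕ → ℕ} {k : ℕ} (h : ∀ i < k, g i = g' i) : pre g k = pre g' k :=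
  List.map_congr_left fun i hi => h i (List.mem_range.1 hi)

theorem pre_prefix (g : ℕ → ℕ) {i k : ℕ} (h : i ≤ k) : pre g i <+: pre g k :=
  take_pre g h ▸ List.take_prefix _ _

theorem pfn_mono {l l' : List ℕ} (h : l <+: l') {n x : ℕ} (hx : x ∈ pfn l n) : x ∈ pfn l' n := by
  obtain ⟨t, rfl⟩ := h
  simp only [pfn, Part.mem_ofOption, Option.mem_def] at hx ⊢
  obtain ⟨h, -⟩ := List.getElem?_eq_some_iff.1 hx
  rw [List.getElem?_append_left h, hx]

theorem OracleCode.mem_eval_comp {g : ℕ →. ℕ} {c d : OracleCode} {n x : ℕ} :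
    x ∈ (OracleCode.comp c d).eval g n ↔ ∃ a ∈ d.eval g n, x ∈ c.eval g a := Part.mem_bind_iff

theorem OracleCode.mem_eval_rfind {g : ℕ →. ℕ} {c : OracleCode} {n x : ℕ} :
    x ∈ (OracleCode.rfind c).eval g n ↔ (∃ a ∈ c.eval g (Nat.pair n x), decide (a = 0) = true) ∧
      ∀ {m}, m < x → ∃ a ∈ c.eval g (Nat.pair n m), decide (a = 0) = false := by
  refine Nat.mem_rfind.trans (and_congr (Part.mem_map_iff _) ⟨fun h m hm => ?_, fun h m hm => ?_⟩)
  · exact (Part.mem_map_iff _).1 (h hm)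
  · exact (Part.mem_map_iff _).2 (h hm)

/-- Evaluation depends positively on the oracle: even an unbounded search needs defined values below
its result and never uses divergence. -/
theorem OracleCode.eval_mono {g g' : ℕ →. ℕ} (h : ∀ n x, x ∈ g n → x ∈ g' n) (c : OracleCode) :
    ∀ n x, x ∈ c.eval g n → x ∈ c.eval g' n := by
  induction c with
  | zero | succ | left | right => exact fun n x hx => hx
  | oracle => exact h
  | pair c d ihc ihd =>
    intro n x
    simp only [OracleCode.eval, Seq.seq, Part.map_eq_map, Part.mem_bind_iff, Part.mem_map_iff]
    rintro ⟨_, ⟨a, ha, rfl⟩, b, hb, rfl⟩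
    exact ⟨_, ⟨a, ihc _ _ ha, rfl⟩, b, ihd _ _ hb, rfl⟩
  | comp c d ihc ihd =>
    intro n x
    rw [OracleCode.mem_eval_comp, OracleCode.mem_eval_comp]
    rintro ⟨a, ha, hb⟩
    exact ⟨a, ihd _ _ ha, ihc _ _ hb⟩
  | prec c d ihc ihd =>
    intro n
    simp only [OracleCode.eval]
    induction n.unpair.2 with
    | zero => exact ihc _
    | succ m ih =>
      intro x
      simp only [Part.bind_eq_bind, Part.mem_bind_iff]
      rintro ⟨a, ha, hb⟩
      exact ⟨a, ih _ ha, ihd _ _ hb⟩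
  | rfind c ih =>
    intro n x
    simp only [OracleCode.mem_eval_rfind]
    rintro ⟨⟨a, ha, ha'⟩, hb⟩
    refine ⟨⟨a, ih _ _ ha, ha'⟩, fun {m} hm => ?_⟩
    obtain ⟨b, hb, hb'⟩ := hb hm
    exact ⟨b, ih _ _ hb, hb'⟩

theorem OracleCode.eval_pfn_mono (c : OracleCode) {l l' : List ℕ} (h : l <+: l') {n x : ℕ}
    (hx : x ∈ c.eval (pfn l) n) : x ∈ c.eval (pfn l') n :=
  c.eval_mono (fun _ _ => pfn_mono h) n x hx

theorem OracleCode.eval_pre_mono (c : OracleCode) {g : ℕ → ℕ} {i k : ℕ} (h : i ≤ k) {n x : ℕ}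
    (hx : x ∈ c.eval (pfn (pre g i)) n) : x ∈ c.eval (pfn (pre g k)) n :=
  c.eval_pfn_mono (pre_prefix g h) hx

theorem OracleCode.eval_of_pre (c : OracleCode) {g : ℕ → ℕ} {k n x : ℕ}
    (hx : x ∈ c.eval (pfn (pre g k)) n) : x ∈ c.eval (tot g) n :=
  c.eval_mono (fun _ _ h => Part.mem_some_iff.2 (mem_pfn_pre.1 h).2) n x hx

theorem exists_bound_of_forall_lt {P : ℕ → ℕ → Prop} (hP : ∀ m i k, i ≤ k → P m i → P m k) (n : ℕ)
    (h : ∀ m < n, ∃ k, P m k) : ∃ k, ∀ m < n, P m k := by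
  induction n with
  | zero => exact ⟨0, by simp⟩
  | succ n ih =>
    obtain ⟨k, hk⟩ := ih fun m hm => h m (by omega)
    obtain ⟨k', hk'⟩ := h n (by omega)
    refine ⟨max k k', fun m hm => ?_⟩
    rcases Nat.lt_succ_iff_lt_or_eq.1 hm with hm | rfl
    · exact hP _ _ _ (le_max_left _ _) (hk m hm)
    · exact hP _ _ _ (le_max_right _ _) hk'

/-- The use principle: a convergent computation asks finitely many questions. Monotonicity in the
length merges the uses of the parts of a computation. -/
theorem OracleCode.exists_pre (g : ℕ → ℕ) (c : OracleCode) :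
    ∀ n x, x ∈ c.eval (tot g) n → ∃ k, x ∈ c.eval (pfn (pre g k)) n := by
  induction c with
  | zero | succ | left | right => exact fun n x hx => ⟨0, hx⟩
  | oracle =>
    intro n x hx
    exact ⟨n + 1, mem_pfn_pre.2 ⟨by omega, Part.mem_some_iff.1 hx⟩⟩
  | pair c d ihc ihd =>
    intro n x
    simp only [OracleCode.eval, Seq.seq, Part.map_eq_map, Part.mem_bind_iff, Part.mem_map_iff]
    rintro ⟨_, ⟨a, ha, rfl⟩, b, hb, rfl⟩
    obtain ⟨k, hk⟩ := ihc _ _ ha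
    obtain ⟨k', hk'⟩ := ihd _ _ hb
    exact ⟨max k k', _, ⟨a, c.eval_pre_mono (le_max_left _ _) hk, rfl⟩, b,
      d.eval_pre_mono (le_max_right _ _) hk', rfl⟩
  | comp c d ihc ihd =>
    intro n x
    simp only [OracleCode.mem_eval_comp]
    rintro ⟨a, ha, hb⟩
    obtain ⟨k, hk⟩ := ihd _ _ ha
    obtain ⟨k', hk'⟩ := ihc _ _ hb
    exact ⟨max k k', a, d.eval_pre_mono (le_max_left _ _) hk,
      c.eval_pre_mono (le_max_right _ _) hk'⟩
  | prec c d ihc ihd =>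
    intro n
    -- The bound is stated for all longer prefixes, so that in the inductive step the maximum of two
    -- uses serves both.
    have key : ∀ m x, x ∈ (Nat.rec (c.eval (tot g) n.unpair.1) (fun y IH => do
        let i ← IH
        d.eval (tot g) (Nat.pair n.unpair.1 (Nat.pair y i))) m : Part ℕ) →
        ∃ k, ∀ k', k ≤ k' → x ∈ (Nat.rec (c.eval (pfn (pre g k')) n.unpair.1) (fun y IH => do
        let i ← IH
        d.eval (pfn (pre g k')) (Nat.pair n.unpair.1 (Nat.pair y i))) m : Part ℕ) := by
      intro m
      induction m with
      | zero =>
        intro x hx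
        obtain ⟨k, hk⟩ := ihc _ _ hx
        exact ⟨k, fun k' hk' => c.eval_pre_mono hk' hk⟩
      | succ m ih =>
        intro x
        simp only [Part.bind_eq_bind, Part.mem_bind_iff]
        rintro ⟨a, ha, hb⟩
        obtain ⟨k, hk⟩ := ih _ ha
        obtain ⟨k', hk'⟩ := ihd _ _ hb
        exact ⟨max k k', fun j hj => ⟨a, hk j (by omega), d.eval_pre_mono (by omega) hk'⟩⟩
    intro x hx
    obtain ⟨k, hk⟩ := key _ x hx
    exact ⟨k, hk k le_rfl⟩
  | rfind c ih =>
    intro n x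
    simp only [OracleCode.mem_eval_rfind]
    rintro ⟨⟨a, ha, ha'⟩, hb⟩
    obtain ⟨k, hk⟩ := ih _ _ ha
    obtain ⟨k', hk'⟩ := exists_bound_of_forall_lt
      (P := fun m k => ∃ a ∈ c.eval (pfn (pre g k)) (Nat.pair n m), decide (a = 0) = false)
      (fun m i k hik ⟨a, ha, h⟩ => ⟨a, c.eval_pre_mono hik ha, h⟩) x (fun m hm => by
        obtain ⟨b, hb, hb'⟩ := hb hm
        obtain ⟨k, hk⟩ := ih _ _ hb
        exact ⟨k, b, hk, hb'⟩)
    refine ⟨max k k', ⟨a, c.eval_pre_mono (le_max_left _ _) hk, ha'⟩, fun {m} hm => ?_⟩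
    obtain ⟨b, hb, hb'⟩ := hk' m hm
    exact ⟨b, c.eval_pre_mono (le_max_right _ _) hb, hb'⟩

theorem OracleCode.mem_eval_iff (g : ℕ → ℕ) (c : OracleCode) (n x : ℕ) :
    x ∈ c.eval (tot g) n ↔ ∃ k, x ∈ c.eval (pfn (pre g k)) n :=
  ⟨c.exists_pre g n x, fun ⟨_, h⟩ => c.eval_of_pre h⟩

theorem exists_oracleCode {g F : ℕ →. ℕ} (h : Nat.RecursiveIn {g} F) :
    ∃ c : OracleCode, c.eval g = F := by
  induction h with
  | zero => exact ⟨.zero, rfl⟩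
  | succ => exact ⟨.succ, rfl⟩
  | left => exact ⟨.left, rfl⟩
  | right => exact ⟨.right, rfl⟩
  | oracle f hf =>
    obtain rfl : f = g := hf
    exact ⟨.oracle, rfl⟩
  | pair _ _ hc hd =>
    obtain ⟨c, rfl⟩ := hc
    obtain ⟨d, rfl⟩ := hd
    exact ⟨.pair c d, rfl⟩
  | comp _ _ hc hd =>
    obtain ⟨c, rfl⟩ := hc
    obtain ⟨d, rfl⟩ := hd
    exact ⟨.comp c d, rfl⟩
  | prec _ _ hc hd =>
    obtain ⟨c, rfl⟩ := hc
    obtain ⟨d, rfl⟩ := hd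
    exact ⟨.prec c d, rfl⟩
  | rfind _ hc =>
    obtain ⟨c, rfl⟩ := hc
    exact ⟨.rfind c, rfl⟩

theorem exists_code_lookup : ∃ c : Code, ∀ (l : List ℕ) n,
    c.eval (Nat.pair (Encodable.encode l) n) = pfn l n := by
  have : Partrec fun q : ℕ =>
      (((Encodable.decode q.unpair.1 : Option (List ℕ)).getD [])[q.unpair.2]? : Part ℕ) :=
    Computable.ofOption (Primrec.to_comp (by fun_prop))
  obtain ⟨c, hc⟩ := Code.exists_code.1 (Partrec.nat_iff.1 this)
  exact ⟨c, fun l n => by rw [hc]; simp [pfn]⟩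

/-- A program for looking up an entry of a finite oracle. -/
noncomputable def lookupCode : Code := exists_code_lookup.choose

/-- The translation of programs with a finite oracle into programs without oracle, on numbers. -/
noncomputable def translate : ℕ → Code
  | 0 => .zero
  | 1 => .comp .succ .right
  | 2 => .comp .left .right
  | 3 => .comp .right .right
  | 4 => lookupCode
  | n + 5 =>
    have h : n / 4 < n + 5 := by omega
    have _h1 : (n / 4).unpair.1 < n + 5 := (Nat.unpair_left_le _).trans_lt h
    have _h2 : (n / 4).unpair.2 < n + 5 := (Nat.unpair_right_le _).trans_lt h
    if n % 4 = 0 then .pair (translate (n / 4).unpair.1) (translate (n / 4).unpair.2)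
    else if n % 4 = 1 then
      .comp (translate (n / 4).unpair.1) (.pair .left (translate (n / 4).unpair.2))
    else if n % 4 = 2 then
      -- The encoded oracle travels inside the parameter of the recursion. The inner pairing turns
      -- `((l, a), (y, i))` back into `(l, (a, (y, i)))`, the form that the translated step expects.
      .comp (.prec (translate (n / 4).unpair.1) (.comp (translate (n / 4).unpair.2)
        (.pair (.comp .left .left) (.pair (.comp .right .left) .right))))
        (.pair (.pair .left (.comp .left .right)) (.comp .right .right))
    else
      .comp (.rfind' (.comp (translate (n / 4))
        (.pair (.comp .left .left) (.pair (.comp .right .left) .right))))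
        (.pair (.pair .left .right) .zero)

/-- Course-of-values recursion: `G` computes a value from the list `L` of all earlier values, whose
length is the argument. -/
theorem primrec_translate : Primrec translate := by
  let G : List Code → Code := fun L =>
    let n := L.length - 5
    let A := L.getD (n / 4).unpair.1 .zero
    let B := L.getD (n / 4).unpair.2 .zero
    if L.length = 0 then .zero
    else if L.length = 1 then .comp .succ .right
    else if L.length = 2 then .comp .left .right
    else if L.length = 3 then .comp .right .right
    else if L.length = 4 then lookupCode
    else if n % 4 = 0 then .pair A B
    else if n % 4 = 1 then .comp A (.pair .left B)
    else if n % 4 = 2 then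
      .comp (.prec A (.comp B
        (.pair (.comp .left .left) (.pair (.comp .right .left) .right))))
        (.pair (.pair .left (.comp .left .right)) (.comp .right .right))
    else
      .comp (.rfind' (.comp (L.getD (n / 4) .zero)
        (.pair (.comp .left .left) (.pair (.comp .right .left) .right))))
        (.pair (.pair .left .right) .zero)
  have hG : Primrec G := by
    simp only [G]
    fun_prop
  have : Primrec₂ fun (_ : Unit) n => translate n := by
    refine Primrec.nat_strong_rec (fun (_ : Unit) n => translate n)
      (g := fun _ L => some (G L)) ?_ ?_
    · unfold Primrec₂
      fun_prop
    · intro _ n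
      have hget : ∀ m, m < n → ((List.range n).map translate).getD m .zero = translate m := by
        intro m hm
        simp [hm]
      simp only [G, List.length_map, List.length_range]
      match n with
      | 0 | 1 | 2 | 3 | 4 => simp [translate]
      | n + 5 =>
        have h : n / 4 < n + 5 := by omega
        have h1 : (n / 4).unpair.1 < n + 5 := (Nat.unpair_left_le _).trans_lt h
        have h2 : (n / 4).unpair.2 < n + 5 := (Nat.unpair_right_le _).trans_lt h
        rw [Nat.add_sub_cancel, hget _ h, hget _ h1, hget _ h2, translate]
        simp
  exact this.comp (Primrec.const ()) Primrec.id

attribute [fun_prop] primrec_translate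

theorem eval_comp_eq_bind (c d : Code) (n : ℕ) :
    (Code.comp c d).eval n = (d.eval n).bind fun a => c.eval a := rfl

theorem eval_pair_eq_bind (c d : Code) (n : ℕ) :
    (Code.pair c d).eval n = (c.eval n).bind fun a => (d.eval n).map (Nat.pair a) := by
  simp [Code.eval, Seq.seq]

theorem eval_left_pair (n : ℕ) : Code.left.eval n = Part.some n.unpair.1 := rfl

theorem eval_right_pair (n : ℕ) : Code.right.eval n = Part.some n.unpair.2 := rfl

/-- `rfind'` starts its search at the second component of its input; starting it at `0` gives
ordinary minimization. -/
theorem eval_rfind_pair_zero (c : Code) (a : ℕ) : (Code.rfind' c).eval (Nat.pair a 0) =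
    Nat.rfind fun n => (c.eval (Nat.pair a n)).map fun m => decide (m = 0) := by
  simp [Code.eval, Part.map_id']

/-- Makes oracle computations accessible to ordinary codes, hence to the primitive recursive
step-bounded evaluation `Code.evaln`. -/
theorem eval_translate (c : OracleCode) : ∀ (l : List ℕ) n,
    (translate c.index).eval (Nat.pair (Encodable.encode l) n) = c.eval (pfn l) n := by
  induction c with
  | zero => intro l n; simp [OracleCode.index, translate, OracleCode.eval, Code.eval]; rfl
  | succ | left | right =>
    intro l n
    simp only [OracleCode.index, translate, OracleCode.eval, eval_comp_eq_bind, eval_right_pair,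
      Part.bind_some, Nat.unpair_pair]
    try rfl
  | oracle =>
    intro l n
    simp only [OracleCode.index, translate]
    exact exists_code_lookup.choose_spec l n
  | pair c d ihc ihd =>
    intro l n
    simp [OracleCode.index, translate, OracleCode.eval, Code.eval, ihc, ihd]
  | comp c d ihc ihd =>
    intro l n
    have h1 : (4 * Nat.pair c.index d.index + 1) / 4 = Nat.pair c.index d.index := by omega
    have h2 : (4 * Nat.pair c.index d.index + 1) % 4 = 1 := by omega
    simp only [OracleCode.index, translate, h1, h2, one_ne_zero, if_true, if_false,
      Nat.unpair_pair, eval_comp_eq_bind, eval_pair_eq_bind, eval_left_pair, Part.bind_some, ihd,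
      Part.bind_map, ihc]
    rfl
  | prec c d ihc ihd =>
    intro l n
    have h1 : (4 * Nat.pair c.index d.index + 2) / 4 = Nat.pair c.index d.index := by omega
    have h2 : (4 * Nat.pair c.index d.index + 2) % 4 = 2 := by omega
    simp only [OracleCode.index, translate, h1, h2, OfNat.ofNat_ne_zero, OfNat.ofNat_ne_one,
      if_true, if_false, Nat.unpair_pair, eval_comp_eq_bind, eval_pair_eq_bind, eval_left_pair,
      eval_right_pair, Part.bind_some, Part.map_some, OracleCode.eval]
    induction n.unpair.2 with
    | zero => exact (Code.eval_prec_zero _ _ _).trans (ihc _ _)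
    | succ m ih =>
      rw [Code.eval_prec_succ, ih]
      refine congrArg _ (funext fun i => ?_)
      simp only [eval_comp_eq_bind, eval_pair_eq_bind, eval_left_pair, eval_right_pair,
        Part.bind_some, Part.map_some, Nat.unpair_pair, ihd]
  | rfind c ih =>
    intro l n
    have h1 : (4 * c.index + 3) / 4 = c.index := by omega
    have h2 : (4 * c.index + 3) % 4 = 3 := by omega
    have hz : ∀ m, Code.zero.eval m = Part.some 0 := fun _ => rfl
    simp only [OracleCode.index, translate, h1, h2, OfNat.ofNat_ne_zero, OfNat.ofNat_ne_one,
      if_false, Nat.unpair_pair, eval_comp_eq_bind, eval_pair_eq_bind, eval_left_pair,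
      eval_right_pair, Part.bind_some, Part.map_some, OracleCode.eval, hz, Nat.reduceEqDiff]
    rw [eval_rfind_pair_zero]
    refine congrArg _ (funext fun i => ?_)
    simp only [eval_comp_eq_bind, eval_pair_eq_bind, eval_left_pair, eval_right_pair,
      Part.bind_some, Part.map_some, Nat.unpair_pair, ih]
    rfl

end OracleCode
end Cupping

namespace Cupping
open Nat.Partrec (Code)

/-! ### Relative enumerability and relative computability by normal forms -/

section RelativeSigma

variable {α β γ δ : Type*} [Primcodable α] [Primcodable β] [Primcodable γ] [Primcodable δ]

/-- `p` is `Σ⁰₁` relative to `g`, in normal form. -/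
def SigIn (g : ℕ → ℕ) (p : α → Prop) : Prop :=
  ∃ R : List ℕ → α → Bool, (Primrec fun q : List ℕ × α => R q.1 q.2) ∧
    ∀ a, p a ↔ ∃ k, R (pre g k) a = true

variable {g : ℕ → ℕ}

theorem SigIn.of_iff {p q : α → Prop} (hp : SigIn g p) (h : ∀ a, q a ↔ p a) : SigIn g q := by
  obtain ⟨R, hR, H⟩ := hp
  exact ⟨R, hR, fun a => (h a).trans (H a)⟩

theorem SigIn.of_primrec {p : α → Prop} [DecidablePred p] (hp : Primrec fun a => decide (p a)) :
    SigIn g p :=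
  ⟨fun _ a => decide (p a), hp.comp Primrec.snd, fun a => by simp⟩

theorem take_pre_min (g : ℕ → ℕ) (i k : ℕ) : (pre g k).take i = pre g (min i k) := by
  rcases le_total i k with h | h
  · rw [take_pre g h, min_eq_left h]
  · rw [List.take_of_length_le (by simpa using h), min_eq_right h]

/-- Letting a list accept when one of its prefixes does makes the matrix monotone; conjunctions and
bounded quantifiers can then share one prefix. -/
theorem SigIn.exists_mono {p : α → Prop} (hp : SigIn g p) :
    ∃ R : List ℕ → α → Bool, (Primrec fun q : List ℕ × α => R q.1 q.2) ∧
      (∀ a, p a ↔ ∃ k, R (pre g k) a = true) ∧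
      ∀ l l' a, l <+: l' → R l a = true → R l' a = true := by
  obtain ⟨R, hR, H⟩ := hp
  refine ⟨fun l a => decide (∃ i < l.length + 1, R (l.take i) a = true), ?_, ?_, ?_⟩
  · have : Primrec fun q : (List ℕ × α) × ℕ => R (q.1.1.take q.2) q.1.2 :=
      hR.comp (f := fun q : List ℕ × α => R q.1 q.2)
        (g := fun q : (List ℕ × α) × ℕ => (q.1.1.take q.2, q.1.2)) (by fun_prop)
    fun_prop
  · intro a
    rw [H a]
    constructor
    · rintro ⟨k, hk⟩
      exact ⟨k, by simpa using ⟨k, by omega, by rwa [take_pre g le_rfl]⟩⟩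
    · rintro ⟨k, hk⟩
      obtain ⟨i, -, hi⟩ := of_decide_eq_true hk
      rw [take_pre_min] at hi
      exact ⟨_, hi⟩
  · rintro l l' a hl h
    obtain ⟨i, hi, hR⟩ := of_decide_eq_true h
    refine decide_eq_true ⟨i, hi.trans_le (by simpa using hl.length_le), ?_⟩
    obtain ⟨t, rfl⟩ := hl
    rwa [List.take_append_of_le_length (by omega)]

/-- The length of the oracle prefix doubles as a step bound, and all shorter prefixes are tried, so
that convergence becomes a primitive recursive matrix. -/
theorem SigIn.of_code {p : α → Prop} (c : Code)
    (h : ∀ a, p a ↔ ∃ k, (c.eval (Nat.pair (Encodable.encode (pre g k))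
      (Encodable.encode a))).Dom) : SigIn g p := by
  refine ⟨fun l a => decide (∃ i < l.length + 1, (Code.evaln l.length c (Nat.pair
    (Encodable.encode (l.take i)) (Encodable.encode a))).isSome = true), by fun_prop, fun a => ?_⟩
  rw [h a]
  constructor
  · rintro ⟨k, hk⟩
    obtain ⟨x, hx⟩ := Part.dom_iff_mem.1 hk
    obtain ⟨u, hu⟩ := Code.evaln_complete.1 hx
    refine ⟨max k u, decide_eq_true ⟨k, by simp, ?_⟩⟩
    rw [take_pre _ (le_max_left _ _), length_pre]
    exact Option.isSome_iff_exists.2 ⟨x, Code.evaln_mono (le_max_right _ _) hu⟩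
  · rintro ⟨k, hk⟩
    obtain ⟨i, -, hi⟩ := of_decide_eq_true hk
    rw [take_pre_min] at hi
    obtain ⟨x, hx⟩ := Option.isSome_iff_exists.1 hi
    exact ⟨_, Part.dom_iff_mem.2 ⟨x, Code.evaln_sound hx⟩⟩

theorem exists_code_of_re {p : α → Prop} (hp : REPred p) :
    ∃ c : Code, ∀ a, p a ↔ (c.eval (Encodable.encode a)).Dom := by
  obtain ⟨c, hc⟩ := Code.exists_code.1 hp
  exact ⟨c, fun a => by rw [hc]; simp [Part.assert]⟩

theorem SigIn.of_re {p : α → Prop} {R : List ℕ → α → Prop}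
    (hR : REPred fun q : List ℕ × α => R q.1 q.2) (h : ∀ a, p a ↔ ∃ k, R (pre g k) a) :
    SigIn g p := by
  obtain ⟨c, hc⟩ := exists_code_of_re hR
  exact SigIn.of_code c fun a => (h a).trans (exists_congr fun k => hc (pre g k, a))

theorem SigIn.of_rePred {p : α → Prop} (hp : REPred p) : SigIn g p := by
  obtain ⟨c, hc⟩ := exists_code_of_re hp
  refine SigIn.of_code (.comp c .right) fun a => ?_
  have : ∀ k, (Code.comp c .right).eval (Nat.pair (Encodable.encode (pre g k))
      (Encodable.encode a)) = c.eval (Encodable.encode a) := by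
    intro k
    simp only [eval_comp_eq_bind, eval_right_pair, Nat.unpair_pair, Part.bind_some]
  simp [this, hc a]

theorem SigIn.exists_code {p : α → Prop} (hp : SigIn g p) : ∃ c : Code,
    ∀ a, p a ↔ ∃ k, (c.eval (Nat.pair (Encodable.encode (pre g k)) (Encodable.encode a))).Dom := by
  obtain ⟨R, hR, H⟩ := hp
  have : REPred fun q : List ℕ × α => R q.1 q.2 = true :=
    (Primrec.primrecPred (by fun_prop : Primrec fun q : List ℕ × α =>
      decide (R q.1 q.2 = true))).computablePred.to_re
  obtain ⟨c, hc⟩ := exists_code_of_re this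
  exact ⟨c, fun a => (H a).trans (exists_congr fun k => hc (pre g k, a))⟩

theorem SigIn.and {p q : α → Prop} (hp : SigIn g p) (hq : SigIn g q) :
    SigIn g fun a => p a ∧ q a := by
  obtain ⟨R, hR, H, hm⟩ := hp.exists_mono
  obtain ⟨R', hR', H', hm'⟩ := hq.exists_mono
  refine ⟨fun l a => R l a && R' l a, Primrec.and.comp hR hR', fun a => ?_⟩
  simp only [H, H', Bool.and_eq_true]
  constructor
  · rintro ⟨⟨k, hk⟩, k', hk'⟩
    exact ⟨max k k', hm _ _ _ (pre_prefix g (le_max_left _ _)) hk,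
      hm' _ _ _ (pre_prefix g (le_max_right _ _)) hk'⟩
  · rintro ⟨k, hk, hk'⟩
    exact ⟨⟨k, hk⟩, k, hk'⟩

theorem SigIn.or {p q : α → Prop} (hp : SigIn g p) (hq : SigIn g q) :
    SigIn g fun a => p a ∨ q a := by
  obtain ⟨R, hR, H⟩ := hp
  obtain ⟨R', hR', H'⟩ := hq
  refine ⟨fun l a => R l a || R' l a, Primrec.or.comp hR hR', fun a => ?_⟩
  simp only [H, H', Bool.or_eq_true, exists_or]

/-- The length of the prefix also bounds the code of the witness. -/
theorem SigIn.ex {p : α → β → Prop} (hp : SigIn g fun q : α × β => p q.1 q.2) :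
    SigIn g fun a => ∃ b, p a b := by
  obtain ⟨R, hR, H, hm⟩ := hp.exists_mono
  refine ⟨fun l a => decide (∃ n < l.length,
    ((Encodable.decode n : Option β).map fun b => R l (a, b)).getD false = true), ?_, fun a => ?_⟩
  · have : Primrec fun q : (List ℕ × α) × ℕ =>
        ((Encodable.decode q.2 : Option β).map fun b => R q.1.1 (q.1.2, b)) :=
      Primrec.option_map (g := fun (q : (List ℕ × α) × ℕ) b => R q.1.1 (q.1.2, b)) (by fun_prop)
        (hR.comp (g := fun q : ((List ℕ × α) × ℕ) × β => (q.1.1.1, (q.1.1.2, q.2))) (by fun_prop))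
    fun_prop
  · constructor
    · rintro ⟨b, hb⟩
      obtain ⟨k, hk⟩ := (H (a, b)).1 hb
      refine ⟨max k (Encodable.encode b + 1), decide_eq_true ⟨Encodable.encode b, ?_, ?_⟩⟩
      · rw [length_pre]
        omega
      · simpa using hm _ _ _ (pre_prefix g (le_max_left _ _)) hk
    · rintro ⟨k, hk⟩
      obtain ⟨n, -, hn⟩ := of_decide_eq_true hk
      cases hd : (Encodable.decode n : Option β) with
      | none => simp [hd] at hn
      | some b => exact ⟨b, (H (a, b)).2 ⟨k, by simpa [hd] using hn⟩⟩

/-- The total function `f` is computable relative to `g`. -/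
@[fun_prop]
def FunIn (f : α → β) (g : ℕ → ℕ) : Prop := SigIn g fun q : α × β => q.2 = f q.1

theorem SigIn.comp_computable {p : β → Prop} {f : α → β} (hp : SigIn g p) (hf : Computable f) :
    SigIn g fun a => p (f a) := by
  obtain ⟨R, hR, H⟩ := hp
  refine SigIn.of_re (R := fun l a => R l (f a) = true) ?_ fun a => H (f a)
  exact (Computable.computablePred (p := fun q : List ℕ × α => R q.1 (f q.2) = true)
    ((hR.to_comp.comp (Computable.fst.pair (hf.comp Computable.snd))).of_eq
      fun q => by simp)).to_re

theorem SigIn.comp_primrec {p : β → Prop} {f : α → β} (hp : SigIn g p) (hf : Primrec f) :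
    SigIn g fun a => p (f a) := hp.comp_computable hf.to_comp

theorem SigIn.comp {p : β → Prop} {f : α → β} (hp : SigIn g p) (hf : FunIn f g) :
    SigIn g fun a => p (f a) := by
  refine (SigIn.ex (p := fun a b => b = f a ∧ p b)
    (SigIn.and hf (hp.comp_primrec (f := fun q : α × β => q.2) (by fun_prop)))).of_iff fun a => ?_
  simp

@[fun_prop]
theorem FunIn.of_primrec {f : α → β} (hf : Primrec f) : FunIn f g := by
  have : DecidableEq β := Encodable.decidableEqOfEncodable β
  exact SigIn.of_primrec (by fun_prop)

@[fun_prop]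
theorem FunIn.id : FunIn (fun a : α => a) g := FunIn.of_primrec Primrec.id

@[fun_prop]
theorem FunIn.comp {f : β → γ} {h : α → β} (hf : FunIn f g) (hh : FunIn h g) :
    FunIn (fun a => f (h a)) g := by
  have := SigIn.ex (g := g) (p := fun (q : α × γ) (b : β) => b = h q.1 ∧ q.2 = f b)
    (SigIn.and (hh.comp_primrec (f := fun q : (α × γ) × β => (q.1.1, q.2)) (by fun_prop))
      (hf.comp_primrec (f := fun q : (α × γ) × β => (q.2, q.1.2)) (by fun_prop)))
  exact this.of_iff fun a => by simp

@[fun_prop]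
theorem FunIn.pair {f : α → β} {h : α → γ} (hf : FunIn f g) (hh : FunIn h g) :
    FunIn (fun a => (f a, h a)) g := by
  refine (SigIn.and (hf.comp_primrec (f := fun q : α × (β × γ) => (q.1, q.2.1)) (by fun_prop))
      (hh.comp_primrec (f := fun q : α × (β × γ) => (q.1, q.2.2)) (by fun_prop))).of_iff
        fun a => by simp [Prod.ext_iff]

@[fun_prop]
theorem FunIn.fst {f : α → β × γ} (hf : FunIn f g) : FunIn (fun a => (f a).1) g :=
  (FunIn.of_primrec Primrec.fst).comp hf

@[fun_prop]
theorem FunIn.snd {f : α → β × γ} (hf : FunIn f g) : FunIn (fun a => (f a).2) g :=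
  (FunIn.of_primrec Primrec.snd).comp hf

theorem FunIn.oracle : FunIn g g := by
  refine ⟨fun l q => decide (l[q.1]? = some q.2), by fun_prop, fun q => ?_⟩
  simp only [decide_eq_true_eq]
  constructor
  · intro h
    exact ⟨q.1 + 1, by simp [pre, h]⟩
  · rintro ⟨k, hk⟩
    have : q.2 ∈ pfn (pre g k) q.1 := by simp [pfn, hk]
    exact (mem_pfn_pre.1 this).2

/-- Finitely many instances have a common accepting prefix, by monotonicity of the matrix. -/
theorem SigIn.forall_lt {f : α → ℕ} {p : α → ℕ → Prop} (hf : FunIn f g)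
    (hp : SigIn g fun q : α × ℕ => p q.1 q.2) : SigIn g fun a => ∀ i < f a, p a i := by
  obtain ⟨R, hR, H, hm⟩ := hp.exists_mono
  have h1 : SigIn g fun q : α × ℕ => ∀ i < q.2, p q.1 i := by
    refine ⟨fun l q => decide (∀ i < q.2, R l (q.1, i) = true), ?_, fun q => ?_⟩
    · have : Primrec fun q : (List ℕ × α × ℕ) × ℕ => R q.1.1 (q.1.2.1, q.2) :=
        hR.comp (g := fun q : (List ℕ × α × ℕ) × ℕ => (q.1.1, (q.1.2.1, q.2))) (by fun_prop)
      fun_prop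
    · simp only [decide_eq_true_eq]
      constructor
      · intro h
        exact exists_bound_of_forall_lt (P := fun i k => R (pre g k) (q.1, i) = true)
          (fun m i k hik => hm _ _ _ (pre_prefix g hik)) q.2 fun m hmq => (H (q.1, m)).1 (h m hmq)
      · rintro ⟨k, hk⟩ i hi
        exact (H (q.1, i)).2 ⟨k, hk i hi⟩
  exact h1.comp (f := fun a => (a, f a)) (by fun_prop)

-- The graph says that the list has the right length and the right entries, a bounded
-- quantification. This yields initial segments of computable functions, and with them transitivity.
@[fun_prop]
theorem FunIn.map_range {f : α → ℕ} {h : α → ℕ → β} (hf : FunIn f g)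
    (hh : FunIn (fun q : α × ℕ => h q.1 q.2) g) : FunIn (fun a => (List.range (f a)).map (h a)) g := by
  have h0 : SigIn g fun q : α × List β => q.2.length = f q.1 :=
    SigIn.comp (p := fun q : ℕ × ℕ => q.1 = q.2) (SigIn.of_primrec (by fun_prop))
      (f := fun q : α × List β => (q.2.length, f q.1)) (by fun_prop)
  have h1 : SigIn g fun q : α × List β => ∀ i < f q.1, q.2[i]? = some (h q.1 i) := by
    refine SigIn.forall_lt (by fun_prop) ?_
    have : DecidableEq β := Encodable.decidableEqOfEncodable β
    exact SigIn.comp (p := fun q : Option β × β => q.1 = some q.2) (SigIn.of_primrec (by fun_prop))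
      (f := fun q : (α × List β) × ℕ => (q.1.2[q.2]?, h q.1.1 q.2))
      (FunIn.pair (FunIn.of_primrec (by fun_prop))
        (hh.comp (h := fun q : (α × List β) × ℕ => (q.1.1, q.2)) (by fun_prop)))
  refine (h0.and h1).of_iff fun q => ⟨fun hq => ?_, fun ⟨hl, hq⟩ => ?_⟩
  · rw [hq]
    simp +contextual
  · apply List.ext_getElem?
    intro i
    by_cases hi : i < f q.1
    · rw [hq i hi]
      simp [hi]
    · simp [List.getElem?_eq_none (l := q.2) (i := i) (by omega), hi]

theorem FunIn.pre {h : ℕ → ℕ} (hh : FunIn h g) : FunIn (pre h) g :=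
  FunIn.map_range FunIn.id (by fun_prop)

/-- Relative computability is transitive. -/
theorem SigIn.trans {h : ℕ → ℕ} {p : α → Prop} (hp : SigIn h p) (hh : FunIn h g) : SigIn g p := by
  obtain ⟨R, hR, H⟩ := hp
  refine (SigIn.ex (p := fun a k => R (Cupping.pre h k) a = true) ?_).of_iff H
  exact SigIn.comp (p := fun q : List ℕ × α => R q.1 q.2 = true)
    (SigIn.of_primrec (by simpa using hR)) (f := fun q : α × ℕ => (Cupping.pre h q.2, q.1))
    (FunIn.pair (hh.pre.comp (by fun_prop)) (by fun_prop))

theorem FunIn.trans {h : ℕ → ℕ} {f : α → β} (hf : FunIn f h) (hh : FunIn h g) : FunIn f g :=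
  SigIn.trans hf hh

-- Post's theorem, relativized.
open Classical in
theorem FunIn.decide {p : α → Prop} (hp : SigIn g p) (hn : SigIn g fun a => ¬ p a) :
    FunIn (fun a => decide (p a)) g := by
  have h1 : SigIn g fun q : α × Bool => q.2 = true ∧ p q.1 :=
    SigIn.and (SigIn.of_primrec (by fun_prop)) (hp.comp_primrec Primrec.fst)
  have h2 : SigIn g fun q : α × Bool => q.2 = false ∧ ¬ p q.1 :=
    SigIn.and (SigIn.of_primrec (by fun_prop)) (hn.comp_primrec Primrec.fst)
  refine (h1.or h2).of_iff fun q => ?_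
  by_cases h : p q.1 <;> simp [h]

theorem recursiveIn_pre (g : ℕ → ℕ) :
    Nat.RecursiveIn {tot g} fun n => Part.some (Encodable.encode (pre g n)) := by
  have hS : Nat.Primrec fun q => Encodable.encode
      ((Encodable.decode q.unpair.2 : Option (List ℕ)).getD [] ++ [q.unpair.1]) :=
    Primrec.nat_iff.1 (by fun_prop)
  have hrr : Nat.RecursiveIn {tot g} (fun n => Part.some (n.unpair.2.unpair.2)) :=
    (Nat.Primrec.recursiveIn (f := fun n => n.unpair.2.unpair.2) (Primrec.nat_iff.1 (by fun_prop)))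
  have hrl : Nat.RecursiveIn {tot g} (fun n => Part.some (n.unpair.2.unpair.1)) :=
    (Nat.Primrec.recursiveIn (f := fun n => n.unpair.2.unpair.1) (Primrec.nat_iff.1 (by fun_prop)))
  have hstep := (hS.recursiveIn (O := {tot g})).comp
    (((Nat.RecursiveIn.oracle (tot g) (Set.mem_singleton _)).comp hrl).pair hrr)
  have hrec := (Nat.RecursiveIn.zero (O := {tot g})).prec hstep
  have hp : Nat.RecursiveIn {tot g} (fun n => Part.some (Nat.pair 0 n)) :=
    (Nat.Primrec.recursiveIn (f := fun n => Nat.pair 0 n) (Primrec.nat_iff.1 (by fun_prop)))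
  refine (hrec.comp hp).of_eq fun n => ?_
  refine (Part.bind_some _ _).trans ?_
  simp only [Nat.unpair_pair]
  induction n with
  | zero => rfl
  | succ n ih =>
    refine (congrArg (fun z : Part ℕ => z.bind _) ih).trans ?_
    rw [pre_succ]
    have ht : (Part.some n >>= tot g) = Part.some (g n) := Part.bind_some _ _
    simp [ht, Seq.seq]

theorem recursiveIn_rfind_map {O : Set (ℕ →. ℕ)} {D E : ℕ → ℕ}
    (hD : Nat.RecursiveIn O fun n => Part.some (D n)) (hE : Nat.Primrec E) :
    Nat.RecursiveIn O fun n =>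
      (Nat.rfind fun t => Part.some (decide (D (Nat.pair n t) = 0))).map E := by
  refine ((hE.recursiveIn (O := O)).comp hD.rfind).of_eq fun n => ?_
  simp only [Part.map_eq_map, Part.map_some]
  exact Part.bind_some_eq_map _ _

theorem rePred_exists {p : α → ℕ → Bool} (hp : Primrec fun q : α × ℕ => p q.1 q.2) :
    REPred fun a => ∃ k, p a k = true := by
  have hR : Partrec fun a => Nat.rfind fun k => Part.some (p a k) :=
    Partrec.rfind hp.to_comp.partrec
  refine hR.dom_re.of_eq fun a => Nat.rfind_dom.trans ?_
  simp

/-- Relative computability of partial functions in terms of the graph. -/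
theorem sigIn_of_recursiveIn {F : α →. β} (h : RecursiveIn {tot g} F) :
    SigIn g fun q : α × β => q.2 ∈ F q.1 := by
  obtain ⟨c, hc⟩ := exists_oracleCode h
  refine SigIn.of_re (R := fun l (q : α × β) => ∃ k, decide (Code.evaln k (translate c.index)
    (Nat.pair (Encodable.encode l) (Encodable.encode q.1)) = some (Encodable.encode q.2)) = true)
    (rePred_exists (p := fun (q : List ℕ × (α × β)) k =>
    decide (Code.evaln k (translate c.index) (Nat.pair (Encodable.encode q.1)
      (Encodable.encode q.2.1)) = some (Encodable.encode q.2.2))) (by fun_prop)) fun q => ?_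
  have : q.2 ∈ F q.1 ↔ Encodable.encode q.2 ∈ c.eval (tot g) (Encodable.encode q.1) := by
    rw [hc]
    simp
  rw [this, c.mem_eval_iff]
  simp only [← eval_translate, Code.evaln_complete, Option.mem_def, decide_eq_true_eq]

theorem recursiveIn_pre_comp {D : ℕ → List ℕ → ℕ → ℕ}
    (hD : Primrec fun z : ℕ × List ℕ × ℕ => D z.1 z.2.1 z.2.2) : Nat.RecursiveIn {tot g} fun m =>
      Part.some (D m.unpair.1 (pre g m.unpair.2.unpair.1) m.unpair.2.unpair.2) := by
  have h1 : Nat.RecursiveIn {tot g} fun m =>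
      Part.some (Encodable.encode (pre g m.unpair.2.unpair.1)) := by
    refine ((recursiveIn_pre g).comp (Nat.Primrec.recursiveIn (f := fun n => n.unpair.2.unpair.1)
      (Primrec.nat_iff.1 (by fun_prop)))).of_eq fun n => Part.bind_some _ _
  have h2 : Nat.Primrec fun z : ℕ => D z.unpair.2.unpair.1
      ((Encodable.decode z.unpair.1 : Option (List ℕ)).getD []) z.unpair.2.unpair.2.unpair.2 := by
    refine Primrec.nat_iff.1 ?_
    exact hD.comp (g := fun z : ℕ => (z.unpair.2.unpair.1,
      (Encodable.decode z.unpair.1 : Option (List ℕ)).getD [], z.unpair.2.unpair.2.unpair.2))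
      (by fun_prop)
  refine ((h2.recursiveIn (O := {tot g})).comp (h1.pair (Nat.Primrec.recursiveIn
    (f := fun n => n) (Primrec.nat_iff.1 Primrec.id)))).of_eq fun n => ?_
  simp [Seq.seq]

/-- Search for a number coding a prefix length together with a value that the matrix accepts, then
extract the value. The test `D` returns `0` for success because minimization looks for a zero.
Different successful searches agree since `F` is single-valued. -/
theorem SigIn.recursiveIn {F : α →. β} (h : SigIn g fun q : α × β => q.2 ∈ F q.1) :
    RecursiveIn {tot g} F := by
  obtain ⟨R, hR, H⟩ := h
  let D' : ℕ → List ℕ → ℕ → Bool := fun n l t =>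
    ((Encodable.decode (Nat.pair n t) : Option (α × β)).map fun q => R l q).getD false
  have hD' : Primrec fun z : ℕ × List ℕ × ℕ => D' z.1 z.2.1 z.2.2 := by
    have : Primrec fun z : ℕ × List ℕ × ℕ =>
        ((Encodable.decode (Nat.pair z.1 z.2.2) : Option (α × β)).map fun q => R z.2.1 q) :=
      Primrec.option_map (by fun_prop) (hR.comp (g := fun z : (ℕ × List ℕ × ℕ) × (α × β) =>
        (z.1.2.1, z.2)) (by fun_prop))
    simp only [D']
    fun_prop
  let E : ℕ → ℕ := fun t =>
    ((Encodable.decode t.unpair.2 : Option β).map Encodable.encode).getD 0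
  have hE : Nat.Primrec E := by
    have : Primrec fun t : ℕ => (Encodable.decode t.unpair.2 : Option β).map Encodable.encode :=
      Primrec.option_map (by fun_prop) (Primrec.encode.comp Primrec.snd)
    refine Primrec.nat_iff.1 ?_
    simp only [E]
    fun_prop
  let D : ℕ → List ℕ → ℕ → ℕ := fun n l t => if D' n l t = true then 0 else 1
  have hD := recursiveIn_pre_comp (g := g) (D := D) (by simp only [D]; fun_prop)
  refine (recursiveIn_rfind_map hD hE).of_eq fun n => Part.ext fun y => ?_
  have hDz : ∀ m : ℕ, D n (pre g m.unpair.1) m.unpair.2 = 0 ↔ ∃ a b, Encodable.decode n = some a ∧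
      Encodable.decode m.unpair.2 = some b ∧ R (pre g m.unpair.1) (a, b) = true := by
    intro m
    simp only [D, D']
    cases h : (Encodable.decode n : Option α) <;>
      cases h' : (Encodable.decode m.unpair.2 : Option β) <;> simp [h, h']
  have hEz : ∀ m (b : β), Encodable.decode m.unpair.2 = some b → E m = Encodable.encode b := by
    intro m b h
    simp [E, h]
  simp only [Nat.unpair_pair, Part.mem_map_iff, Part.mem_bind_iff, Part.mem_ofOption, Option.mem_def]
  constructor
  · rintro ⟨m, hm, rfl⟩
    have hm := of_decide_eq_true (Part.mem_some_iff.1 (Nat.rfind_spec hm)).symm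
    obtain ⟨a, b, ha, hb, hR⟩ := (hDz m).1 hm
    exact ⟨a, ha, b, (H (a, b)).2 ⟨_, hR⟩, (hEz m b hb).symm⟩
  · rintro ⟨a, ha, b, hb, rfl⟩
    obtain ⟨k, hk⟩ := (H (a, b)).1 hb
    have hdom : (Nat.rfind fun m => Part.some (decide
        (D n (pre g m.unpair.1) m.unpair.2 = 0))).Dom := by
      refine Nat.rfind_dom.2 ⟨Nat.pair k (Encodable.encode b), ?_, fun _ => trivial⟩
      refine Part.mem_some_iff.2 (decide_eq_true ?_).symm
      exact (hDz _).2 ⟨a, b, ha, by simp, by simpa using hk⟩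
    obtain ⟨m, hm⟩ := Part.dom_iff_mem.1 hdom
    refine ⟨m, hm, ?_⟩
    have hm := of_decide_eq_true (Part.mem_some_iff.1 (Nat.rfind_spec hm)).symm
    obtain ⟨a', b', ha', hb', hR⟩ := (hDz m).1 hm
    obtain rfl : a = a' := Option.some_injective _ (ha.symm.trans ha')
    rw [hEz m b' hb', Part.mem_unique hb ((H (a, b')).2 ⟨_, hR⟩)]

theorem recursiveIn_iff_sigIn {F : α →. β} :
    RecursiveIn {tot g} F ↔ SigIn g fun q : α × β => q.2 ∈ F q.1 :=
  ⟨sigIn_of_recursiveIn, SigIn.recursiveIn⟩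

theorem recursiveIn_some_iff_funIn {f : α → β} :
    RecursiveIn {tot g} (fun a => Part.some (f a)) ↔ FunIn f g := by
  refine recursiveIn_iff_sigIn.trans ?_
  simp only [FunIn, Part.mem_some_iff]

theorem turingLE_iff_funIn {A B : Set ℕ} : TuringLE A B ↔ FunIn (charFun A) (charFun B) :=
  recursiveIn_some_iff_funIn

theorem isCEIn_iff_sigIn {A : Set ℕ} {p : α → Prop} : IsCEIn A p ↔ SigIn (charFun A) p := by
  refine recursiveIn_iff_sigIn.trans ⟨fun h => ?_, fun h => ?_⟩
  · exact (h.comp_primrec (f := fun a => (a, ())) (by fun_prop)).of_iff fun a => by simp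
  · exact (h.comp_primrec (f := fun q : α × Unit => q.1) (by fun_prop)).of_iff fun a => by simp

theorem sigIn_charFun {A : Set ℕ} : SigIn (charFun A) fun n => n ∈ A := by
  refine (SigIn.comp (p := fun b : ℕ => b = 1) (SigIn.of_primrec (by fun_prop))
    FunIn.oracle).of_iff fun n => ?_
  by_cases h : n ∈ A <;> simp [charFun, h]

theorem sigIn_charFun_not {A : Set ℕ} : SigIn (charFun A) fun n => n ∉ A := by
  refine (SigIn.comp (p := fun b : ℕ => b = 0) (SigIn.of_primrec (by fun_prop))
    FunIn.oracle).of_iff fun n => ?_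
  by_cases h : n ∈ A <;> simp [charFun, h]

theorem funIn_charFun_of_sigIn {A : Set ℕ} (h : SigIn g fun n => n ∈ A)
    (h' : SigIn g fun n => n ∉ A) : FunIn (charFun A) g := by
  have := (FunIn.of_primrec (f := fun b : Bool => if b = true then 1 else 0)
    (by fun_prop)).comp (FunIn.decide h h')
  refine this.of_iff fun q => ?_
  by_cases hq : q.1 ∈ A <;> simp [charFun, hq]

end RelativeSigma
end Cupping

namespace Cupping
open Nat.Partrec (Code)

/-! ### The halting problem, approximations to c.e. sets and the limit lemma -/

section Halting

variable {α β : Type*} [Primcodable α] [Primcodable β] {g : ℕ → ℕ}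

theorem SigIn.comp_decide {p : β → Prop} [DecidablePred p] (hp : Primrec fun b => decide (p b))
    {f : α → β} (hf : FunIn f g) : SigIn g fun a => p (f a) := (SigIn.of_primrec hp).comp hf

/-- By the s-m-n theorem, `f n` is an index of a function that ignores its input and behaves like `F
n`. It transfers both completeness of `∅'` and diagonal noncomputability. -/
theorem exists_self_halting {F : ℕ →. ℕ} (hF : Nat.Partrec F) :
    ∃ f : ℕ → ℕ, Primrec f ∧ ∀ n, phi (f n) (f n) = F n := by
  obtain ⟨c, hc⟩ := Code.exists_code.1 hF
  refine ⟨fun n => Encodable.encode ((c.comp Code.left).curry n), ?_, fun n => ?_⟩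
  · exact Primrec.encode.comp (Code.primrec₂_curry.comp (Primrec.const _) Primrec.id)
  · rw [phi, Denumerable.ofNat_encode, Code.eval_curry, eval_comp_eq_bind, eval_left_pair,
      Part.bind_some, Nat.unpair_pair, hc]

theorem exists_reduction_haltingSet {p : α → Prop} (hp : REPred p) :
    ∃ f : α → ℕ, Primrec f ∧ ∀ a, p a ↔ f a ∈ haltingSet := by
  obtain ⟨c, hc⟩ := exists_code_of_re hp
  obtain ⟨f, hf, hf'⟩ := exists_self_halting (F := c.eval) (Code.exists_code.2 ⟨c, rfl⟩)
  refine ⟨fun a => f (Encodable.encode a), by fun_prop, fun a => ?_⟩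
  rw [hc, haltingSet, Set.mem_ofPred_eq, hf']

theorem sigIn_haltingSet_not_of_re {p : α → Prop} (hp : REPred p) :
    SigIn (charFun haltingSet) fun a => ¬ p a := by
  obtain ⟨f, hf, h⟩ := exists_reduction_haltingSet hp
  exact (sigIn_charFun_not.comp_primrec hf).of_iff fun a => not_congr (h a)

theorem isCE_haltingSet : IsCE haltingSet := by
  have : Partrec fun e : ℕ => (Denumerable.ofNat Code e).eval e :=
    Code.eval_part.comp (Computable.ofNat _) Computable.id
  exact this.dom_re

/-- A computable approximation from below of the characteristic function of `A`. -/
structure IsApprox (A : Set ℕ) (as : ℕ → ℕ → ℕ) : Prop where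
  primrec : Primrec fun q : ℕ × ℕ => as q.1 q.2
  le_charFun : ∀ s n, as s n ≤ charFun A n
  mono : ∀ s t n, s ≤ t → as s n ≤ as t n
  exists_eq : ∀ n, ∃ s, as s n = charFun A n

theorem IsCE.exists_isApprox {A : Set ℕ} (hA : IsCE A) : ∃ as, IsApprox A as := by
  obtain ⟨c, hc⟩ := exists_code_of_re hA
  refine ⟨fun s n => if (Code.evaln s c n).isSome = true then 1 else 0, by fun_prop, fun s n => ?_,
    fun s t n hst => ?_, fun n => ?_⟩
  · split_ifs with h
    · have : n ∈ A := by
        obtain ⟨x, hx⟩ := Option.isSome_iff_exists.1 h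
        exact (hc n).2 (Part.dom_iff_mem.2 ⟨x, Code.evaln_sound hx⟩)
      simp [charFun, this]
    · exact Nat.zero_le _
  · split_ifs with h h'
    · exact le_rfl
    · obtain ⟨x, hx⟩ := Option.isSome_iff_exists.1 h
      exact absurd (Option.isSome_iff_exists.2 ⟨x, Code.evaln_mono hst hx⟩) h'
    · exact Nat.zero_le _
    · exact le_rfl
  · by_cases h : n ∈ A
    · obtain ⟨x, hx⟩ := Part.dom_iff_mem.1 ((hc n).1 h)
      obtain ⟨s, hs⟩ := Code.evaln_complete.1 hx
      refine ⟨s, ?_⟩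
      rw [if_pos (Option.isSome_iff_exists.2 ⟨x, hs⟩ : (Code.evaln s c n).isSome = true)]
      simp [charFun, h]
    · refine ⟨0, ?_⟩
      rw [if_neg]
      · simp [charFun, h]
      · intro h'
        obtain ⟨x, hx⟩ := Option.isSome_iff_exists.1 h'
        exact h ((hc n).2 (Part.dom_iff_mem.2 ⟨x, Code.evaln_sound hx⟩))

theorem charFun_le_one (A : Set ℕ) (n : ℕ) : charFun A n ≤ 1 := by
  unfold charFun; split_ifs <;> omega

theorem charFun_eq_one {A : Set ℕ} {n : ℕ} : charFun A n = 1 ↔ n ∈ A := by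
  unfold charFun; split_ifs with h <;> simp [h]

namespace IsApprox

variable {A : Set ℕ} {as : ℕ → ℕ → ℕ} (h : IsApprox A as)
include h

theorem eq_of_le {s t n : ℕ} (hst : s ≤ t) (hs : as s n = charFun A n) :
    as t n = charFun A n :=
  le_antisymm (h.le_charFun t n) (hs ▸ h.mono s t n hst)

/-- An approximation from below that is correct on an initial segment stays correct there. This is
the use made of enumerability of `A` in the joining argument. -/
theorem pre_eq_of_le {s t u : ℕ} (hst : s ≤ t) (hs : pre (as s) u = pre (charFun A) u) :
    pre (as t) u = pre (charFun A) u := by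
  refine pre_congr fun i hi => h.eq_of_le hst ?_
  have := congrArg (fun l : List ℕ => l[i]?) hs
  simpa [pre, hi] using this

theorem exists_pre_eq (u : ℕ) : ∃ s, pre (as s) u = pre (charFun A) u := by
  obtain ⟨k, hk⟩ := exists_bound_of_forall_lt (P := fun n s => as s n = charFun A n)
    (fun m i k hik => h.eq_of_le hik) u fun n _ => h.exists_eq n
  exact ⟨k, pre_congr hk⟩

theorem primrec_pre {α : Type*} [Primcodable α] {s u : α → ℕ} (hs : Primrec s) (hu : Primrec u) :
    Primrec fun a => pre (as (s a)) (u a) := by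
  have := h.primrec
  exact PR.map (g := fun a => as (s a)) (Primrec.list_range.comp hu) (by fun_prop)

end IsApprox

theorem charFun_congr {A B : Set ℕ} {m n : ℕ} (h : m ∈ A ↔ n ∈ B) : charFun A m = charFun B n := by
  unfold charFun
  by_cases hm : m ∈ A
  · rw [if_pos hm, if_pos (h.1 hm)]
  · rw [if_neg hm, if_neg (mt h.2 hm)]

/-- The limit lemma. -/
theorem IsDelta2Fun.funIn {f : ℕ → ℕ} (hf : IsDelta2Fun f) : FunIn f (charFun haltingSet) := by
  obtain ⟨h, hh, hlim⟩ := hf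
  have hne : REPred fun q : (ℕ × ℕ) × ℕ => ∃ d, h q.1.1 (q.2 + d) ≠ q.1.2 := by
    have hc : Computable fun q : ((ℕ × ℕ) × ℕ) × ℕ => decide (h q.1.1.1 (q.1.2 + q.2) ≠ q.1.1.2) := by
      have h1 : Computable fun q : ((ℕ × ℕ) × ℕ) × ℕ => h q.1.1.1 (q.1.2 + q.2) :=
        Computable.comp (g := fun q : ((ℕ × ℕ) × ℕ) × ℕ => (q.1.1.1, q.1.2 + q.2)) hh
          (Primrec.to_comp (by fun_prop))
      exact (Primrec.to_comp (by fun_prop : Primrec fun q : ℕ × ℕ => decide (q.1 ≠ q.2))).comp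
        (h1.pair (g := fun q : ((ℕ × ℕ) × ℕ) × ℕ => q.1.1.2) (Primrec.to_comp (by fun_prop)))
    have hR := Partrec.rfind (p := fun (q : (ℕ × ℕ) × ℕ) d =>
      Part.some (decide (h q.1.1 (q.2 + d) ≠ q.1.2))) hc.partrec
    refine hR.dom_re.of_eq fun a => Nat.rfind_dom.trans ?_
    simp
  refine (SigIn.ex (p := fun (q : ℕ × ℕ) s => ¬ ∃ d, h q.1 (s + d) ≠ q.2)
    (sigIn_haltingSet_not_of_re hne)).of_iff fun q => ?_
  obtain ⟨s, hs⟩ := Filter.eventually_atTop.1 (hlim q.1)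
  constructor
  · intro hq
    refine ⟨s, ?_⟩
    rintro ⟨d, hd⟩
    exact hd ((hs _ (by omega)).trans hq.symm)
  · rintro ⟨t, ht⟩
    push Not at ht
    rw [← ht s, hs (t + s) (by omega)]

theorem exists_index_eq : ∀ e : ℕ, ∃ c : OracleCode, c.index = e := by
  intro e
  induction e using Nat.strong_induction_on with
  | _ e ih =>
    match e with
    | 0 => exact ⟨.zero, rfl⟩
    | 1 => exact ⟨.succ, rfl⟩
    | 2 => exact ⟨.left, rfl⟩
    | 3 => exact ⟨.right, rfl⟩
    | 4 => exact ⟨.oracle, rfl⟩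
    | n + 5 =>
      have h : n / 4 < n + 5 := by omega
      obtain ⟨c, hc⟩ := ih _ ((Nat.unpair_left_le (n / 4)).trans_lt h)
      obtain ⟨d, hd⟩ := ih _ ((Nat.unpair_right_le (n / 4)).trans_lt h)
      obtain ⟨c', hc'⟩ := ih _ h
      have h4 : n % 4 = 0 ∨ n % 4 = 1 ∨ n % 4 = 2 ∨ n % 4 = 3 := by omega
      rcases h4 with h4 | h4 | h4 | h4
      · exact ⟨.pair c d, by simp only [OracleCode.index, hc, hd, Nat.pair_unpair]; omega⟩
      · exact ⟨.comp c d, by simp only [OracleCode.index, hc, hd, Nat.pair_unpair]; omega⟩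
      · exact ⟨.prec c d, by simp only [OracleCode.index, hc, hd, Nat.pair_unpair]; omega⟩
      · exact ⟨.rfind c', by simp only [OracleCode.index, hc']; omega⟩

end Halting

/-! ### Tracing implies joining -/

section Joining

/-- A diagonally noncomputable function computes a function that avoids a given partial computable
function. -/
theorem IsDNRFun.exists_avoiding {g : ℕ → ℕ} (hg : IsDNRFun g) {Q : ℕ →. ℕ} (hQ : Nat.Partrec Q) :
    ∃ G : ℕ → ℕ, FunIn G g ∧ ∀ w, G w ∉ Q w := by
  obtain ⟨f, hf, hf'⟩ := exists_self_halting hQ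
  refine ⟨fun w => g (f w), FunIn.oracle.comp (FunIn.of_primrec hf), fun w hw => ?_⟩
  rw [← hf'] at hw
  exact hg _ hw

theorem funIn_join_left (A D : Set ℕ) : FunIn (charFun A) (charFun (join A D)) := by
  have h : ∀ n, charFun A n = charFun (join A D) (2 * n) := by
    intro n
    have : 2 * n ∈ join A D ↔ n ∈ A := by
      refine ⟨?_, fun h => Or.inl ⟨n, h, rfl⟩⟩
      rintro (⟨m, hm, h⟩ | ⟨m, hm, h⟩)
      · rwa [show n = m by omega]
      · omega
    exact charFun_congr this.symm
  rw [funext h]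
  exact FunIn.oracle.comp (h := fun n => 2 * n) (FunIn.of_primrec (by fun_prop))

theorem funIn_join_right (A D : Set ℕ) : FunIn (charFun D) (charFun (join A D)) := by
  have h : ∀ n, charFun D n = charFun (join A D) (2 * n + 1) := by
    intro n
    have : 2 * n + 1 ∈ join A D ↔ n ∈ D := by
      refine ⟨?_, fun h => Or.inr ⟨n, h, rfl⟩⟩
      rintro (⟨m, hm, h⟩ | ⟨m, hm, h⟩)
      · omega
      · rwa [show n = m by omega]
    exact charFun_congr this.symm
  rw [funext h]
  exact FunIn.oracle.comp (h := fun n => 2 * n + 1) (FunIn.of_primrec (by fun_prop))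

/-- The search carried out with oracle `A ⊕ D` is effective: everything apart from the prefix of `A`
and the value `g N` is primitive recursive once a step bound is added. -/
theorem sigIn_traced {A B : Set ℕ} {as hs : ℕ → ℕ → ℕ} (has : IsApprox A as) (hhs : IsApprox B hs)
    {b v g O : ℕ → ℕ} (hb : Primrec b) (hv : Primrec v) (hA : FunIn (pre (charFun A)) O)
    (hg : FunIn g O) : SigIn O fun k => ∃ s N z u y, hs s k = 0 ∧ k ≤ N ∧ z < b N ∧ u ≤ s ∧
      pre (as s) u = pre (charFun A) u ∧ y ∈ (translate z.unpair.1).eval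
        (Nat.pair (Encodable.encode (pre (charFun A) u)) z.unpair.2) ∧ v y = g N := by
  simp only [Code.evaln_complete, Option.mem_def]
  -- Here `x` lists `k, s, N, z, u, y` and `l` lists the initial segment of `A`, the value `g N` and
  -- the step bound.
  let B : ((((ℕ × ℕ) × ℕ) × ℕ) × ℕ) × ℕ → List ℕ × ℕ × ℕ → Prop := fun x l =>
    hs x.1.1.1.1.2 x.1.1.1.1.1 = 0 ∧ x.1.1.1.1.1 ≤ x.1.1.1.2 ∧ x.1.1.2 < b x.1.1.1.2 ∧
    x.1.2 ≤ x.1.1.1.1.2 ∧ pre (as x.1.1.1.1.2) x.1.2 = l.1 ∧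
    Code.evaln l.2.2 (translate x.1.1.2.unpair.1) (Nat.pair (Encodable.encode l.1)
      x.1.1.2.unpair.2) = some x.2 ∧ v x.2 = l.2.1
  have hB : Primrec fun q : (((((ℕ × ℕ) × ℕ) × ℕ) × ℕ) × ℕ) × List ℕ × ℕ × ℕ =>
      decide (B q.1 q.2) := by
    have h1 := hhs.primrec
    have h2 := has.primrec
    simp only [B, pre]
    fun_prop
  have h : SigIn O fun x : (((((ℕ × ℕ) × ℕ) × ℕ) × ℕ) × ℕ) × ℕ =>
      B x.1 (pre (charFun A) x.1.1.2, g x.1.1.1.1.2, x.2) :=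
    SigIn.comp_decide (p := fun q : (((((ℕ × ℕ) × ℕ) × ℕ) × ℕ) × ℕ) × List ℕ × ℕ × ℕ => B q.1 q.2)
      (f := fun x : (((((ℕ × ℕ) × ℕ) × ℕ) × ℕ) × ℕ) × ℕ =>
        (x.1, pre (charFun A) x.1.1.2, g x.1.1.1.1.2, x.2)) hB (by fun_prop)
  have h' : SigIn O fun x => ∃ t, B x (pre (charFun A) x.1.2, g x.1.1.1.2, t) :=
    SigIn.ex (p := fun x t => B x (pre (charFun A) x.1.2, g x.1.1.1.2, t)) h
  refine SigIn.ex (SigIn.ex (SigIn.ex (SigIn.ex (SigIn.ex (h'.of_iff fun x => ?_)))))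
  simp only [B, exists_and_left, exists_and_right]

/-- A c.e. set that traces every `∅'`-computable function infinitely often, with a computable bound
on the indices of the trace, joins every `Δ⁰₂` DNR set above `∅'`. -/
theorem joinsDelta2DNR_of_trace {A : Set ℕ} (hA : IsCE A) {b v : ℕ → ℕ} (hb : Primrec b)
    (hv : Primrec v)
    (H : ∀ p : ℕ → ℕ, FunIn p (charFun haltingSet) → ∀ m, ∃ N ≥ m, ∃ (c : OracleCode) (i : ℕ),
      Nat.pair c.index i < b N ∧ ∃ y ∈ c.eval (tot (charFun A)) i, v y = p N) :
    JoinsDelta2DNR A := by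
  intro D hD ⟨g₀, hg₀, hg₀D⟩
  have hg₀D : FunIn g₀ (charFun D) := recursiveIn_some_iff_funIn.1 hg₀D
  obtain ⟨as, has⟩ := hA.exists_isApprox
  obtain ⟨hs, hhs⟩ := isCE_haltingSet.exists_isApprox
  -- the value that is to be avoided: the component `w` of the value of the program `w.1.1` on
  -- `w.1.2`, with the approximation to `A` at the stage at which `w.2` enters `∅'` as oracle
  let E : ℕ → ℕ →. ℕ := fun w t => (translate w.unpair.1.unpair.1).eval
    (Nat.pair (Encodable.encode (pre (as t) t)) w.unpair.1.unpair.2)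
  let comp : ℕ → ℕ → ℕ := fun w y =>
    ((Encodable.decode (v y) : Option (List ℕ)).getD []).getD w 0
  let Q : ℕ →. ℕ := fun w =>
    (Nat.rfind fun t => Part.some (decide (hs t w.unpair.2 = 1))).bind fun t =>
      (E w t).map (comp w)
  have hQ : Nat.Partrec Q := by
    refine Partrec.nat_iff.1 (Partrec.bind (Partrec.rfind ?_) (Partrec.map ?_ ?_))
    · have := hhs.primrec
      exact (Primrec.to_comp (by fun_prop : Primrec fun q : ℕ × ℕ =>
        decide (hs q.2 q.1.unpair.2 = 1))).partrec
    · have h2 : Primrec fun q : ℕ × ℕ => pre (as q.2) q.2 :=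
        has.primrec_pre Primrec.snd Primrec.snd
      exact Partrec.comp (g := fun q : ℕ × ℕ => (translate q.1.unpair.1.unpair.1,
        Nat.pair (Encodable.encode (pre (as q.2) q.2)) q.1.unpair.1.unpair.2)) Code.eval_part
        (Primrec.to_comp (by fun_prop))
    · have : Primrec fun q : (ℕ × ℕ) × ℕ => comp q.1.1 q.2 := by
        simp only [comp]
        fun_prop
      exact this.to_comp
  obtain ⟨G, hG, hGQ⟩ := hg₀.exists_avoiding hQ
  -- For `z < b N` and `k ≤ N` the pair of `z` and `k` is below `r N`, so the segment of `G` coded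
  -- by `g N` has a coordinate for it.
  let r : ℕ → ℕ := fun N => (b N + N + 1) ^ 2
  have hr : Primrec r := by
    simp only [r]
    fun_prop
  let g : ℕ → ℕ := fun N => Encodable.encode ((List.range (r N)).map G)
  have hgD : FunIn g (charFun D) := by
    have : FunIn g G :=
      FunIn.comp (f := fun l : List ℕ => Encodable.encode l) (by fun_prop)
        (FunIn.map_range (FunIn.of_primrec hr) (FunIn.oracle.comp (by fun_prop)))
    exact (this.trans hG).trans hg₀D
  have hgH : FunIn g (charFun haltingSet) := hgD.trans hD.funIn
  have hgJ : FunIn g (charFun (join A D)) := hgD.trans (funIn_join_right A D)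
  have hAJ : FunIn (pre (charFun A)) (charFun (join A D)) := (funIn_join_left A D).pre
  rw [turingLE_iff_funIn]
  refine funIn_charFun_of_sigIn (SigIn.of_rePred isCE_haltingSet) ?_
  -- `k ∉ ∅'` iff `k` is not in `∅'` at a stage at which `g N` is seen to be traced, for some `N ≥ k`
  refine (sigIn_traced has hhs hb hv hAJ hgJ).of_iff fun k => ?_
  constructor
  · intro hk
    obtain ⟨N, hN, c, i, hci, y, hy, hyN⟩ := H g hgH k
    obtain ⟨u, hu⟩ := c.exists_pre _ _ _ hy
    obtain ⟨s, hs'⟩ := has.exists_pre_eq u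
    refine ⟨max s u, N, Nat.pair c.index i, u, y, ?_, hN, hci, le_max_right _ _,
      has.pre_eq_of_le (le_max_left _ _) hs', ?_, hyN⟩
    · have := hhs.le_charFun (max s u) k
      simp only [charFun, hk, if_false] at this
      omega
    · simpa [eval_translate] using hu
  · rintro ⟨s, N, z, u, y, hk0, hkN, hz, hus, hAs, hy, hyN⟩ hk
    obtain ⟨c, hc⟩ := exists_index_eq z.unpair.1
    -- Suppose `k` does enter, first at stage `t`. Then `s ≤ t`, the use of the tracing computation
    -- is still correct at `t`, and `Q` returns the coordinate `w` of `g N`, which is `G w`.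
    obtain ⟨t', ht'⟩ := hhs.exists_eq k
    rw [charFun_eq_one.2 hk] at ht'
    have hdom : (Nat.rfind fun t => Part.some (decide (hs t k = 1))).Dom :=
      Nat.rfind_dom.2 ⟨t', by simp [ht'], fun _ => trivial⟩
    obtain ⟨t, ht⟩ := Part.dom_iff_mem.1 hdom
    have htk : hs t k = 1 := of_decide_eq_true (Part.mem_some_iff.1 (Nat.rfind_spec ht)).symm
    have hst : s ≤ t := by
      by_contra hlt
      have := hhs.mono t s k (by omega)
      omega
    have hAt := has.pre_eq_of_le hst hAs
    rw [← hc, eval_translate, ← hAt] at hy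
    have hyt := c.eval_pre_mono (hus.trans hst) hy
    let w := Nat.pair z k
    have hw : w < r N := by
      refine (Nat.pair_lt_max_add_one_sq z k).trans_le (Nat.pow_le_pow_left ?_ 2)
      rcases le_total z k with h | h
      · rw [max_eq_right h]
        omega
      · rw [max_eq_left h]
        omega
    refine hGQ w (Part.mem_bind_iff.2 ⟨t, by simpa [w] using ht,
      (Part.mem_map_iff _).2 ⟨y, ?_, ?_⟩⟩)
    · simp only [E, w, Nat.unpair_pair, ← hc, eval_translate]
      exact hyt
    · simp only [comp, hyN, g, Encodable.encodek]
      simp [hw]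

end Joining
end Cupping

namespace Cupping
open Nat.Partrec (Code)

/-! ### Complexity bounds give traces -/

section Complexity

theorem K_le_of_machine {c : OracleCode} {A : Set ℕ} {σ x : List Bool} (h : c.Machine A σ x) :
    K A x ≤ c.index + 1 + σ.length := by
  refine Nat.sInf_le ⟨_, ?_, c, σ, rfl, h⟩
  simp
  omega

theorem exists_machine (A : Set ℕ) (x : List Bool) :
    ∃ (c : OracleCode) (σ : List Bool), c.Machine A σ x ∧ K A x = c.index + 1 + σ.length := by
  obtain ⟨ρ, hρ⟩ := exists_description A x
  obtain ⟨ρ, hl, c, σ, rfl, h⟩ :=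
    Nat.sInf_mem (s := {n | ∃ ρ : List Bool, ρ.length = n ∧ Universal A ρ x}) ⟨_, ρ, rfl, hρ⟩
  refine ⟨c, σ, h, hl.symm.trans ?_⟩
  simp
  omega

theorem pair_mono {a b c d : ℕ} (h : a ≤ c) (h' : b ≤ d) : Nat.pair a b ≤ Nat.pair c d := by
  rcases h.eq_or_lt with rfl | h
  · rcases h'.eq_or_lt with rfl | h'
    · exact le_rfl
    · exact (Nat.pair_lt_pair_right _ h').le
  · rcases h'.eq_or_lt with rfl | h'
    · exact (Nat.pair_lt_pair_left _ h).le
    · exact ((Nat.pair_lt_pair_left _ h).trans (Nat.pair_lt_pair_right _ h')).le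

/-- A bound for the codes of the binary strings of length at most `n`. -/
def stringBound (n : ℕ) : ℕ := Nat.rec 0 (fun _ b => Nat.pair 1 b + 1) n

theorem primrec_stringBound : Primrec stringBound := by
  unfold stringBound
  fun_prop

theorem encode_le_stringBound (σ : List Bool) {n : ℕ} (h : σ.length ≤ n) :
    Encodable.encode σ ≤ stringBound n := by
  induction n generalizing σ with
  | zero =>
    obtain rfl := List.length_eq_zero_iff.1 (Nat.le_zero.1 h)
    exact Nat.zero_le _
  | succ n ih =>
    cases σ with
    | nil => exact Nat.zero_le _
    | cons a σ =>
      rw [Encodable.encode_list_cons]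
      have ha : Encodable.encode a ≤ 1 := by cases a <;> simp
      exact Nat.succ_le_succ (pair_mono ha (ih σ (by simpa using h)))

theorem exists_code_of_funIn {α β : Type*} [Primcodable α] [Primcodable β] {f : α → β} {g : ℕ → ℕ}
    (hf : FunIn f g) : ∃ c : OracleCode, ∀ a,
      c.eval (tot g) (Encodable.encode a) = Part.some (Encodable.encode (f a)) := by
  obtain ⟨c, hc⟩ := exists_oracleCode (recursiveIn_some_iff_funIn.2 hf)
  exact ⟨c, fun a => by rw [hc]; simp⟩

/-- A number computable from `A` has, in unary, small prefix-free complexity relative to `A`. -/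
theorem exists_K_replicate_le {A : Set ℕ} {p : ℕ → ℕ} (hp : FunIn p (charFun A)) :
    ∃ c, ∀ m, K A (List.replicate (p m) true) ≤ m + c := by
  -- The intended input is `1^m 0`: the value `0` asks for another bit until the bit `false` has
  -- been read. The input has length `m + 1`, which accounts for the constant `c.index + 2`.
  let F : List Bool → ℕ := fun τ => if false ∈ τ then
    Encodable.encode ((List.range (p (τ.length - 1))).map fun _ => true) + 1 else 0
  have hF : FunIn F (charFun A) := by
    have h1 : FunIn (fun τ : List Bool => p (τ.length - 1)) (charFun A) :=
      hp.comp (h := fun τ : List Bool => τ.length - 1) (FunIn.of_primrec (by fun_prop))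
    have hmem : PrimrecPred fun τ : List Bool => ∃ b ∈ τ, b = false := by fun_prop
    have h2 : Primrec fun q : List Bool × ℕ => if (∃ b ∈ q.1, b = false) then
        Encodable.encode ((List.range q.2).map fun _ => true) + 1 else 0 := by
      have := hmem.comp (Primrec.fst (α := List Bool) (β := ℕ))
      fun_prop
    have := (FunIn.of_primrec (g := charFun A) h2).comp
      (h := fun τ : List Bool => (τ, p (τ.length - 1))) (by fun_prop)
    simpa [F] using this
  obtain ⟨c, hc⟩ := exists_code_of_funIn hF
  refine ⟨c.index + 2, fun m => ?_⟩
  have : c.Machine A (List.replicate m true ++ [false]) (List.replicate (p m) true) := by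
    refine ⟨fun τ hτ hne => ?_, ?_⟩
    · have h0 : false ∉ τ := by
        rcases List.prefix_concat_iff.1 hτ with h | h
        · exact absurd h hne
        · intro h'
          simpa using List.eq_of_mem_replicate (h.subset h')
      refine (Part.ext_iff.1 (hc τ) 0).2 ?_
      simp [F, h0]
    · refine (Part.ext_iff.1 (hc _) _).2 ?_
      simp [F, List.map_const']
  refine (K_le_of_machine this).trans ?_
  simp
  omega

/-- Values of `p` are coded in unary; a short description relative to `A` consists of a program
index and a string, both bounded computably in its length. -/
theorem joinsDelta2DNR_of_K_le {A : Set ℕ} (hA : IsCE A) {f : ℕ → ℕ} (hf : IsDelta2Fun f) {c : ℕ}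
    (h : ∀ σ, K A σ ≤ f (K haltingSet σ) + c) : JoinsDelta2DNR A := by
  -- A description of length at most `N + c` bounds both the program index and the length of the
  -- string by `N + c`. In `v`, the subtraction undoes the shift by one in the output convention of
  -- `OracleCode.Machine`.
  let b : ℕ → ℕ := fun N => Nat.pair (N + c) (stringBound (N + c)) + 1
  let v : ℕ → ℕ := fun y => ((Encodable.decode (y - 1) : Option (List Bool)).getD []).length
  have hb : Primrec b := by
    have := primrec_stringBound.comp (by fun_prop : Primrec fun N => N + c)
    simp only [b]
    fun_prop
  have hv : Primrec v := by
    simp only [v]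
    fun_prop
  refine joinsDelta2DNR_of_trace hA hb hv fun p hp m₀ => ?_
  -- The complexity relative to `∅'` is at most `m + d ≤ 2 * m` once `m ≥ d`, so the sum over
  -- arguments up to `2 * m` dominates the relevant value of `f`; the summand `m` makes `F`
  -- unbounded.
  let F : ℕ → ℕ := fun m => m + (((List.range (2 * m + 1)).map f).sum)
  have hF : FunIn F (charFun haltingSet) := by
    have hs : Primrec fun q : ℕ × List ℕ => q.1 + q.2.sum :=
      Primrec.nat_add.comp Primrec.fst (Primrec.list_foldr
        (h := fun (_ : ℕ × List ℕ) (z : ℕ × ℕ) => z.1 + z.2) Primrec.snd (Primrec.const 0)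
        (by unfold Primrec₂; fun_prop))
    exact (FunIn.of_primrec hs).comp (h := fun m => (m, (List.range (2 * m + 1)).map f))
      (FunIn.pair FunIn.id ((hf.funIn.pre).comp (h := fun m => 2 * m + 1)
        (FunIn.of_primrec (by fun_prop))))
  obtain ⟨d, hd⟩ := exists_K_replicate_le (hp.comp hF)
  have hm := hd (max m₀ d)
  generalize max m₀ d = m, le_max_left m₀ d = h1, le_max_right m₀ d = h2 at hm
  have hN : K A (List.replicate (p (F m)) true) ≤ F m + c := by
    refine (h _).trans (Nat.add_le_add_right ?_ c)
    refine le_trans ?_ (Nat.le_add_left _ m)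
    refine List.single_le_sum (fun _ _ => Nat.zero_le _) _ (List.mem_map.2 ⟨_, ?_, rfl⟩)
    rw [List.mem_range]
    omega
  obtain ⟨e, σ, he, hK⟩ := exists_machine A (List.replicate (p (F m)) true)
  refine ⟨F m, h1.trans (Nat.le_add_right _ _), e, Encodable.encode σ,
    Nat.lt_succ_of_le (pair_mono (by omega) (encode_le_stringBound σ (by omega))), _, he.2, ?_⟩
  simp [v]

end Complexity
end Cupping

namespace Cupping
open MeasureTheory ProbabilityTheory

/-! ### The uniform measure, cylinders and independent blocks -/

section Measure

instance : IsProbabilityMeasure coinMeasure := by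
  unfold coinMeasure
  infer_instance

theorem coinMeasure_forall_eq (s : Finset ℕ) (x : ℕ → Bool) :
    coinMeasure {Z | ∀ i ∈ s, Z i = x i} = 2⁻¹ ^ s.card := by
  have : {Z : ℕ → Bool | ∀ i ∈ s, Z i = x i} = (s : Set ℕ).pi fun i => {x i} := by
    ext Z
    simp [Set.mem_pi]
  rw [this, coinMeasure, Measure.infinitePi_pi _ (fun _ _ => MeasurableSet.of_discrete)]
  simp

/-- The initial segment of length `L` of a sequence. -/
def seg (Z : ℕ → Bool) (L : ℕ) : List Bool := (List.range L).map Z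

@[simp] theorem length_seg (Z : ℕ → Bool) (L : ℕ) : (seg Z L).length = L := by simp [seg]

theorem getElem?_seg {Z : ℕ → Bool} {L i : ℕ} (h : i < L) : (seg Z L)[i]? = some (Z i) := by
  simp [seg, h]

theorem take_seg (Z : ℕ → Bool) {i L : ℕ} (h : i ≤ L) : (seg Z L).take i = seg Z i := by
  simp [seg, ← List.map_take, List.take_range, min_eq_left h]

theorem mem_cylinder_iff_seg {σ : List Bool} {Z : ℕ → Bool} :
    Z ∈ cylinder σ ↔ seg Z σ.length = σ := by
  constructor
  · intro h
    refine List.ext_getElem (by simp) fun i h1 h2 => ?_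
    simp [seg, h i h2]
  · intro h i hi
    have := getElem?_seg (Z := Z) hi
    rw [h, List.getElem?_eq_getElem hi] at this
    exact (Option.some_injective _ this).symm

theorem mem_cylinder_iff_prefix {σ : List Bool} {Z : ℕ → Bool} {L : ℕ} (h : σ.length ≤ L) :
    Z ∈ cylinder σ ↔ σ <+: seg Z L := by
  rw [mem_cylinder_iff_seg, List.prefix_iff_eq_take, take_seg Z h, eq_comm]

theorem coinMeasure_cylinder (σ : List Bool) : coinMeasure (cylinder σ) = 2⁻¹ ^ σ.length := by
  have : cylinder σ = {Z | ∀ i ∈ Finset.range σ.length, Z i = σ.getD i false} := by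
    ext Z
    constructor
    · intro h i hi
      have hi := Finset.mem_range.1 hi
      simp [h i hi, hi]
    · intro h i hi
      simpa [hi] using h i (Finset.mem_range.2 hi)
  rw [this, coinMeasure_forall_eq, Finset.card_range]

/-- All binary strings of length `L`. -/
def strs (L : ℕ) : List (List Bool) :=
  Nat.rec [[]] (fun _ l => l.map (fun σ => true :: σ) ++ l.map (fun σ => false :: σ)) L

theorem primrec_strs : Primrec strs := by
  unfold strs
  fun_prop

attribute [fun_prop] primrec_strs

theorem strs_succ (L : ℕ) : strs (L + 1) =
    (strs L).map (fun σ => true :: σ) ++ (strs L).map (fun σ => false :: σ) := rfl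

theorem mem_strs {L : ℕ} {σ : List Bool} : σ ∈ strs L ↔ σ.length = L := by
  induction L generalizing σ with
  | zero => simp [strs]
  | succ L ih =>
    cases σ with
    | nil => simp [strs_succ]
    | cons a σ => cases a <;> simp [strs_succ, ih]

theorem nodup_strs (L : ℕ) : (strs L).Nodup := by
  induction L with
  | zero => simp [strs]
  | succ L ih =>
    rw [strs_succ]
    refine List.Nodup.append (ih.map fun _ _ h => by simpa using h)
      (ih.map fun _ _ h => by simpa using h) ?_
    intro σ h h'
    simp only [List.mem_map] at h h'
    obtain ⟨_, _, rfl⟩ := h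
    obtain ⟨_, _, h⟩ := h'
    simp at h

/-- The number of strings of length `L` with the property `F`. -/
def cnt (F : List Bool → Bool) (L : ℕ) : ℕ := ((strs L).filter F).length

theorem measurableSet_cylinder (σ : List Bool) : MeasurableSet (cylinder σ) := by
  have : cylinder σ = ⋂ (i : ℕ) (h : i < σ.length), (fun Z : ℕ → Bool => Z i) ⁻¹' {σ[i]} := by
    ext Z
    simp [cylinder]
  rw [this]
  exact MeasurableSet.iInter fun i => MeasurableSet.iInter fun h =>
    measurable_pi_apply i MeasurableSet.of_discrete

theorem measurableSet_openSet (W : Set (List Bool)) : MeasurableSet (openSet W) :=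
  MeasurableSet.biUnion (Set.to_countable W) fun σ _ => measurableSet_cylinder σ

theorem setOf_seg_eq (F : List Bool → Bool) (L : ℕ) :
    {Z | F (seg Z L) = true} = ⋃ σ ∈ ((strs L).filter F).toFinset, cylinder σ := by
  ext Z
  simp only [Set.mem_ofPred_eq, Set.mem_iUnion, List.mem_toFinset, List.mem_filter, mem_strs,
    exists_prop, mem_cylinder_iff_seg]
  constructor
  · intro h
    exact ⟨seg Z L, ⟨by simp, h⟩, by simp⟩
  · rintro ⟨σ, ⟨rfl, h⟩, hσ⟩
    rwa [hσ]

theorem measurableSet_seg (F : List Bool → Bool) (L : ℕ) :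
    MeasurableSet {Z | F (seg Z L) = true} := by
  rw [setOf_seg_eq]
  exact Finset.measurableSet_biUnion _ fun σ _ => measurableSet_cylinder σ

theorem coinMeasure_seg (F : List Bool → Bool) (L : ℕ) :
    coinMeasure {Z | F (seg Z L) = true} = cnt F L * 2⁻¹ ^ L := by
  rw [setOf_seg_eq, measure_biUnion_finset]
  · rw [Finset.sum_congr rfl (g := fun _ => (2⁻¹ : ENNReal) ^ L), Finset.sum_const,
      List.toFinset_card_of_nodup ((nodup_strs L).filter _), nsmul_eq_mul, cnt]
    intro σ hσ
    rw [List.mem_toFinset, List.mem_filter, mem_strs] at hσ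
    rw [coinMeasure_cylinder, hσ.1]
  · intro σ hσ τ hτ hne
    rw [Finset.mem_coe, List.mem_toFinset, List.mem_filter, mem_strs] at hσ hτ
    refine Set.disjoint_left.2 fun Z h h' => hne ?_
    rw [mem_cylinder_iff_seg] at h h'
    rw [← h, ← h', hσ.1, hτ.1]
  · exact fun σ _ => measurableSet_cylinder σ

/-- Events determined by disjoint finite sets of coordinates are preimages under independent
families; all subsets of the finite products are measurable. -/
theorem coinMeasure_inter_of_disjoint {S T : Finset ℕ} (hST : Disjoint S T) {A B : Set (ℕ → Bool)}
    (hA : ∀ Z Z', (∀ i ∈ S, Z i = Z' i) → Z ∈ A → Z' ∈ A)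
    (hB : ∀ Z Z', (∀ i ∈ T, Z i = Z' i) → Z ∈ B → Z' ∈ B) :
    coinMeasure (A ∩ B) = coinMeasure A * coinMeasure B := by
  have hI := iIndepFun_infinitePi (P := fun _ : ℕ => (PMF.uniformOfFintype Bool).toMeasure)
    (X := fun _ b => b) fun _ => measurable_id
  have h := hI.indepFun_finset S T hST fun i => measurable_pi_apply i
  have key : ∀ (S : Finset ℕ) (A : Set (ℕ → Bool)),
      (∀ Z Z', (∀ i ∈ S, Z i = Z' i) → Z ∈ A → Z' ∈ A) →
      A = (fun (Z : ℕ → Bool) (i : S) => Z i) ⁻¹' ((fun (Z : ℕ → Bool) (i : S) => Z i) '' A) := by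
    intro S A hA
    refine Set.Subset.antisymm (Set.subset_preimage_image _ _) ?_
    rintro Z ⟨Z', hZ', h⟩
    exact hA Z' Z (fun i hi => congrFun h ⟨i, hi⟩) hZ'
  rw [key S A hA, key T B hB]
  exact h.measure_inter_preimage_eq_mul _ _ MeasurableSet.of_discrete MeasurableSet.of_discrete

/-- The sequences that vanish on the `i`-th block of length `m`. -/
def zeroBlock (m i : ℕ) : Set (ℕ → Bool) := {Z | ∀ j < m, Z (m * i + j) = false}

theorem zeroBlock_eq (m i : ℕ) : zeroBlock m i =
    {Z | ∀ j ∈ Finset.Ico (m * i) (m * i + m), Z j = false} := by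
  ext Z
  constructor
  · intro h j hj
    rw [Finset.mem_Ico] at hj
    simpa [Nat.add_sub_cancel' hj.1] using h (j - m * i) (by omega)
  · intro h j hj
    exact h _ (Finset.mem_Ico.2 ⟨by omega, by omega⟩)

theorem coinMeasure_zeroBlock (m i : ℕ) : coinMeasure (zeroBlock m i) = 2⁻¹ ^ m := by
  rw [zeroBlock_eq, coinMeasure_forall_eq _ fun _ => false, Nat.card_Ico, Nat.add_sub_cancel_left]

theorem zeroBlock_eq_seg (m i : ℕ) {L : ℕ} (hL : m * i + m ≤ L) : zeroBlock m i =
    {Z | decide (∀ j < m, (seg Z L)[m * i + j]? = some false) = true} := by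
  ext Z
  rw [Set.mem_ofPred_eq, decide_eq_true_eq]
  refine forall₂_congr fun j hj => ?_
  rw [getElem?_seg (by omega)]
  simp

theorem measurableSet_zeroBlock (m i : ℕ) : MeasurableSet (zeroBlock m i) := by
  rw [zeroBlock_eq_seg m i le_rfl]
  exact measurableSet_seg (fun σ => decide (∀ j < m, σ[m * i + j]? = some false)) _

/-- For fixed `m` the blocks occupy disjoint intervals of positions, so they are independent. -/
theorem coinMeasure_iInter_compl_zeroBlock (m : ℕ) (F : Finset ℕ) :
    coinMeasure (⋂ i ∈ F, (zeroBlock m i)ᶜ) = (1 - 2⁻¹ ^ m) ^ F.card := by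
  induction F using Finset.induction_on with
  | empty => simp
  | insert i F hi ih =>
    rw [Finset.set_biInter_insert, coinMeasure_inter_of_disjoint
      (S := Finset.Ico (m * i) (m * i + m))
      (T := F.biUnion fun i => Finset.Ico (m * i) (m * i + m)), ih,
      prob_compl_eq_one_sub (measurableSet_zeroBlock m i), coinMeasure_zeroBlock,
      Finset.card_insert_of_notMem hi, pow_succ']
    · rw [Finset.disjoint_biUnion_right]
      intro j hj
      have hne : i ≠ j := fun h => hi (h ▸ hj)
      rw [Finset.disjoint_left]
      intro x hx hx'
      rw [Finset.mem_Ico] at hx hx'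
      rcases Nat.lt_or_gt_of_ne hne with h | h
      · have : m * i + m ≤ m * j := by nlinarith
        omega
      · have : m * j + m ≤ m * i := by nlinarith
        omega
    · intro Z Z' h hZ hZ'
      rw [zeroBlock_eq] at hZ hZ'
      exact hZ fun j hj => (h j hj).trans (hZ' j hj)
    · intro Z Z' h hZ
      simp only [Set.mem_iInter] at hZ ⊢
      intro i hi hZ'
      refine hZ i hi ?_
      rw [zeroBlock_eq] at hZ' ⊢
      exact fun j hj => (h j (Finset.mem_biUnion.2 ⟨i, hi, hj⟩)).trans (hZ' j hj)

end Measure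
end Cupping

namespace Cupping
open MeasureTheory

/-! ### Few blocks nearly miss a closed set of positive measure -/

section Trace

/-- With `x = 2^(-m)`, Bernoulli gives `(1 + x) ^ 2 ^ m ≥ 2`, while `(1 - x) * (1 + x) ≤ 1`. -/
theorem one_sub_inv_two_pow_pow_le (m : ℕ) : (1 - 2⁻¹ ^ m : ENNReal) ^ 2 ^ m ≤ 2⁻¹ := by
  set x : ENNReal := 2⁻¹ ^ m with hx
  have hx1 : x ≤ 1 := pow_le_one₀ (by simp) (by simp)
  have hNx : ((2 ^ m : ℕ) : ENNReal) * x = 1 := by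
    rw [hx, Nat.cast_pow, Nat.cast_ofNat, ← mul_pow, ENNReal.mul_inv_cancel (by simp) (by simp),
      one_pow]
  have h1 : (1 - x) * (1 + x) ≤ 1 := by
    calc (1 - x) * (1 + x) = (1 - x) + (1 - x) * x := by ring
      _ ≤ (1 - x) + 1 * x := by gcongr; exact tsub_le_self
      _ = 1 := by rw [one_mul, tsub_add_cancel_of_le hx1]
  have h2 : 2 ≤ (1 + x) ^ 2 ^ m := by
    calc (2 : ENNReal) = 1 + ((2 ^ m : ℕ) : ENNReal) * x := by rw [hNx]; norm_num
      _ ≤ (1 + x) ^ 2 ^ m :=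
        one_add_mul_le_pow_of_sq_nonneg zero_le zero_le zero_le _
  rw [ENNReal.le_inv_iff_mul_le]
  calc (1 - x) ^ 2 ^ m * 2 ≤ (1 - x) ^ 2 ^ m * (1 + x) ^ 2 ^ m := by gcongr
    _ = ((1 - x) * (1 + x)) ^ 2 ^ m := (mul_pow _ _ _).symm
    _ ≤ 1 := pow_le_one₀ zero_le h1

/-- A point of `P` lies in one of the blocks, or in none; the second possibility is estimated by
independence. -/
theorem coinMeasure_le_of_zeroBlock_inter_le {P : Set (ℕ → Bool)} {m : ℕ} {ε : ENNReal}
    {F : Finset ℕ} (h : ∀ i ∈ F, coinMeasure (zeroBlock m i ∩ P) ≤ ε) :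
    coinMeasure P ≤ F.card * ε + (1 - 2⁻¹ ^ m) ^ F.card := by
  have hP : P ⊆ (⋃ i ∈ F, zeroBlock m i ∩ P) ∪ ⋂ i ∈ F, (zeroBlock m i)ᶜ := by
    intro Z hZ
    by_cases h : ∃ i ∈ F, Z ∈ zeroBlock m i
    · obtain ⟨i, hi, h⟩ := h
      exact Or.inl (Set.mem_biUnion hi ⟨h, hZ⟩)
    · push Not at h
      exact Or.inr (Set.mem_iInter₂.2 h)
  refine (measure_mono hP).trans ((measure_union_le _ _).trans ?_)
  rw [coinMeasure_iInter_compl_zeroBlock]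
  gcongr
  refine (measure_biUnion_finset_le _ _).trans ((Finset.sum_le_sum h).trans ?_)
  simp

/-- A set of positive measure has small intersection with few of the blocks of length `m`. -/
theorem exists_card_lt_of_zeroBlock_inter_le {P : Set (ℕ → Bool)} (hP : coinMeasure P ≠ 0) :
    ∃ C d : ℕ, ∀ m, ∀ F : Finset ℕ,
      (∀ i ∈ F, coinMeasure (zeroBlock m i ∩ P) ≤ 2⁻¹ ^ (m + d)) → F.card < C * 2 ^ m := by
  have hq : coinMeasure P / 2 ≠ 0 := by simpa [ENNReal.div_eq_zero_iff] using hP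
  -- First `C` makes `2^(-C)` less than half the measure, then `d` makes `C * 2^(-d)` less than half
  -- of it; exactly `C * 2 ^ m` such blocks would then be too many.
  obtain ⟨C, hC⟩ := ENNReal.exists_inv_two_pow_lt hq
  have hqC : coinMeasure P / 2 / C ≠ 0 := by
    rw [Ne, ENNReal.div_eq_zero_iff]
    simp [hq]
  obtain ⟨d, hd⟩ := ENNReal.exists_inv_two_pow_lt hqC
  refine ⟨C, d, fun m F hF => ?_⟩
  by_contra hlt
  push Not at hlt
  obtain ⟨F', hF', hcard⟩ := Finset.exists_subset_card_eq hlt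
  have h := coinMeasure_le_of_zeroBlock_inter_le fun i hi => hF i (hF' hi)
  rw [hcard] at h
  have h1 : ((C * 2 ^ m : ℕ) : ENNReal) * 2⁻¹ ^ (m + d) ≤ coinMeasure P / 2 := by
    have : ((C * 2 ^ m : ℕ) : ENNReal) * 2⁻¹ ^ (m + d) = C * 2⁻¹ ^ d := by
      rw [pow_add, Nat.cast_mul, Nat.cast_pow, Nat.cast_ofNat]
      calc (C : ENNReal) * 2 ^ m * (2⁻¹ ^ m * 2⁻¹ ^ d) = C * (2 * 2⁻¹) ^ m * 2⁻¹ ^ d := by ring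
        _ = C * 2⁻¹ ^ d := by
          rw [ENNReal.mul_inv_cancel (by simp) (by simp), one_pow, mul_one]
    rw [this]
    calc (C : ENNReal) * 2⁻¹ ^ d ≤ C * (coinMeasure P / 2 / C) := by gcongr
      _ ≤ coinMeasure P / 2 := ENNReal.mul_div_le
  have h2 : (1 - 2⁻¹ ^ m : ENNReal) ^ (C * 2 ^ m) ≤ 2⁻¹ ^ C := by
    rw [mul_comm, pow_mul]
    gcongr
    exact one_sub_inv_two_pow_pow_le m
  have h3 : coinMeasure P < coinMeasure P / 2 + coinMeasure P / 2 :=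
    h.trans_lt (ENNReal.add_lt_add_of_le_of_lt
      (ne_top_of_le_ne_top (measure_ne_top coinMeasure P) (h1.trans ENNReal.half_le_self))
      h1 (h2.trans_lt hC))
  rw [ENNReal.add_halves] at h3
  exact lt_irrefl _ h3

/-- Continuity from above along the finite subsets of `V` with codes below `k`. It makes
"intersection of measure zero" imply an enumerable condition. -/
theorem exists_finite_measure_diff_le {E : Set (ℕ → Bool)} (hE : MeasurableSet E)
    {V : Set (List Bool)} (h : coinMeasure (E ∩ (openSet V)ᶜ) = 0) {ε : ENNReal} (hε : ε ≠ 0) :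
    ∃ S : List (List Bool), (∀ σ ∈ S, σ ∈ V) ∧ coinMeasure (E ∩ (openSet {σ | σ ∈ S})ᶜ) ≤ ε := by
  let D : ℕ → Set (List Bool) := fun k => {σ ∈ V | Encodable.encode σ < k}
  have hD : ⋂ k, (E ∩ (openSet (D k))ᶜ) = E ∩ (openSet V)ᶜ := by
    ext Z
    simp only [Set.mem_iInter, Set.mem_inter_iff, openSet, Set.mem_compl_iff, Set.mem_iUnion,
      exists_prop, not_exists, not_and]
    exact ⟨fun hZ => ⟨(hZ 0).1, fun σ hσ => (hZ (Encodable.encode σ + 1)).2 σ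
      ⟨hσ, Nat.lt_succ_self _⟩⟩, fun hZ k => ⟨hZ.1, fun σ hσ => hZ.2 σ hσ.1⟩⟩
  have hlim := tendsto_measure_iInter_atTop (μ := coinMeasure) (s := fun k => E ∩ (openSet (D k))ᶜ)
    (fun k => (hE.inter (measurableSet_openSet _).compl).nullMeasurableSet)
    (fun k l hkl => Set.inter_subset_inter_right _ (Set.compl_subset_compl.2
      (Set.biUnion_subset_biUnion_left fun σ hσ => ⟨hσ.1, hσ.2.trans_le hkl⟩)))
    ⟨0, measure_ne_top _ _⟩
  rw [hD, h] at hlim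
  obtain ⟨k, hk⟩ := (hlim.eventually (gt_mem_nhds (pos_iff_ne_zero.2 hε))).exists
  have hfin : (D k).Finite := by
    refine Set.Finite.of_finite_image (f := Encodable.encode) ((Set.finite_lt_nat k).subset ?_)
      Encodable.encode_injective.injOn
    rintro _ ⟨σ, hσ, rfl⟩
    exact hσ.2
  refine ⟨hfin.toFinset.toList, fun σ hσ => ?_, ?_⟩
  · rw [Finset.mem_toList, Set.Finite.mem_toFinset] at hσ
    exact hσ.1
  · have : {σ | σ ∈ hfin.toFinset.toList} = D k := by
      ext σ
      simp
    rw [this]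
    exact hk.le

end Trace
end Cupping

namespace Cupping
open MeasureTheory

/-! ### Enumeration without repetitions -/

section Trace

variable {g : ℕ → ℕ}

theorem SigIn.exists_oracleCode {G : ℕ → ℕ → Prop} (hG : SigIn g fun q : ℕ × ℕ => G q.1 q.2)
    (h : ∀ z y y', G z y → G z y' → y = y') :
    ∃ c : OracleCode, ∀ z y, y ∈ c.eval (tot g) z ↔ G z y := by
  let F : ℕ →. ℕ := fun z => ⟨∃ y, G z y, fun h => h.choose⟩
  have hF : ∀ z y, y ∈ F z ↔ G z y := by
    intro z y
    constructor
    · rintro ⟨hz, rfl⟩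
      exact hz.choose_spec
    · exact fun hy => ⟨⟨y, hy⟩, h _ _ _ (Exists.choose_spec (⟨y, hy⟩ : ∃ y, G z y)) hy⟩
  obtain ⟨c, hc⟩ := Cupping.exists_oracleCode
    (SigIn.recursiveIn (F := F) (hG.of_iff fun q => hF q.1 q.2))
  refine ⟨c, fun z y => ?_⟩
  rw [hc, ← hF]
  simp

/-- The sections of a relation that is `Σ⁰₁` relative to `g` can be enumerated without
repetitions by a program with oracle `g`. -/
theorem SigIn.exists_enumeration {T : ℕ → ℕ → Prop} (hT : SigIn g fun q : ℕ × ℕ => T q.1 q.2) :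
    ∃ c : OracleCode, ∀ m n, (∀ F : Finset ℕ, (∀ i ∈ F, T m i) → F.card < n) →
      ∀ i, T m i → ∃ r < n, ∀ y, y ∈ c.eval (tot g) (Nat.pair m r) ↔ y = i := by
  obtain ⟨R, hR, H⟩ := hT
  -- The number `t` codes a pair of `w` and `i` where `w` is the least length of a prefix that puts
  -- `i` into the section; thus each `i` occurs exactly once.
  let D : List ℕ → ℕ → ℕ → Prop := fun l m t => R (l.take t.unpair.1) (m, t.unpair.2) = true ∧
    ∀ w < t.unpair.1, R (l.take w) (m, t.unpair.2) = false
  have hD : PrimrecPred fun q : List ℕ × ℕ × ℕ => D q.1 q.2.1 q.2.2 := by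
    have h1 : Primrec fun q : List ℕ × ℕ × ℕ =>
        R (q.1.take q.2.2.unpair.1) (q.2.1, q.2.2.unpair.2) :=
      hR.comp (g := fun q : List ℕ × ℕ × ℕ =>
        (q.1.take q.2.2.unpair.1, q.2.1, q.2.2.unpair.2)) (by fun_prop)
    have h2 : Primrec fun q : (List ℕ × ℕ × ℕ) × ℕ =>
        R (q.1.1.take q.2) (q.1.2.1, q.1.2.2.unpair.2) :=
      hR.comp (g := fun q : (List ℕ × ℕ × ℕ) × ℕ =>
        (q.1.1.take q.2, q.1.2.1, q.1.2.2.unpair.2)) (by fun_prop)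
    exact PR.and (PR.eq h1 (Primrec.const true)) (PR.forall_lt (by fun_prop)
      (PR.eq h2 (Primrec.const false)))
  have hDdec : ∀ l m t, Decidable (D l m t) := fun l m t => by
    simp only [D]
    infer_instance
  let E : ℕ → ℕ → Prop := fun m t => D (pre g (t + 1)) m t
  have hE : ∀ m t s, t ≤ s → (D (pre g (s + 1)) m t ↔ E m t) := by
    intro m t s hts
    have ht := Nat.unpair_left_le t
    have htake : ∀ w ≤ t.unpair.1, (pre g (s + 1)).take w = (pre g (t + 1)).take w := by
      intro w hw
      rw [take_pre g (by omega), take_pre g (by omega)]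
    simp only [E, D]
    rw [htake _ le_rfl]
    refine and_congr_right fun _ => forall₂_congr fun w hw => ?_
    rw [htake w hw.le]
  have hER : ∀ m t, E m t ↔ R (pre g t.unpair.1) (m, t.unpair.2) = true ∧
      ∀ w < t.unpair.1, R (pre g w) (m, t.unpair.2) = false := by
    intro m t
    have ht := Nat.unpair_left_le t
    simp only [E, D]
    rw [take_pre g (by omega)]
    refine and_congr_right fun _ => forall₂_congr fun w hw => ?_
    rw [take_pre g (by omega)]
  have hEinj : ∀ m t t', E m t → E m t' → t.unpair.2 = t'.unpair.2 → t = t' := by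
    intro m t t' h h' h2
    rw [hER] at h h'
    have h1 : t.unpair.1 = t'.unpair.1 := by
      rcases Nat.lt_trichotomy t.unpair.1 t'.unpair.1 with hlt | heq | hlt
      · simpa [← h2, h.1] using h'.2 _ hlt
      · exact heq
      · simpa [h2, h'.1] using h.2 _ hlt
    rw [← Nat.pair_unpair t, ← Nat.pair_unpair t', h1, h2]
  have hET : ∀ m t, E m t → T m t.unpair.2 := fun m t h => (H (m, t.unpair.2)).2 ⟨_, ((hER m t).1 h).1⟩
  have hEdec : ∀ m, DecidablePred (E m) := fun m t => hDdec _ _ _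
  -- On input `(m, r)` the program outputs the element whose code has exactly `r` predecessors.
  let G : ℕ → ℕ → Prop := fun z y => ∃ t, E z.unpair.1 t ∧
    Nat.count (E z.unpair.1) t = z.unpair.2 ∧ y = t.unpair.2
  have hG : SigIn g fun q : ℕ × ℕ => G q.1 q.2 := by
    refine SigIn.ex ?_
    have hB : PrimrecPred fun q : List ℕ × ℕ × ℕ × ℕ => D q.1 q.2.1.unpair.1 q.2.2.2 ∧
        ((List.range q.2.2.2).filter fun t => decide (D q.1 q.2.1.unpair.1 t)).length =
          q.2.1.unpair.2 ∧ q.2.2.1 = q.2.2.2.unpair.2 := by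
      have h1 : PrimrecPred fun q : List ℕ × ℕ × ℕ × ℕ => D q.1 q.2.1.unpair.1 q.2.2.2 :=
        hD.comp (f := fun q : List ℕ × ℕ × ℕ × ℕ => (q.1, q.2.1.unpair.1, q.2.2.2)) (by fun_prop)
      have h2 : Primrec fun q : (List ℕ × ℕ × ℕ × ℕ) × ℕ => decide (D q.1.1 q.1.2.1.unpair.1 q.2) :=
        (hD.comp (f := fun q : (List ℕ × ℕ × ℕ × ℕ) × ℕ => (q.1.1, q.1.2.1.unpair.1, q.2))
          (by fun_prop)).decide
      have h3 := PR.filter (f := fun q : List ℕ × ℕ × ℕ × ℕ => List.range q.2.2.2)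
        (p := fun q t => decide (D q.1 q.2.1.unpair.1 t)) (by fun_prop) h2
      exact PR.and h1 (PR.and (PR.eq (Primrec.list_length.comp h3) (by fun_prop)) (by fun_prop))
    have hpre : FunIn (fun q : (ℕ × ℕ) × ℕ => pre g (q.2 + 1)) g :=
      (FunIn.oracle.pre).comp (h := fun q : (ℕ × ℕ) × ℕ => q.2 + 1) (FunIn.of_primrec (by fun_prop))
    refine (SigIn.comp_decide (g := g) hB.decide (f := fun q : (ℕ × ℕ) × ℕ =>
      (pre g (q.2 + 1), q.1.1, q.1.2, q.2)) (hpre.pair (FunIn.of_primrec (by fun_prop)))).of_iff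
        fun q => ?_
    refine and_congr_right fun _ => and_congr_left fun _ => ?_
    have : Nat.count (E q.1.1.unpair.1) q.2 = ((List.range q.2).filter fun t =>
        decide (D (pre g (q.2 + 1)) q.1.1.unpair.1 t)).length := by
      rw [Nat.count_eq_card_filter_range]
      refine Eq.trans (b := ((List.range q.2).filter fun t =>
        decide (E q.1.1.unpair.1 t)).length) rfl ?_
      congr 1
      refine List.filter_congr fun t ht => decide_eq_decide.2 (hE _ _ _ ?_).symm
      exact (List.mem_range.1 ht).le
    rw [this]
  have hGuniq : ∀ z y y', G z y → G z y' → y = y' := by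
    rintro z y y' ⟨t, ht, hc, rfl⟩ ⟨t', ht', hc', rfl⟩
    rw [Nat.count_injective ht ht' (hc.trans hc'.symm)]
  obtain ⟨c, hc⟩ := hG.exists_oracleCode hGuniq
  refine ⟨c, fun m n hn i hi => ?_⟩
  have hex : ∃ w, R (pre g w) (m, i) = true := (H (m, i)).1 hi
  let t := Nat.pair (Nat.find hex) i
  have ht : E m t := by
    rw [hER]
    simp only [t, Nat.unpair_pair]
    exact ⟨Nat.find_spec hex, fun w hw => by simpa using Nat.find_min hex hw⟩
  have hGt : G (Nat.pair m (Nat.count (E m) t)) i := ⟨t, by simpa using ht, by simp, by simp [t]⟩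
  refine ⟨Nat.count (E m) t, ?_, fun y => ?_⟩
  -- The predecessors contribute distinct elements of the section, so the bound on finite subsets
  -- bounds the rank.
  · rw [Nat.count_eq_card_filter_range, ← Finset.card_image_of_injOn (f := fun t => t.unpair.2)]
    · refine hn _ fun j hj => ?_
      obtain ⟨s, hs, rfl⟩ := Finset.mem_image.1 hj
      exact hET m s (Finset.mem_filter.1 hs).2
    · intro s hs s' hs' h
      exact hEinj m s s' (Finset.mem_filter.1 hs).2 (Finset.mem_filter.1 hs').2 h
  · rw [hc]
    exact ⟨fun h => hGuniq _ _ _ h hGt, fun h => h ▸ hGt⟩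

end Trace
end Cupping

namespace Cupping
open MeasureTheory

/-! ### Forcing with closed sets of positive measure -/

section Forcing

variable {g : ℕ → ℕ}

theorem isOpen_cylinder (σ : List Bool) : IsOpen (cylinder σ) := by
  have : cylinder σ = {Z | ∀ i ∈ Finset.range σ.length, Z i = σ.getD i false} := by
    ext Z
    constructor
    · intro h i hi
      have hi := Finset.mem_range.1 hi
      simp [h i hi, hi]
    · intro h i hi
      simpa [hi] using h i (Finset.mem_range.2 hi)
  rw [this]
  have : {Z : ℕ → Bool | ∀ i ∈ Finset.range σ.length, Z i = σ.getD i false} =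
      ⋂ i ∈ Finset.range σ.length, (fun Z : ℕ → Bool => Z i) ⁻¹' {σ.getD i false} := by
    ext Z
    simp
  rw [this]
  exact isOpen_biInter_finset fun i _ => (isOpen_discrete _).preimage (continuous_apply i)

theorem isOpen_openSet (W : Set (List Bool)) : IsOpen (openSet W) :=
  isOpen_biUnion fun σ _ => isOpen_cylinder σ

theorem openSet_union (V W : Set (List Bool)) : openSet (V ∪ W) = openSet V ∪ openSet W :=
  Set.biUnion_union V W _

theorem openSet_mono {V W : Set (List Bool)} (h : V ⊆ W) : openSet V ⊆ openSet W :=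
  Set.biUnion_subset_biUnion_left h

theorem countable_setOf_sigIn {α : Type*} [Primcodable α] (g : ℕ → ℕ) :
    {p : α → Prop | SigIn g p}.Countable := by
  refine (Set.countable_range fun (c : Nat.Partrec.Code) (a : α) => ∃ k, (c.eval
    (Nat.pair (Encodable.encode (pre g k)) (Encodable.encode a))).Dom).mono fun p hp => ?_
  obtain ⟨c, hc⟩ := SigIn.exists_code hp
  exact ⟨c, funext fun a => propext (hc a).symm⟩

/-- Each test is determined by a code, so the forcing can treat all tests one after the other; the
empty test makes the collection nonempty. -/
theorem exists_mlTest_sequence (A : Set ℕ) : ∃ W : ℕ → ℕ → Set (List Bool),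
    (∀ n, IsMLTest A (W n)) ∧ ∀ W', IsMLTest A W' → ∃ n, W n = W' := by
  have hc : {W | IsMLTest A W}.Countable := by
    refine ((countable_setOf_sigIn (α := ℕ × List Bool) (charFun A)).preimage_of_injOn
      (f := fun (W : ℕ → Set (List Bool)) q => q.2 ∈ W q.1) ?_).mono
      fun W hW => isCEIn_iff_sigIn.1 hW.1
    intro W _ W' _ h
    ext n σ
    exact iff_of_eq (congrFun h (n, σ))
  have hne : {W | IsMLTest A W}.Nonempty := by
    refine ⟨fun _ => ∅, isCEIn_iff_sigIn.2 ?_, fun n => by simp [openSet]⟩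
    exact (SigIn.of_primrec (p := fun _ => False) (by fun_prop)).of_iff fun q => by simp
  obtain ⟨W, hW⟩ := hc.exists_eq_range hne
  refine ⟨W, fun n => ?_, fun W' hW' => ?_⟩
  · have : W n ∈ {W | IsMLTest A W} := hW ▸ Set.mem_range_self n
    exact this
  · have : W' ∈ Set.range W := hW ▸ hW'
    exact this

/-- A component of measure less than that of the closed set can be removed from it. -/
theorem IsMLTest.exists_measure_union_compl_ne_zero {A : Set ℕ} {W : ℕ → Set (List Bool)}
    (hW : IsMLTest A W) {V : Set (List Bool)} (hV : coinMeasure (openSet V)ᶜ ≠ 0) :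
    ∃ k, coinMeasure (openSet (V ∪ W k))ᶜ ≠ 0 := by
  obtain ⟨k, hk⟩ := ENNReal.exists_inv_two_pow_lt hV
  refine ⟨k, fun h => not_le_of_gt hk ?_⟩
  calc coinMeasure (openSet V)ᶜ ≤ coinMeasure ((openSet (V ∪ W k))ᶜ ∪ openSet (W k)) := by
        refine measure_mono fun Z hZ => ?_
        rw [openSet_union]
        by_cases h : Z ∈ openSet (W k)
        · exact Or.inr h
        · exact Or.inl fun h' => h'.elim hZ h
    _ ≤ 0 + 2⁻¹ ^ k := (measure_union_le _ _).trans (add_le_add h.le (hW.2 k))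
    _ = 2⁻¹ ^ k := zero_add _

theorem exists_openSet_eq_compl_zeroBlock (m i : ℕ) : ∃ V : Set (List Bool),
    (SigIn g fun σ => σ ∈ V) ∧ openSet V = (zeroBlock m i)ᶜ := by
  refine ⟨{σ | σ.length = m * i + m ∧ ∃ j < m, σ[m * i + j]? = some true},
    SigIn.of_primrec (p := fun σ : List Bool => σ.length = m * i + m ∧
      ∃ j < m, σ[m * i + j]? = some true) (by fun_prop), ?_⟩
  ext Z
  simp only [openSet, Set.mem_iUnion, exists_prop, mem_cylinder_iff_seg, Set.mem_ofPred_eq,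
    Set.mem_compl_iff, zeroBlock, not_forall, Bool.not_eq_false]
  constructor
  · rintro ⟨σ, ⟨hl, j, hj, h⟩, hσ⟩
    rw [← hσ, getElem?_seg (by omega)] at h
    exact ⟨j, hj, Option.some_injective _ h⟩
  · rintro ⟨j, hj, h⟩
    exact ⟨seg Z (m * i + m), ⟨by simp, j, hj, by rw [getElem?_seg (by omega), h]⟩, by simp⟩

/-- Forcing with closed sets of positive measure: if every closed set of positive measure that is
`Π⁰₁` relative to `A` meets infinitely many of the given blocks in positive measure, then some
sequence that is random relative to `A` is in infinitely many of them. -/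
theorem exists_isMLRandom_frequently_mem_zeroBlock {A : Set ℕ} {p : ℕ → ℕ}
    (h : ∀ V : Set (List Bool), (SigIn (charFun A) fun σ => σ ∈ V) →
      coinMeasure (openSet V)ᶜ ≠ 0 → ∀ n, ∃ m ≥ n,
        coinMeasure (zeroBlock m (p m) ∩ (openSet V)ᶜ) ≠ 0) :
    ∃ Z, IsMLRandom A Z ∧ ∀ n, ∃ m ≥ n, Z ∈ zeroBlock m (p m) := by
  obtain ⟨W, hW, hW'⟩ := exists_mlTest_sequence A
  let S : Type := {V : Set (List Bool) // (SigIn (charFun A) fun σ => σ ∈ V) ∧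
    coinMeasure (openSet V)ᶜ ≠ 0}
  have hstep : ∀ (n : ℕ) (V : S), ∃ V' : S, V.1 ⊆ V'.1 ∧ (∃ k, W n k ⊆ V'.1) ∧
      ∃ m ≥ n, (openSet V'.1)ᶜ ⊆ zeroBlock m (p m) := by
    rintro n ⟨V, hV, hV0⟩
    obtain ⟨k, hk⟩ := (hW n).exists_measure_union_compl_ne_zero hV0
    have hVk : SigIn (charFun A) fun σ => σ ∈ V ∪ W n k :=
      hV.or ((isCEIn_iff_sigIn.1 (hW n).1).comp_primrec
        (f := fun σ : List Bool => (k, σ)) (by fun_prop))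
    obtain ⟨m, hm, hm0⟩ := h _ hVk hk n
    obtain ⟨V', hV', hV'm⟩ := exists_openSet_eq_compl_zeroBlock (g := charFun A) m (p m)
    have hcompl : (openSet (V ∪ W n k ∪ V'))ᶜ = zeroBlock m (p m) ∩ (openSet (V ∪ W n k))ᶜ := by
      rw [openSet_union _ V', hV'm, Set.compl_union, compl_compl, Set.inter_comm]
    refine ⟨⟨V ∪ W n k ∪ V', hVk.or hV', by rwa [hcompl]⟩, ?_, ⟨k, ?_⟩, m, hm, ?_⟩
    · exact Set.subset_union_left.trans Set.subset_union_left
    · exact Set.subset_union_right.trans Set.subset_union_left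
    · rw [hcompl]
      exact Set.inter_subset_left
  choose next h1 h2 h3 using hstep
  have hempty : SigIn (charFun A) fun σ : List Bool => σ ∈ (∅ : Set (List Bool)) :=
    (SigIn.of_primrec (p := fun _ => False) (by fun_prop)).of_iff fun q => by simp
  let V : ℕ → S := fun n => Nat.rec ⟨∅, hempty, by simp [openSet]⟩ next n
  have hVs : ∀ n, V (n + 1) = next n (V n) := fun _ => rfl
  -- The closed sets decrease and are nonempty because their measure is positive; by compactness a
  -- sequence lies in all of them. Step `n` excludes a component of test `n` and forces membership
  -- in a block with `m ≥ n`.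
  obtain ⟨Z, hZ⟩ := IsCompact.nonempty_iInter_of_sequence_nonempty_isCompact_isClosed
    (fun n => (openSet (V n).1)ᶜ)
    (fun n => Set.compl_subset_compl.2 (openSet_mono (hVs n ▸ h1 n (V n))))
    (fun n => nonempty_of_measure_ne_zero (V n).2.2)
    (isOpen_openSet _).isClosed_compl.isCompact (fun n => (isOpen_openSet _).isClosed_compl)
  rw [Set.mem_iInter] at hZ
  refine ⟨Z, fun W' hWW' hZW => ?_, fun n => ?_⟩
  · obtain ⟨n, rfl⟩ := hW' W' hWW'
    obtain ⟨k, hk⟩ := h2 n (V n)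
    exact hZ (n + 1) (openSet_mono hk (Set.mem_iInter.1 hZW k))
  · obtain ⟨m, hm, hsub⟩ := h3 n (V n)
    exact ⟨m, hm, hsub (hZ (n + 1))⟩

/-- The tails of the sequence of blocks form a test relative to `B`, as in the Borel–Cantelli lemma.
-/
theorem not_isMLRandom_of_frequently_mem_zeroBlock {B : Set ℕ} {p : ℕ → ℕ}
    (hp : FunIn p (charFun B)) {Z : ℕ → Bool} (hZ : ∀ n, ∃ m ≥ n, Z ∈ zeroBlock m (p m)) :
    ¬ IsMLRandom B Z := by
  -- Starting at `n + 1` makes the geometric tail sum to exactly `2^(-n)`.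
  let W : ℕ → Set (List Bool) := fun n => {σ | ∃ m, n + 1 ≤ m ∧ σ.length = m * p m + m ∧
    ∀ j < m, σ[m * p m + j]? = some false}
  have hW : ∀ n, openSet (W n) = ⋃ k, zeroBlock (n + 1 + k) (p (n + 1 + k)) := by
    intro n
    ext Z
    simp only [openSet, Set.mem_iUnion, exists_prop, mem_cylinder_iff_seg, W, Set.mem_ofPred_eq,
      zeroBlock]
    constructor
    · rintro ⟨σ, ⟨m, hm, hl, h⟩, hσ⟩
      obtain ⟨k, rfl⟩ := Nat.exists_eq_add_of_le hm
      refine ⟨k, fun j hj => ?_⟩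
      have := h j hj
      rw [← hσ, getElem?_seg (by omega)] at this
      exact Option.some_injective _ this
    · rintro ⟨k, h⟩
      refine ⟨seg Z _, ⟨n + 1 + k, by omega, length_seg _ _, fun j hj => ?_⟩, by simp⟩
      rw [getElem?_seg (by omega), h j hj]
  have htest : IsMLTest B W := by
    refine ⟨isCEIn_iff_sigIn.2 ?_, fun n => ?_⟩
    · have hB : PrimrecPred fun q : ℕ × ℕ × ℕ × List Bool => q.2.2.1 + 1 ≤ q.1 ∧
          q.2.2.2.length = q.1 * q.2.1 + q.1 ∧
            ∀ j < q.1, q.2.2.2[q.1 * q.2.1 + j]? = some false := by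
        fun_prop
      exact SigIn.ex (SigIn.comp_decide hB.decide
        (f := fun q : (ℕ × List Bool) × ℕ => (q.2, p q.2, q.1.1, q.1.2))
        (FunIn.pair (by fun_prop) (FunIn.pair (hp.comp (by fun_prop)) (by fun_prop))))
    · rw [hW]
      refine (measure_iUnion_le _).trans ?_
      simp only [coinMeasure_zeroBlock, pow_add _ (n + 1)]
      rw [ENNReal.tsum_mul_left, ENNReal.tsum_geometric, ENNReal.one_sub_inv_two, inv_inv, pow_succ,
        mul_assoc, ENNReal.inv_mul_cancel (by simp) (by simp), mul_one]
  intro h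
  refine h W htest (Set.mem_iInter.2 fun n => ?_)
  obtain ⟨m, hm, hZm⟩ := hZ (n + 1)
  obtain ⟨k, rfl⟩ := Nat.exists_eq_add_of_le hm
  rw [hW]
  exact Set.mem_iUnion.2 ⟨k, hZm⟩

end Forcing

/-! ### LR-hardness gives traces -/

section LRHard

variable {g : ℕ → ℕ}

theorem natCast_mul_inv_two_pow_le_iff (a L e : ℕ) :
    (a : ENNReal) * 2⁻¹ ^ L ≤ 2⁻¹ ^ e ↔ a * 2 ^ e ≤ 2 ^ L := by
  rw [← ENNReal.inv_pow, ← ENNReal.inv_pow, ENNReal.le_inv_iff_mul_le, mul_right_comm,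
    ← div_eq_mul_inv, ENNReal.div_le_iff (by simp) (by simp), one_mul]
  exact_mod_cast Iff.rfl

/-- The blocks that have small intersection with a closed set that is `Π⁰₁` relative to `g`
include a trace of those that have intersection of measure zero. -/
theorem exists_trace {V : Set (List Bool)} (hV : SigIn g fun σ => σ ∈ V)
    (hV0 : coinMeasure (openSet V)ᶜ ≠ 0) : ∃ (c : OracleCode) (C : ℕ), ∀ m i,
      coinMeasure (zeroBlock m i ∩ (openSet V)ᶜ) = 0 →
        ∃ r < C * 2 ^ m, ∀ y, y ∈ c.eval (tot g) (Nat.pair m r) ↔ y = i := by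
  obtain ⟨C, d, hCd⟩ := exists_card_lt_of_zeroBlock_inter_le hV0
  let F : ℕ → ℕ → List (List Bool) → List Bool → Bool := fun m i S τ =>
    decide ((∀ j < m, τ[m * i + j]? = some false) ∧ ¬ ∃ σ ∈ S, σ = τ.take σ.length)
  let B : ℕ → ℕ → List (List Bool) → ℕ → Prop := fun m i S L => (∀ σ ∈ S, σ.length ≤ L) ∧
    m * i + m ≤ L ∧ cnt (F m i S) L * 2 ^ (m + d) ≤ 2 ^ L
  have hB : PrimrecPred fun q : ((ℕ × ℕ) × List (List Bool)) × ℕ => B q.1.1.1 q.1.1.2 q.1.2 q.2 := by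
    simp only [B, cnt, F]
    fun_prop
  have hF : ∀ m i S L, (∀ σ ∈ S, σ.length ≤ L) → m * i + m ≤ L →
      zeroBlock m i ∩ (openSet {σ | σ ∈ S})ᶜ = {Z | F m i S (seg Z L) = true} := by
    intro m i S L hS hL
    ext Z
    rw [zeroBlock_eq_seg m i hL]
    simp only [F, openSet, Set.mem_inter_iff, Set.mem_ofPred_eq, Set.mem_compl_iff, Set.mem_iUnion,
      exists_prop, decide_eq_true_eq]
    refine and_congr_right fun _ => not_congr (exists_congr fun σ => and_congr_right fun hσ => ?_)
    rw [mem_cylinder_iff_prefix (hS σ hσ), List.prefix_iff_eq_take]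
  have hBm : ∀ m i S L, (∀ σ ∈ S, σ.length ≤ L) → m * i + m ≤ L →
      (cnt (F m i S) L * 2 ^ (m + d) ≤ 2 ^ L ↔
        coinMeasure (zeroBlock m i ∩ (openSet {σ | σ ∈ S})ᶜ) ≤ 2⁻¹ ^ (m + d)) := by
    intro m i S L hS hL
    rw [hF m i S L hS hL, coinMeasure_seg, natCast_mul_inv_two_pow_le_iff]
  -- Enumerated is each `i` for which finitely many strings of `V` already cover the block up to
  -- measure `2^(-(m + d))`.
  have hT : SigIn g fun q : ℕ × ℕ => ∃ S : List (List Bool), ∃ L,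
      (∀ j < S.length, S.getD j [] ∈ V) ∧ B q.1 q.2 S L := by
    refine SigIn.ex (SigIn.ex (SigIn.and (SigIn.forall_lt (by fun_prop) ?_)
      (SigIn.of_primrec hB.decide)))
    exact hV.comp_primrec
      (f := fun q : (((ℕ × ℕ) × List (List Bool)) × ℕ) × ℕ => q.1.1.2.getD q.2 []) (by fun_prop)
  obtain ⟨c, hc⟩ := SigIn.exists_enumeration
    (T := fun m i => ∃ S L, (∀ j < S.length, S.getD j [] ∈ V) ∧ B m i S L) hT
  refine ⟨c, C, fun m i hmi => hc m (C * 2 ^ m) (fun F hF => hCd m F fun i hi => ?_) i ?_⟩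
  · obtain ⟨S, L, hS, hS', hL, hcnt⟩ := hF i hi
    refine le_trans (measure_mono (Set.inter_subset_inter_right _ (Set.compl_subset_compl.2
      (openSet_mono fun σ hσ => ?_)))) ((hBm m i S L hS' hL).1 hcnt)
    obtain ⟨j, hj, rfl⟩ := List.mem_iff_getElem.1 hσ
    simpa [hj] using hS j hj
  · obtain ⟨S, hS, hSm⟩ := exists_finite_measure_diff_le (measurableSet_zeroBlock m i) hmi
      (ε := 2⁻¹ ^ (m + d)) (by simp)
    -- The sum of all lengths, added to the end of the block, is a common length at which the
    -- covering can be counted.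
    have hS' : ∀ σ ∈ S, σ.length ≤ m * i + m + (S.map List.length).sum := fun σ hσ =>
      (List.single_le_sum (fun _ _ => Nat.zero_le _) _ (List.mem_map.2 ⟨σ, hσ, rfl⟩)).trans
        (Nat.le_add_left _ _)
    refine ⟨S, m * i + m + (S.map List.length).sum, fun j hj => ?_, hS', by omega,
      (hBm m i S _ hS' (by omega)).2 hSm⟩
    simpa [hj] using hS _ (List.getElem_mem hj)

/-- If `p` were untraced from some point on, no closed set of positive measure that is `Π⁰₁` in `A`
could eventually avoid its blocks; forcing would then contradict LR-hardness. -/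
theorem joinsDelta2DNR_of_lrHard {A : Set ℕ} (hA : IsCE A) (h : LRHard A) : JoinsDelta2DNR A := by
  refine joinsDelta2DNR_of_trace hA (b := fun N => Nat.pair N (Nat.pair N (N * 2 ^ N)) + 1)
    (v := fun y => y) (by fun_prop) (by fun_prop) fun p hp n => ?_
  by_contra hcon
  push Not at hcon
  have hdense : ∀ V : Set (List Bool), (SigIn (charFun A) fun σ => σ ∈ V) →
      coinMeasure (openSet V)ᶜ ≠ 0 → ∀ n, ∃ m ≥ n,
        coinMeasure (zeroBlock m (p m) ∩ (openSet V)ᶜ) ≠ 0 := by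
    intro V hV hV0 n₀
    by_contra hstuck
    push Not at hstuck
    obtain ⟨c, C, hc⟩ := exists_trace hV hV0
    -- Large enough for the failure of tracing, for the avoidance of the block, for the program
    -- index, and for `C * 2 ^ N ≤ N * 2 ^ N`.
    let N := n + n₀ + c.index + C
    obtain ⟨r, hr, hcr⟩ := hc N (p N) (hstuck N (by omega))
    refine hcon N (by omega) c (Nat.pair N r) (Nat.lt_succ_of_le (pair_mono (by omega)
      (pair_mono le_rfl (hr.le.trans (Nat.mul_le_mul_right _ (by omega)))))) (p N) ?_ rfl
    exact (hcr _).2 rfl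
  obtain ⟨Z, hZ, hZp⟩ := exists_isMLRandom_frequently_mem_zeroBlock hdense
  exact not_isMLRandom_of_frequently_mem_zeroBlock hp hZp (h Z hZ)

end LRHard
end Cupping

namespace Cupping
open Nat.Partrec (Code)
open MeasureTheory

/-! ### A cost construction relative to an oracle: definitions -/

section Operator

/-- The component of a test that the strategy number `p` works with. -/
def testIndex (p : ℕ) : ℕ := p + p.unpair.2 + 2

/-- Some string in `S` is an initial segment of `τ`. -/
def covers (S : List (List Bool)) (τ : List Bool) : Bool := decide (∃ σ ∈ S, σ = τ.take σ.length)

/-- The strings that the program number `p.unpair.1` enumerates into the component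
`testIndex p` of a test in `l.length` steps with oracle `l`. -/
def enumStrings (p : ℕ) (l : List ℕ) : List (List Bool) :=
  ((List.range l.length).flatMap strs).filter fun σ => decide (∃ k < l.length + 1,
    (Code.evaln l.length (Denumerable.ofNat Code p.unpair.1) (Nat.pair (Encodable.encode (l.take k))
      (Nat.pair (testIndex p) (Encodable.encode σ)))).isSome = true)

/-- The strings of `enumStrings`, as long as they cover little. -/
def goodStrings (p : ℕ) (l : List ℕ) : List (List Bool) :=
  (List.range (l.length + 1)).flatMap fun k =>
    if cnt (covers (enumStrings p (l.take k))) k * 2 ^ testIndex p ≤ 2 ^ k then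
      enumStrings p (l.take k) else []

/-- The initial segment of length `n` of the join of the oracle `l` with the set `W`. -/
def joinList (l W : List ℕ) (n : ℕ) : List ℕ :=
  (List.range n).map fun i => l.getD i 0 + 2 * if i ∈ W then 1 else 0

/-- The number `x` may be enumerated, with oracle `l`, when `W` is the set of the numbers that have
been enumerated and the current approximation to the join has length `n`. -/
def Eligible (l W : List ℕ) (n x : ℕ) : Prop :=
  -- The number `x` serves to defeat the program `x.unpair.1`. Each program receives at most one
  -- number, it must have answered `0` there, and cutting the approximation to the join back to
  -- length `x` must lose little measure for every `p` up to the program's index.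
  (∀ y ∈ W, y.unpair.1 ≠ x.unpair.1) ∧
  (∃ k < l.length + 1, Code.evaln l.length (translate x.unpair.1)
    (Nat.pair (Encodable.encode (l.take k)) x) = some 0) ∧
  ∀ p < x.unpair.1 + 1,
    cnt (covers (goodStrings p (joinList l W n))) n * 2 ^ (x.unpair.1 + testIndex p) ≤
      cnt (covers (goodStrings p (joinList l W x))) n * 2 ^ (x.unpair.1 + testIndex p) + 2 ^ n

noncomputable instance (l W : List ℕ) (n x : ℕ) : Decidable (Eligible l W n x) := by
  unfold Eligible
  infer_instance

/-- One step of the construction. -/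
noncomputable def opStep (l : List ℕ) (q : List ℕ × ℕ) : List ℕ × ℕ :=
  if (List.range q.2).filter (fun x => decide (Eligible l q.1 q.2 x)) = [] then (q.1, q.2 + 1) else
    (((List.range q.2).filter fun x => decide (Eligible l q.1 q.2 x)).getD 0 0 :: q.1,
      ((List.range q.2).filter fun x => decide (Eligible l q.1 q.2 x)).getD 0 0)

/-- The first `l.length` steps of the construction. -/
noncomputable def opRun (l : List ℕ) : List ℕ × ℕ := Nat.rec ([], 0) (fun s q => opStep (l.take s) q) l.length

section Primrec

variable {α β γ : Type*} [Primcodable α] [Primcodable β] [Primcodable γ]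

@[fun_prop] theorem PR.flatMap {f : α → List β} {g : α → β → List γ} (hf : Primrec f)
    (hg : Primrec fun q : α × β => g q.1 q.2) : Primrec fun a => (f a).flatMap fun b => g a b :=
  Primrec.list_flatMap hf hg

@[fun_prop] theorem primrec_testIndex : Primrec testIndex := by
  unfold testIndex
  fun_prop

@[fun_prop] theorem PR.mem {f : α → β} {l : α → List β} (hf : Primrec f) (hl : Primrec l) :
    PrimrecPred fun a => f a ∈ l a :=
  (PR.exists_mem (p := fun a b => b = f a) hl (PR.eq Primrec.snd (hf.comp Primrec.fst))).of_eq
    fun a => by simp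

@[fun_prop] theorem PR.cnt {F : α → List Bool → Bool} {f : α → ℕ}
    (hF : Primrec fun q : α × List Bool => F q.1 q.2) (hf : Primrec f) :
    Primrec fun a => cnt (F a) (f a) := by
  unfold Cupping.cnt
  fun_prop

@[fun_prop] theorem PR.covers {S : α → List (List Bool)} {τ : α → List Bool} (hS : Primrec S)
    (hτ : Primrec τ) : Primrec fun a => covers (S a) (τ a) := by
  unfold Cupping.covers
  fun_prop

@[fun_prop] theorem PR.enumStrings {p : α → ℕ} {l : α → List ℕ} (hp : Primrec p) (hl : Primrec l) :
    Primrec fun a => enumStrings (p a) (l a) := by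
  unfold Cupping.enumStrings
  fun_prop

@[fun_prop] theorem PR.goodStrings {p : α → ℕ} {l : α → List ℕ} (hp : Primrec p) (hl : Primrec l) :
    Primrec fun a => goodStrings (p a) (l a) := by
  unfold Cupping.goodStrings
  fun_prop

@[fun_prop] theorem PR.joinList {l W : α → List ℕ} {n : α → ℕ} (hl : Primrec l) (hW : Primrec W)
    (hn : Primrec n) : Primrec fun a => joinList (l a) (W a) (n a) := by
  unfold Cupping.joinList
  fun_prop

@[fun_prop] theorem PR.eligible {l W : α → List ℕ} {n x : α → ℕ} (hl : Primrec l) (hW : Primrec W)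
    (hn : Primrec n) (hx : Primrec x) : PrimrecPred fun a => Eligible (l a) (W a) (n a) (x a) := by
  unfold Eligible
  fun_prop

theorem primrec_opRun : Primrec opRun := by
  unfold opRun opStep
  fun_prop

end Primrec

end Operator
end Cupping

namespace Cupping
open Nat.Partrec (Code)
open MeasureTheory

/-! ### Measure of the accepted strings -/

section Strings

/-- The open set generated by a list of strings. -/
abbrev listOpen (S : List (List Bool)) : Set (ℕ → Bool) := openSet {σ | σ ∈ S}

theorem listOpen_eq_seg {S : List (List Bool)} {L : ℕ} (h : ∀ σ ∈ S, σ.length ≤ L) :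
    listOpen S = {Z | covers S (seg Z L) = true} := by
  ext Z
  simp only [covers, openSet, Set.mem_ofPred_eq, Set.mem_iUnion, exists_prop, decide_eq_true_eq]
  refine exists_congr fun σ => and_congr_right fun hσ => ?_
  rw [mem_cylinder_iff_prefix (h σ hσ), List.prefix_iff_eq_take]

theorem coinMeasure_listOpen {S : List (List Bool)} {L : ℕ} (h : ∀ σ ∈ S, σ.length ≤ L) :
    coinMeasure (listOpen S) = cnt (covers S) L * 2⁻¹ ^ L := by
  rw [listOpen_eq_seg h, coinMeasure_seg]

theorem mem_enumStrings {p : ℕ} {l : List ℕ} {σ : List Bool} : σ ∈ enumStrings p l ↔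
    σ.length < l.length ∧ ∃ k ≤ l.length,
      (Code.evaln l.length (Denumerable.ofNat Code p.unpair.1) (Nat.pair (Encodable.encode (l.take k))
        (Nat.pair (testIndex p) (Encodable.encode σ)))).isSome = true := by
  simp [enumStrings, mem_strs]

theorem enumStrings_subset {p : ℕ} {l l' : List ℕ} (h : l <+: l') :
    enumStrings p l ⊆ enumStrings p l' := by
  intro σ hσ
  rw [mem_enumStrings] at hσ ⊢
  obtain ⟨hl, k, hk, he⟩ := hσ
  refine ⟨hl.trans_le h.length_le, k, hk.trans h.length_le, ?_⟩
  obtain ⟨t, rfl⟩ := h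
  rw [List.take_append_of_le_length hk]
  obtain ⟨x, hx⟩ := Option.isSome_iff_exists.1 he
  exact Option.isSome_iff_exists.2 ⟨x, Code.evaln_mono (by simp) hx⟩

theorem coinMeasure_enumStrings_le_iff {p k : ℕ} {l : List ℕ} (h : l.length = k) :
    cnt (covers (enumStrings p l)) k * 2 ^ testIndex p ≤ 2 ^ k ↔
      coinMeasure (listOpen (enumStrings p l)) ≤ 2⁻¹ ^ testIndex p := by
  subst h
  rw [coinMeasure_listOpen fun σ hσ => (mem_enumStrings.1 hσ).1.le, natCast_mul_inv_two_pow_le_iff]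

theorem mem_goodStrings {p : ℕ} {l : List ℕ} {σ : List Bool} : σ ∈ goodStrings p l ↔
    ∃ k ≤ l.length, coinMeasure (listOpen (enumStrings p (l.take k))) ≤ 2⁻¹ ^ testIndex p ∧
      σ ∈ enumStrings p (l.take k) := by
  simp only [goodStrings, List.mem_flatMap, List.mem_range, Nat.lt_succ_iff]
  refine exists_congr fun k => and_congr_right fun hk => ?_
  rw [← coinMeasure_enumStrings_le_iff (p := p) (l := l.take k) (k := k) (by simpa using hk)]
  split_ifs with h <;> simp [h]

theorem goodStrings_subset {p : ℕ} {l l' : List ℕ} (h : l <+: l') :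
    goodStrings p l ⊆ goodStrings p l' := by
  intro σ hσ
  rw [mem_goodStrings] at hσ ⊢
  obtain ⟨k, hk, he⟩ := hσ
  refine ⟨k, hk.trans h.length_le, ?_⟩
  obtain ⟨t, rfl⟩ := h
  rwa [List.take_append_of_le_length hk]

theorem length_le_of_mem_goodStrings {p : ℕ} {l : List ℕ} {σ : List Bool}
    (h : σ ∈ goodStrings p l) : σ.length ≤ l.length := by
  obtain ⟨k, hk, -, h⟩ := mem_goodStrings.1 h
  have := (mem_enumStrings.1 h).1
  rw [List.length_take] at this
  omega

/-- The enumerations increase with the prefix, so all accepted strings come from the longest prefix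
that meets the bound. The bound must be imposed because a wrong approximation to the join may
enumerate too much. -/
theorem coinMeasure_goodStrings_le (p : ℕ) (l : List ℕ) :
    coinMeasure (listOpen (goodStrings p l)) ≤ 2⁻¹ ^ testIndex p := by
  by_cases hne : ∃ k ≤ l.length,
      coinMeasure (listOpen (enumStrings p (l.take k))) ≤ 2⁻¹ ^ testIndex p
  · classical
    obtain ⟨hk, hμ⟩ := Nat.findGreatest_spec (P := fun k => k ≤ l.length ∧
      coinMeasure (listOpen (enumStrings p (l.take k))) ≤ 2⁻¹ ^ testIndex p)
      hne.choose_spec.1 hne.choose_spec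
    refine (measure_mono (openSet_mono fun σ hσ => ?_)).trans hμ
    obtain ⟨k, hk, hkμ, h⟩ := mem_goodStrings.1 hσ
    exact enumStrings_subset (List.take_prefix_take_left (Nat.le_findGreatest (P := fun k =>
      k ≤ l.length ∧ coinMeasure (listOpen (enumStrings p (l.take k))) ≤ 2⁻¹ ^ testIndex p)
      hk ⟨hk, hkμ⟩)) h
  · have : {σ | σ ∈ goodStrings p l} = ∅ := by
      ext σ
      simp only [Set.mem_ofPred_eq, Set.mem_empty_iff_false, iff_false]
      intro h
      obtain ⟨k, hk, hkμ, -⟩ := mem_goodStrings.1 h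
      exact hne ⟨k, hk, hkμ⟩
    rw [listOpen, this]
    simp [openSet]

theorem natCast_mul_inv_two_pow_le_add_iff (a b L e : ℕ) :
    (a : ENNReal) * 2⁻¹ ^ L ≤ b * 2⁻¹ ^ L + 2⁻¹ ^ e ↔ a * 2 ^ e ≤ b * 2 ^ e + 2 ^ L := by
  have h : ∀ n : ℕ, (2⁻¹ ^ n : ENNReal) * 2 ^ n = 1 := fun n => by
    rw [← mul_pow, ENNReal.inv_mul_cancel (by simp) (by simp), one_pow]
  have h1 : (a : ENNReal) * 2⁻¹ ^ L * (2 ^ L * 2 ^ e) = ((a * 2 ^ e : ℕ) : ENNReal) := by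
    calc (a : ENNReal) * 2⁻¹ ^ L * (2 ^ L * 2 ^ e) = a * 2 ^ e * (2⁻¹ ^ L * 2 ^ L) := by ring
      _ = _ := by rw [h]; push_cast; ring
  have h2 : ((b : ENNReal) * 2⁻¹ ^ L + 2⁻¹ ^ e) * (2 ^ L * 2 ^ e) =
      ((b * 2 ^ e + 2 ^ L : ℕ) : ENNReal) := by
    calc ((b : ENNReal) * 2⁻¹ ^ L + 2⁻¹ ^ e) * (2 ^ L * 2 ^ e) =
        b * 2 ^ e * (2⁻¹ ^ L * 2 ^ L) + 2 ^ L * (2⁻¹ ^ e * 2 ^ e) := by ring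
      _ = _ := by rw [h, h]; push_cast; ring
  rw [← ENNReal.mul_le_mul_iff_left (c := 2 ^ L * 2 ^ e) (by simp) (ENNReal.mul_ne_top (by simp)
    (by simp)), h1, h2]
  exact_mod_cast Iff.rfl

end Strings

/-! ### The steps of the construction -/

section Operator

/-- The join of the function `X` with the finite set `W`. -/
def joinFun (X : ℕ → ℕ) (W : List ℕ) (i : ℕ) : ℕ := X i + 2 * if i ∈ W then 1 else 0

theorem joinList_pre (X : ℕ → ℕ) (W : List ℕ) {n s : ℕ} (h : n ≤ s) :
    joinList (pre X s) W n = pre (joinFun X W) n := by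
  refine List.map_congr_left fun i hi => ?_
  have hi := List.mem_range.1 hi
  simp [joinFun, pre, show i < s by omega]

/-- Accepted strings have length at most `n`, so counting at length `n` computes the measures
exactly; `n ≤ s` ensures that the default entries in `joinList` are never read. -/
theorem eligible_pre {X : ℕ → ℕ} {W : List ℕ} {n s x : ℕ} (hn : n ≤ s) (hx : x < n) :
    Eligible (pre X s) W n x ↔ (∀ y ∈ W, y.unpair.1 ≠ x.unpair.1) ∧
      (∃ k ≤ s, Code.evaln s (translate x.unpair.1) (Nat.pair (Encodable.encode (pre X k)) x) =
        some 0) ∧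
      ∀ p ≤ x.unpair.1, coinMeasure (listOpen (goodStrings p (pre (joinFun X W) n))) ≤
        coinMeasure (listOpen (goodStrings p (pre (joinFun X W) x))) +
          2⁻¹ ^ (x.unpair.1 + testIndex p) := by
  unfold Eligible
  rw [joinList_pre X W hn, joinList_pre X W (hx.le.trans hn), length_pre]
  simp only [Nat.lt_succ_iff]
  refine and_congr_right fun _ => and_congr (exists_congr fun k => and_congr_right fun hk => ?_)
    (forall₂_congr fun p _ => ?_)
  · rw [take_pre X hk]
  · rw [coinMeasure_listOpen (L := n) fun σ hσ => ?_, coinMeasure_listOpen (L := n) fun σ hσ => ?_,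
      natCast_mul_inv_two_pow_le_add_iff]
    · have := length_le_of_mem_goodStrings hσ
      rw [length_pre] at this
      omega
    · simpa using length_le_of_mem_goodStrings hσ

theorem opStep_cases (l W : List ℕ) (n : ℕ) :
    (∃ x < n, Eligible l W n x ∧ opStep l (W, n) = (x :: W, x)) ∨
      (∀ x < n, ¬ Eligible l W n x) ∧ opStep l (W, n) = (W, n + 1) := by
  unfold opStep
  simp only
  split_ifs with h
  · right
    refine ⟨fun x hx he => ?_, rfl⟩
    rw [List.filter_eq_nil_iff] at h
    exact h x (List.mem_range.2 hx) (decide_eq_true he)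
  · left
    obtain ⟨x, t, hxt⟩ := List.exists_cons_of_ne_nil h
    have hx : x ∈ (List.range n).filter fun x => decide (Eligible l W n x) := by
      rw [hxt]
      exact List.mem_cons_self
    rw [List.mem_filter, List.mem_range, decide_eq_true_eq] at hx
    exact ⟨x, hx.1, hx.2, by rw [hxt]; rfl⟩

theorem opRun_pre_succ (X : ℕ → ℕ) (s : ℕ) :
    opRun (pre X (s + 1)) = opStep (pre X s) (opRun (pre X s)) := by
  have key : ∀ m n, n ≤ m → (Nat.rec ([], 0) (fun s q => opStep ((pre X m).take s) q) n :
      List ℕ × ℕ) = Nat.rec ([], 0) (fun s q => opStep (pre X s) q) n := by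
    intro m n hn
    induction n with
    | zero => rfl
    | succ n ih =>
      simp only
      rw [ih (by omega), take_pre X (by omega)]
  unfold opRun
  rw [length_pre, length_pre, key (s + 1) (s + 1) le_rfl, key s s le_rfl]

/-- The numbers enumerated in the first `s` steps of the construction. -/
noncomputable def opSet (X : ℕ → ℕ) (s : ℕ) : List ℕ := (opRun (pre X s)).1

/-- The length of the approximation to the join after `s` steps of the construction. -/
noncomputable def opLen (X : ℕ → ℕ) (s : ℕ) : ℕ := (opRun (pre X s)).2

/-- The approximation to the join after `s` steps of the construction. -/
noncomputable def opJoin (X : ℕ → ℕ) (s : ℕ) : List ℕ := pre (joinFun X (opSet X s)) (opLen X s)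

variable (X : ℕ → ℕ)

theorem opLen_le (s : ℕ) : opLen X s ≤ s := by
  induction s with
  | zero => exact le_rfl
  | succ s ih =>
    rcases opStep_cases (pre X s) (opSet X s) (opLen X s) with ⟨x, hx, -, h⟩ | ⟨-, h⟩ <;>
    · have : opLen X (s + 1) = _ := congrArg Prod.snd ((opRun_pre_succ X s).trans h)
      simp only at this
      omega

/-- One step of the construction, in terms of measure. -/
theorem op_cases (s : ℕ) :
    (∃ x < opLen X s, (∀ y ∈ opSet X s, y.unpair.1 ≠ x.unpair.1) ∧
      (∃ k, 0 ∈ (translate x.unpair.1).eval (Nat.pair (Encodable.encode (pre X k)) x)) ∧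
      (∀ p ≤ x.unpair.1, coinMeasure (listOpen (goodStrings p (opJoin X s))) ≤
        coinMeasure (listOpen (goodStrings p (opJoin X (s + 1)))) +
          2⁻¹ ^ (x.unpair.1 + testIndex p)) ∧
      opSet X (s + 1) = x :: opSet X s ∧ opLen X (s + 1) = x ∧ opJoin X (s + 1) <+: opJoin X s) ∨
    ((∀ x < opLen X s, (∀ y ∈ opSet X s, y.unpair.1 ≠ x.unpair.1) → ∀ k ≤ s,
      Code.evaln s (translate x.unpair.1) (Nat.pair (Encodable.encode (pre X k)) x) = some 0 →
      ∃ p ≤ x.unpair.1, coinMeasure (listOpen (goodStrings p (pre (joinFun X (opSet X s)) x))) +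
        2⁻¹ ^ (x.unpair.1 + testIndex p) < coinMeasure (listOpen (goodStrings p (opJoin X s)))) ∧
      opSet X (s + 1) = opSet X s ∧ opLen X (s + 1) = opLen X s + 1 ∧
      opJoin X s <+: opJoin X (s + 1)) := by
  rcases opStep_cases (pre X s) (opSet X s) (opLen X s) with ⟨x, hx, he, h⟩ | ⟨he, h⟩
  · have hW : opSet X (s + 1) = _ := congrArg Prod.fst ((opRun_pre_succ X s).trans h)
    have hl : opLen X (s + 1) = _ := congrArg Prod.snd ((opRun_pre_succ X s).trans h)
    simp only at hW hl
    rw [eligible_pre (opLen_le X s) hx] at he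
    obtain ⟨h1, ⟨k, -, h2⟩, h3⟩ := he
    -- The new element is `x` itself, beyond the positions that are kept.
    have hj : opJoin X (s + 1) = pre (joinFun X (opSet X s)) x := by
      rw [opJoin, hW, hl]
      refine pre_congr fun i hi => ?_
      simp [joinFun, hi.ne]
    refine Or.inl ⟨x, hx, h1, ⟨k, Code.evaln_sound h2⟩, ?_, hW, hl, ?_⟩
    · rw [hj]
      exact h3
    · rw [hj]
      exact pre_prefix _ hx.le
  · have hW : opSet X (s + 1) = _ := congrArg Prod.fst ((opRun_pre_succ X s).trans h)
    have hl : opLen X (s + 1) = _ := congrArg Prod.snd ((opRun_pre_succ X s).trans h)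
    simp only at hW hl
    refine Or.inr ⟨fun x hx h1 k hk h2 => ?_, hW, hl, ?_⟩
    · have := he x hx
      rw [eligible_pre (opLen_le X s) hx] at this
      by_contra hcon
      push Not at hcon
      exact this ⟨h1, ⟨k, hk, h2⟩, hcon⟩
    · rw [opJoin, opJoin, hW, hl]
      exact pre_prefix _ (Nat.le_succ _)

end Operator
end Cupping

namespace Cupping
open Nat.Partrec (Code)
open MeasureTheory

/-! ### The operator is noncomputable but adds no power against randomness -/

section Operator

variable (X : ℕ → ℕ)

/-- The set enumerated by the construction with oracle `X`. -/
def opLim : Set ℕ := {x | ∃ s, x ∈ opSet X s}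

/-- The join of `X` with the set enumerated by the construction. -/
noncomputable def limJoin (i : ℕ) : ℕ := X i + 2 * charFun (opLim X) i

theorem opSet_mono {s t : ℕ} (h : s ≤ t) : opSet X s ⊆ opSet X t := by
  induction h with
  | refl => exact List.Subset.refl _
  | step _ ih =>
    rename_i t _
    refine List.Subset.trans ih ?_
    rcases op_cases X t with ⟨x, -, -, -, -, hW, -⟩ | ⟨-, hW, -⟩
    · rw [Nat.succ_eq_add_one, hW]
      exact List.subset_cons_self _ _
    · rw [Nat.succ_eq_add_one, hW]
      exact List.Subset.refl _

theorem nodup_map_opSet (s : ℕ) : ((opSet X s).map fun x => x.unpair.1).Nodup := by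
  induction s with
  | zero => exact List.nodup_nil
  | succ s ih =>
    rcases op_cases X s with ⟨x, -, hx, -, -, hW, -⟩ | ⟨-, hW, -⟩
    · rw [hW, List.map_cons, List.nodup_cons]
      refine ⟨fun h => ?_, ih⟩
      obtain ⟨y, hy, hxy⟩ := List.mem_map.1 h
      exact hx y hy hxy
    · rwa [hW]

theorem opJoin_eq_of_settled {s k : ℕ} (hk : k ≤ opLen X s)
    (h : ∀ i < k, i ∈ opLim X → i ∈ opSet X s) : pre (limJoin X) k <+: opJoin X s := by
  have : pre (limJoin X) k = pre (joinFun X (opSet X s)) k := by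
    refine pre_congr fun i hi => ?_
    have : i ∈ opLim X ↔ i ∈ opSet X s := ⟨h i hi, fun h => ⟨s, h⟩⟩
    by_cases hi : i ∈ opSet X s <;> simp [limJoin, joinFun, charFun, this, hi]
  rw [this]
  exact pre_prefix _ hk

/-- Once the set is final below `k`, only numbers at least `k` are enumerated, so the length never
drops below `k` again after reaching it. -/
theorem exists_settled (k : ℕ) :
    ∃ t, ∀ s ≥ t, k ≤ opLen X s ∧ ∀ i < k, i ∈ opLim X → i ∈ opSet X s := by
  obtain ⟨t, ht⟩ := exists_bound_of_forall_lt (P := fun i s => i ∈ opLim X → i ∈ opSet X s)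
    (fun _ _ _ h h' hi => opSet_mono X h (h' hi)) k fun i _ => by
      by_cases hi : i ∈ opLim X
      · obtain ⟨s, hs⟩ := id hi
        exact ⟨s, fun _ => hs⟩
      · exact ⟨0, fun h => absurd h hi⟩
  have hlen : ∀ d, min k d ≤ opLen X (t + d) := by
    intro d
    induction d with
    | zero => simp
    | succ d ih =>
      rcases op_cases X (t + d) with ⟨x, -, hx, -, -, hW, hl, -⟩ | ⟨-, -, hl, -⟩
      · have hxk : k ≤ x := by
          by_contra hlt
          refine hx x (opSet_mono X (Nat.le_add_right t d) (ht x (by omega) ⟨t + d + 1, ?_⟩)) rfl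
          rw [hW]
          exact List.mem_cons_self
        rw [← add_assoc, hl]
        omega
      · rw [← add_assoc, hl]
        omega
  refine ⟨t + k, fun s hs => ⟨?_, fun i hi h => opSet_mono X (by omega) (ht i hi h)⟩⟩
  obtain ⟨d, rfl⟩ := Nat.exists_eq_add_of_le hs
  have := hlen (k + d)
  rw [← add_assoc] at this
  omega

/-- Take the least number enumerated from stage `t` on: right after its enumeration it is the length
of the approximation, and nothing smaller comes later. If no number is enumerated from `t` on, stage
`t` itself works. -/
theorem exists_true_stage (t : ℕ) : ∃ s ≥ t, ∀ i < opLen X s, i ∈ opLim X → i ∈ opSet X s := by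
  by_cases hne : ∃ x, ∃ s ≥ t, x ∉ opSet X s ∧ x ∈ opSet X (s + 1)
  · classical
    obtain ⟨s, hs, hxs, hxs'⟩ := Nat.find_spec hne
    refine ⟨s + 1, by omega, fun i hi hi' => ?_⟩
    have hl : opLen X (s + 1) = Nat.find hne := by
      rcases op_cases X s with ⟨x, -, -, -, -, hW, hl, -⟩ | ⟨-, hW, -⟩
      · rw [hW] at hxs'
        rcases List.mem_cons.1 hxs' with h | h
        · rw [hl, ← h]
        · exact absurd h hxs
      · exact absurd (hW ▸ hxs') hxs
    rw [hl] at hi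
    by_contra his
    obtain ⟨u, hu⟩ := hi'
    have hex : ∃ u, i ∈ opSet X u := ⟨u, hu⟩
    have hfind : s + 1 < Nat.find hex := by
      by_contra hle
      exact his (opSet_mono X (by omega) (Nat.find_spec hex))
    refine Nat.find_min hne hi ⟨Nat.find hex - 1, by omega, Nat.find_min hex (by omega), ?_⟩
    rw [Nat.sub_add_cancel (by omega)]
    exact Nat.find_spec hex
  · push Not at hne
    refine ⟨t, le_rfl, fun i _ hi => ?_⟩
    obtain ⟨u, hu⟩ := hi
    by_contra hit
    have : ∀ d, i ∉ opSet X (t + d) := by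
      intro d
      induction d with
      | zero => exact hit
      | succ d ih => exact hne i (t + d) (by omega) ih
    exact this u (opSet_mono X (by omega) hu)

/-- A bounded increasing sequence is eventually within `ε` of its supremum. Along the true join the
loss thus becomes negligible, so no strategy waits forever. -/
theorem exists_measure_stable (p : ℕ) {ε : ENNReal} (hε : ε ≠ 0) : ∃ x₀, ∀ x ≥ x₀, ∀ k,
    coinMeasure (listOpen (goodStrings p (pre (limJoin X) k))) ≤
      coinMeasure (listOpen (goodStrings p (pre (limJoin X) x))) + ε := by
  let f : ℕ → ENNReal := fun k => coinMeasure (listOpen (goodStrings p (pre (limJoin X) k)))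
  have hf : Monotone f := fun k l h =>
    measure_mono (openSet_mono (goodStrings_subset (pre_prefix _ h)))
  suffices h : ∃ x₀, ⨆ k, f k ≤ f x₀ + ε by
    obtain ⟨x₀, h⟩ := h
    exact ⟨x₀, fun x hx k => (le_iSup f k).trans (h.trans (add_le_add_left (hf hx) _))⟩
  have htop : ⨆ k, f k ≠ ⊤ :=
    ne_top_of_le_ne_top ENNReal.one_ne_top (iSup_le fun k => prob_le_one)
  by_cases h0 : ⨆ k, f k = 0
  · exact ⟨0, by simp [h0]⟩
  · obtain ⟨x₀, hx₀⟩ := lt_iSup_iff.1 (ENNReal.sub_lt_self htop h0 hε)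
    exact ⟨x₀, tsub_le_iff_right.1 hx₀.le⟩

/-- The set enumerated by the construction is not computable from the oracle. -/
theorem not_funIn_charFun_opLim : ¬ FunIn (charFun (opLim X)) X := by
  intro h
  obtain ⟨c, hc⟩ := exists_code_of_funIn h
  simp only [Encodable.encode_nat] at hc
  by_cases hy : ∃ y ∈ opLim X, y.unpair.1 = c.index
  · obtain ⟨y, hy, hyc⟩ := hy
    have hex : ∃ u, y ∈ opSet X u := hy
    classical
    obtain ⟨s, hs⟩ : ∃ s, Nat.find hex = s + 1 := by
      refine Nat.exists_eq_succ_of_ne_zero fun h0 => ?_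
      have := Nat.find_spec hex
      rw [h0] at this
      exact absurd this (by simp [opSet, opRun])
    have hys : y ∉ opSet X s := Nat.find_min hex (by omega)
    have hys' : y ∈ opSet X (s + 1) := hs ▸ Nat.find_spec hex
    rcases op_cases X s with ⟨x, -, -, ⟨k, hk⟩, -, hW, -⟩ | ⟨-, hW, -⟩
    · rw [hW] at hys'
      rcases List.mem_cons.1 hys' with rfl | h
      · rw [hyc, eval_translate] at hk
        have := c.eval_of_pre hk
        rw [hc, Part.mem_some_iff] at this
        rw [charFun_eq_one.2 hy] at this
        omega
      · exact hys h
    · exact hys (hW ▸ hys')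
  · push Not at hy
    -- No number in the column of `c` is enumerated. Choose one there, beyond the point where the
    -- measures for all `p ≤ c.index` are stable; the program answers `0` on it.
    obtain ⟨x₀, hx₀⟩ := exists_bound_of_forall_lt (P := fun p x₀ => ∀ x ≥ x₀, ∀ k,
      coinMeasure (listOpen (goodStrings p (pre (limJoin X) k))) ≤
      coinMeasure (listOpen (goodStrings p (pre (limJoin X) x))) + 2⁻¹ ^ (c.index + testIndex p))
      (fun _ _ _ h h' x hx => h' x (h.trans hx)) (c.index + 1)
      fun p _ => exists_measure_stable X p (by simp)
    let x := Nat.pair c.index x₀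
    have hxx : x₀ ≤ x := Nat.right_le_pair _ _
    have hxc : x.unpair.1 = c.index := by simp [x]
    have h0 : 0 ∈ c.eval (tot X) x := by
      rw [hc, Part.mem_some_iff, charFun, if_neg fun h => hy x h hxc]
    obtain ⟨k, hk⟩ := c.exists_pre X x 0 h0
    rw [← eval_translate] at hk
    obtain ⟨u, hu⟩ := Code.evaln_complete.1 hk
    obtain ⟨t, ht⟩ := exists_settled X (x + 1)
    obtain ⟨s, hs, htrue⟩ := exists_true_stage X (max t (max k u))
    have hst : t ≤ s := le_of_max_le_left hs
    have hsk : k ≤ s := (le_max_left _ _).trans (le_of_max_le_right hs)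
    have hsu : u ≤ s := (le_max_right _ _).trans (le_of_max_le_right hs)
    have hxl := (ht s hst).1
    -- At a true stage nothing below the current length can still be enumerated, so no number is
    -- eligible; yet `x` would be, as the approximation is correct there.
    rcases op_cases X s with ⟨y, hyl, hy, -, -, hW, -⟩ | ⟨hne, -⟩
    · refine hy y (htrue y hyl ⟨s + 1, ?_⟩) rfl
      rw [hW]
      exact List.mem_cons_self
    · obtain ⟨p, hp, hlt⟩ := hne x (by omega) (fun y hys => fun h => hy y ⟨s, hys⟩ (h.trans hxc)) k
        hsk (by rw [hxc]; exact Code.evaln_mono hsu hu)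
      rw [hxc] at hp hlt
      refine not_le_of_gt hlt ?_
      have h1 : opJoin X s = pre (limJoin X) (opLen X s) := by
        refine (List.IsPrefix.eq_of_length (opJoin_eq_of_settled X le_rfl htrue) ?_).symm
        simp [opJoin]
      have h2 : pre (joinFun X (opSet X s)) x = pre (limJoin X) x := by
        have := congrArg (List.take x) h1
        rwa [opJoin, take_pre _ (by omega), take_pre _ (by omega)] at this
      rw [h1, h2]
      exact hx₀ p (by omega) x hxx _

/-- The strings that the strategy number `p` accepts. -/
def opStrings (p : ℕ) : Set (List Bool) := {σ | ∃ s, σ ∈ goodStrings p (opJoin X s)}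

theorem sum_loss_le (p N : ℕ) (F : Finset ℕ) :
    ∑ j ∈ F, (if j < p then (2⁻¹ : ENNReal) ^ N else 2⁻¹ ^ (j + N)) ≤ (p + 2) * 2⁻¹ ^ N := by
  calc ∑ j ∈ F, (if j < p then (2⁻¹ : ENNReal) ^ N else 2⁻¹ ^ (j + N))
      ≤ ∑ j ∈ F, ((if j ∈ Finset.range p then (2⁻¹ : ENNReal) ^ N else 0) + 2⁻¹ ^ (j + N)) := by
        refine Finset.sum_le_sum fun j _ => ?_
        by_cases h : j < p <;> simp [h]
    _ = (∑ j ∈ F, if j ∈ Finset.range p then (2⁻¹ : ENNReal) ^ N else 0) +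
        ∑ j ∈ F, 2⁻¹ ^ (j + N) := Finset.sum_add_distrib
    _ ≤ p * 2⁻¹ ^ N + 2 * 2⁻¹ ^ N := by
        gcongr
        · rw [← Finset.sum_filter, Finset.sum_const, nsmul_eq_mul]
          gcongr
          refine (Finset.card_le_card (t := Finset.range p) fun j hj =>
            (Finset.mem_filter.1 hj).2).trans ?_
          simp
        · simp only [pow_add]
          rw [← Finset.sum_mul]
          gcongr
          refine (ENNReal.sum_le_tsum F).trans ?_
          rw [ENNReal.tsum_geometric, ENNReal.one_sub_inv_two, inv_inv]
    _ = (p + 2) * 2⁻¹ ^ N := (add_mul _ _ _).symm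

theorem measure_union_le_of_subset {α : Type*} [MeasurableSpace α] {μ : Measure α}
    {D G G' : Set α} (hG : MeasurableSet G) (hD : G ⊆ D) (hG' : G ⊆ G') {ε : ENNReal}
    (h : μ D ≤ μ G + ε) : μ (G' ∪ D) ≤ μ G' + ε := by
  have hu : G' ∪ D ⊆ D ∪ G' \ G := by
    rintro x (hx | hx)
    · by_cases hxG : x ∈ G
      · exact Or.inl (hD hxG)
      · exact Or.inr ⟨hx, hxG⟩
    · exact Or.inl hx
  calc μ (G' ∪ D) ≤ μ D + μ (G' \ G) := (measure_mono hu).trans (measure_union_le _ _)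
    _ ≤ μ G + ε + μ (G' \ G) := add_le_add_left h _
    _ = μ G + μ (G' \ G) + ε := add_right_comm _ _ _
    _ = μ G' + ε := by
      rw [measure_add_sdiff hG.nullMeasurableSet, Set.union_eq_self_of_subset_left hG']

theorem coinMeasure_opStrings_le (p : ℕ) :
    coinMeasure (openSet (opStrings X p)) ≤ (p + 3) * 2⁻¹ ^ testIndex p := by
  let G : ℕ → Set (ℕ → Bool) := fun s => listOpen (goodStrings p (opJoin X s))
  let D : ℕ → Set (ℕ → Bool) := fun s => ⋃ t ∈ Finset.range (s + 1), G t
  -- A strategy `j < p` ignores the cost for `p` and may destroy everything accepted so far by the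
  -- current approximation, but it acts only once; `j ≥ p` respects the cost bound.
  let loss : ℕ → ENNReal := fun j => if j < p then 2⁻¹ ^ testIndex p else 2⁻¹ ^ (j + testIndex p)
  have hGm : ∀ s, MeasurableSet (G s) := fun s => measurableSet_openSet _
  have hGD : ∀ s, G s ⊆ D s := fun s =>
    Set.subset_biUnion_of_mem (u := G) (Finset.mem_coe.2 (Finset.self_mem_range_succ s))
  have hDs : ∀ s, D (s + 1) = G (s + 1) ∪ D s := fun s => by
    simp only [D]
    rw [Finset.range_add_one (n := s + 1), Finset.set_biUnion_insert]
  -- Everything ever accepted exceeds in measure what is accepted now by at most the losses of the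
  -- strategies that have acted.
  have key : ∀ s, coinMeasure (D s) ≤ coinMeasure (G s) +
      ((opSet X s).map fun x => loss x.unpair.1).sum := by
    intro s
    induction s with
    | zero => simp [D]
    | succ s ih =>
      rw [hDs]
      rcases op_cases X s with ⟨x, -, -, -, hcost, hW, -, hJ⟩ | ⟨-, hW, -, hJ⟩
      · have hsub : G (s + 1) ⊆ G s := openSet_mono (goodStrings_subset hJ)
        have hl : coinMeasure (G s) ≤ coinMeasure (G (s + 1)) + loss x.unpair.1 := by
          by_cases hp : x.unpair.1 < p
          · simp only [loss, hp, if_true]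
            exact (coinMeasure_goodStrings_le p _).trans le_add_self
          · simp only [loss, hp, if_false]
            exact hcost p (by omega)
        rw [Set.union_eq_self_of_subset_left (hsub.trans (hGD s)), hW, List.map_cons, List.sum_cons,
          ← add_assoc]
        exact ih.trans (add_le_add_left hl _)
      · have hsub : G s ⊆ G (s + 1) := openSet_mono (goodStrings_subset hJ)
        rw [hW]
        exact measure_union_le_of_subset (hGm s) (hGD s) hsub ih
  have hD : openSet (opStrings X p) = ⋃ s, D s := by
    ext Z
    simp only [D, G, listOpen, openSet, opStrings, Set.mem_iUnion, Set.mem_ofPred_eq, exists_prop,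
      Finset.mem_range]
    constructor
    · rintro ⟨σ, ⟨s, h⟩, hZ⟩
      exact ⟨s, s, Nat.lt_succ_self s, σ, h, hZ⟩
    · rintro ⟨-, s, -, σ, h, hZ⟩
      exact ⟨σ, ⟨s, h⟩, hZ⟩
  have hmono : Monotone D := monotone_nat_of_le_succ fun s => by
    rw [hDs]
    exact Set.subset_union_right
  rw [hD, hmono.measure_iUnion]
  refine iSup_le fun s => (key s).trans ?_
  have hsum : ((opSet X s).map fun x => loss x.unpair.1).sum =
      ∑ j ∈ ((opSet X s).map fun x => x.unpair.1).toFinset, loss j := by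
    rw [List.sum_toFinset _ (nodup_map_opSet X s), List.map_map]
    rfl
  rw [hsum]
  refine (add_le_add (coinMeasure_goodStrings_le p _) (sum_loss_le p _ _)).trans (le_of_eq ?_)
  ring

/-- Explains `testIndex`: it equals `p + 2 + n`, and the factor `p + 3` is absorbed by `2 ^ (p +
2)`. -/
theorem coinMeasure_opStrings_pair_le (e n : ℕ) :
    coinMeasure (openSet (opStrings X (Nat.pair e n))) ≤ 2⁻¹ ^ n := by
  refine (coinMeasure_opStrings_le X _).trans ?_
  generalize hp : Nat.pair e n = p
  have hN : testIndex p = p + 2 + n := by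
    simp [testIndex, ← hp]
    omega
  have h3 : p + 3 ≤ 2 ^ (p + 2) := Nat.lt_two_pow_self
  rw [hN, pow_add, ← mul_assoc]
  refine mul_le_of_le_one_left zero_le ?_
  calc ((p : ENNReal) + 3) * 2⁻¹ ^ (p + 2) ≤ 2 ^ (p + 2) * 2⁻¹ ^ (p + 2) := by
        gcongr
        exact_mod_cast h3
    _ = 1 := by rw [← mul_pow, ENNReal.mul_inv_cancel (by simp) (by simp), one_pow]

theorem sigIn_opStrings (e : ℕ) :
    SigIn X fun q : ℕ × List Bool => q.2 ∈ opStrings X (Nat.pair e q.1) := by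
  have hB : PrimrecPred fun q : List ℕ × ℕ × List Bool => q.2.2 ∈
      goodStrings (Nat.pair e q.2.1) (joinList q.1 (opRun q.1).1 (opRun q.1).2) := by
    have := primrec_opRun
    fun_prop
  refine (SigIn.ex (p := fun (q : ℕ × List Bool) s => q.2 ∈ goodStrings (Nat.pair e q.1)
    (joinList (pre X s) (opRun (pre X s)).1 (opRun (pre X s)).2))
    (SigIn.comp_decide hB.decide (f := fun q : (ℕ × List Bool) × ℕ => (pre X q.2, q.1))
      (FunIn.pair ((FunIn.oracle.pre).comp (by fun_prop)) (by fun_prop)))).of_iff fun q => ?_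
  refine exists_congr fun s => ?_
  have : joinList (pre X s) (opRun (pre X s)).1 (opRun (pre X s)).2 = opJoin X s :=
    joinList_pre X _ (opLen_le X s)
  rw [this]

/-- True prefixes of the join enumerate only strings of the test, so they always meet the measure
bound; eventually the approximation extends any given true prefix. -/
theorem subset_opStrings {W : ℕ → Set (List Bool)} {c : Code}
    (hW : ∀ n, coinMeasure (openSet (W n)) ≤ 2⁻¹ ^ n)
    (hc : ∀ q : ℕ × List Bool, q.2 ∈ W q.1 ↔ ∃ k, (c.eval
      (Nat.pair (Encodable.encode (pre (limJoin X) k)) (Encodable.encode q))).Dom) (n : ℕ) :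
    W (testIndex (Nat.pair (Encodable.encode c) n)) ⊆ opStrings X (Nat.pair (Encodable.encode c) n) := by
  generalize hp : Nat.pair (Encodable.encode c) n = p
  have hpc : Denumerable.ofNat Code p.unpair.1 = c := by simp [← hp]
  have hsub : ∀ k, {σ | σ ∈ enumStrings p (pre (limJoin X) k)} ⊆ W (testIndex p) := by
    intro k σ hσ
    obtain ⟨-, i, hi, he⟩ := mem_enumStrings.1 hσ
    rw [length_pre] at hi he
    rw [take_pre _ hi, hpc] at he
    obtain ⟨x, hx⟩ := Option.isSome_iff_exists.1 he
    exact (hc (testIndex p, σ)).2 ⟨i, Part.dom_iff_mem.2 ⟨x, Code.evaln_sound hx⟩⟩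
  intro σ hσ
  obtain ⟨k, hk⟩ := (hc (testIndex p, σ)).1 hσ
  obtain ⟨x, hx⟩ := Part.dom_iff_mem.1 hk
  obtain ⟨u, hu⟩ := Code.evaln_complete.1 hx
  -- Long enough for the use of the oracle, for the number of steps, and to exceed the length of the
  -- string.
  let k' := max k (max u (σ.length + 1))
  have hkk : k ≤ k' := le_max_left _ _
  have huk : u ≤ k' := (le_max_left _ _).trans (le_max_right _ _)
  have hlk : σ.length + 1 ≤ k' := (le_max_right _ _).trans (le_max_right _ _)
  have hmem : σ ∈ enumStrings p (pre (limJoin X) k') := by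
    refine mem_enumStrings.2 ⟨by rw [length_pre]; omega, k, by rwa [length_pre], ?_⟩
    rw [take_pre _ hkk, hpc, length_pre]
    exact Option.isSome_iff_exists.2 ⟨x, Code.evaln_mono huk hu⟩
  obtain ⟨s, hs⟩ := exists_settled X k'
  obtain ⟨hl, hs⟩ := hs s le_rfl
  refine ⟨s, goodStrings_subset (opJoin_eq_of_settled X hl hs) (mem_goodStrings.2
    ⟨k', by rw [length_pre], ?_, ?_⟩)⟩
  · rw [take_pre _ le_rfl]
    exact (measure_mono (openSet_mono (hsub k'))).trans (hW _)
  · rwa [take_pre _ le_rfl]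

/-- Randomness relative to `A` implies randomness relative to the join of `A` with the set
enumerated by the construction. -/
theorem lrle_of_funIn_limJoin {A B : Set ℕ} (h : FunIn (charFun B) (limJoin (charFun A))) :
    LRLE B A := by
  intro Z hZ W hW hZW
  have hWS : SigIn (limJoin (charFun A)) fun q : ℕ × List Bool => q.2 ∈ W q.1 :=
    SigIn.trans (isCEIn_iff_sigIn.1 hW.1) h
  obtain ⟨c, hc⟩ := hWS.exists_code
  refine hZ (fun n => opStrings (charFun A) (Nat.pair (Encodable.encode c) n))
    ⟨isCEIn_iff_sigIn.2 (sigIn_opStrings _ _), fun n => coinMeasure_opStrings_pair_le _ _ n⟩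
    (Set.mem_iInter.2 fun n => ?_)
  exact openSet_mono (subset_opStrings (charFun A) hW.2 hc n) (Set.mem_iInter.1 hZW _)

end Operator
end Cupping

namespace Cupping
open Nat.Partrec (Code)

/-! ### Pseudojump inversion: an incomplete LR-hard c.e. set -/

section Inversion

theorem opSet_congr {X Y : ℕ → ℕ} {v : ℕ} (h : pre X v = pre Y v) : opSet X v = opSet Y v := by
  rw [opSet, opSet, h]

/-- The characteristic function of a list. -/
def listFun (L : List ℕ) (i : ℕ) : ℕ := if i ∈ L then 1 else 0

/-- With oracle `L`, the same numbers up to `k` are enumerated in `v` steps as in `s` steps. -/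
def Agree (L : List ℕ) (s k v : ℕ) : Prop :=
  ∀ i < k + 1, i ∈ opSet (listFun L) s → i ∈ opSet (listFun L) v

noncomputable instance (L : List ℕ) (s k v : ℕ) : Decidable (Agree L s k v) := by
  unfold Agree
  infer_instance

/-- The least number of steps in which the same numbers up to `k` are enumerated, with oracle `L`,
as in `s` steps. -/
noncomputable def opUse (L : List ℕ) (s k : ℕ) : ℕ :=
  ((List.range (s + 1)).filter fun v => decide (Agree L s k v)).getD 0 0

/-- The value `v = s` always agrees, so the default `0` in `opUse` is never taken. -/
theorem opUse_spec (L : List ℕ) (s k : ℕ) : opUse L s k ≤ s ∧ Agree L s k (opUse L s k) ∧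
    ∀ v < opUse L s k, ¬ Agree L s k v := by
  have h : ((List.range (s + 1)).find? fun v => decide (Agree L s k v)) = some (opUse L s k) := by
    have hs : s ∈ (List.range (s + 1)).filter fun v => decide (Agree L s k v) :=
      List.mem_filter.2 ⟨by simp, decide_eq_true fun i _ h => h⟩
    rw [← List.head?_filter, opUse]
    obtain ⟨x, t, hxt⟩ := List.exists_cons_of_ne_nil (List.ne_nil_of_mem hs)
    rw [hxt]
    rfl
  rw [List.find?_range_eq_some] at h
  obtain ⟨h1, h2, h3⟩ := h
  exact ⟨by simpa [Nat.lt_succ_iff] using h2, of_decide_eq_true h1, fun v hv => by simpa using h3 v hv⟩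

theorem opUse_le_of_agree {L : List ℕ} {s k v : ℕ} (h : Agree L s k v) : opUse L s k ≤ v := by
  by_contra hlt
  exact (opUse_spec L s k).2.2 v (by omega) h

theorem opUse_mono {L : List ℕ} {s k k' : ℕ} (h : k' ≤ k) : opUse L s k' ≤ opUse L s k :=
  opUse_le_of_agree fun i hi => (opUse_spec L s k).2.1 i (by omega)

section Construction

variable (hs : ℕ → ℕ → ℕ)

/-- The stages of the inversion: when `k` enters the halting problem, a number above the use of the
enumeration of the numbers up to `k` is enumerated. -/
noncomputable def invStage (s : ℕ) : List ℕ := Nat.rec [] (fun s L =>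
  if hs s.unpair.2 s.unpair.1 = 1 ∧ ¬ ∃ y ∈ L, y.unpair.1 = s.unpair.1 then
    Nat.pair s.unpair.1 (opUse L s s.unpair.1) :: L else L) s

/-- The set enumerated by the inversion. -/
def invSet : Set ℕ := {y | ∃ s, y ∈ invStage hs s}

/-- The number `k` has entered the halting problem by stage `s`. -/
def Entered (s k : ℕ) : Prop := ∃ y ∈ invStage hs s, y.unpair.1 = k

noncomputable instance (s k : ℕ) : Decidable (Entered hs s k) := by
  unfold Entered
  infer_instance

/-- The numbers that have been enumerated by the operator at stage `s`. -/
noncomputable def curSet (s : ℕ) : List ℕ := opSet (listFun (invStage hs s)) s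

/-- The current use for the numbers up to `k` at stage `s`. -/
noncomputable def curUse (s k : ℕ) : ℕ := opUse (invStage hs s) s k

theorem invStage_cases (s : ℕ) : invStage hs (s + 1) = invStage hs s ∨
    ∃ k, hs s.unpair.2 k = 1 ∧ ¬ Entered hs s k ∧
      invStage hs (s + 1) = Nat.pair k (curUse hs s k) :: invStage hs s := by
  by_cases h : hs s.unpair.2 s.unpair.1 = 1 ∧ ¬ Entered hs s s.unpair.1
  · exact Or.inr ⟨_, h.1, h.2, if_pos h⟩
  · exact Or.inl (if_neg h)

theorem invStage_succ_of_not_entered {s : ℕ} (h : hs s.unpair.2 s.unpair.1 = 1)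
    (h' : ¬ Entered hs s s.unpair.1) : invStage hs (s + 1) =
      Nat.pair s.unpair.1 (curUse hs s s.unpair.1) :: invStage hs s := if_pos ⟨h, h'⟩

theorem invStage_mono {s t : ℕ} (h : s ≤ t) : invStage hs s ⊆ invStage hs t := by
  induction h with
  | refl => exact List.Subset.refl _
  | step _ ih =>
    rename_i t _
    refine List.Subset.trans ih ?_
    rcases invStage_cases hs t with h | ⟨k, -, -, h⟩
    · rw [Nat.succ_eq_add_one, h]
      exact List.Subset.refl _
    · rw [Nat.succ_eq_add_one, h]
      exact List.subset_cons_self _ _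

theorem Entered.mono {hs : ℕ → ℕ → ℕ} {s t k : ℕ} (h : s ≤ t) (hk : Entered hs s k) :
    Entered hs t k := by
  obtain ⟨y, hy, hyk⟩ := hk
  exact ⟨y, invStage_mono hs h hy, hyk⟩

variable {hs} (hhs : IsApprox haltingSet hs)
include hhs

theorem mem_haltingSet_of_entered {s k : ℕ} (h : Entered hs s k) : k ∈ haltingSet := by
  induction s with
  | zero =>
    obtain ⟨y, hy, -⟩ := h
    exact absurd hy List.not_mem_nil
  | succ s ih =>
    obtain ⟨y, hy, rfl⟩ := h
    rcases invStage_cases hs s with h | ⟨k, hk, -, h⟩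
    · exact ih ⟨y, h ▸ hy, rfl⟩
    · rw [h] at hy
      rcases List.mem_cons.1 hy with rfl | hy
      · have := hhs.le_charFun s.unpair.2 k
        have h1 := charFun_le_one haltingSet k
        simpa using charFun_eq_one.1 (show charFun haltingSet k = 1 by omega)
      · exact ih ⟨y, hy, rfl⟩

theorem exists_entered {k : ℕ} (h : k ∈ haltingSet) : ∃ s, Entered hs s k := by
  obtain ⟨t, ht⟩ := hhs.exists_eq k
  rw [charFun_eq_one.2 h] at ht
  by_cases hk : Entered hs (Nat.pair k t) k
  · exact ⟨_, hk⟩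
  · refine ⟨Nat.pair k t + 1, Nat.pair k (curUse hs (Nat.pair k t) k), ?_, by simp⟩
    rw [invStage_succ_of_not_entered hs (by simpa using ht) (by simpa using hk)]
    simp
omit hhs in
/-- No number below `k` enters the halting problem after stage `s`. -/
def Quiet (hs : ℕ → ℕ → ℕ) (k s : ℕ) : Prop := ∀ i < k, i ∈ haltingSet → Entered hs s i

omit hhs in
theorem Quiet.mono {k k' s t : ℕ} (h : Quiet hs k s) (hk : k' ≤ k) (hst : s ≤ t) :
    Quiet hs k' t := fun i hi hi' => (h i (by omega) hi').mono hst

theorem exists_quiet (k : ℕ) : ∃ s, Quiet hs k s :=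
  exists_bound_of_forall_lt (P := fun i s => i ∈ haltingSet → Entered hs s i)
    (fun _ _ _ h h' hi => (h' hi).mono h) k fun i _ => by
      by_cases hi : i ∈ haltingSet
      · obtain ⟨s, h⟩ := exists_entered hhs hi
        exact ⟨s, fun _ => h⟩
      · exact ⟨0, fun h => absurd h hi⟩

omit hhs in
theorem pre_listFun_cons {L : List ℕ} {y v : ℕ} (h : v ≤ y) :
    pre (listFun (y :: L)) v = pre (listFun L) v := by
  refine pre_congr fun i hi => ?_
  simp [listFun, show i ≠ y by omega]

/-- Only some `k' ≥ k` can act, and it enumerates a number at or above its own use, hence at or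
above the use of `k`. The use cannot drop either: a smaller one would lie in the unchanged part of
the oracle and would have sufficed before. -/
theorem quiet_step {k s : ℕ} (h : Quiet hs k s) :
    pre (listFun (invStage hs (s + 1))) (curUse hs s k) =
      pre (listFun (invStage hs s)) (curUse hs s k) ∧
    (∀ i ≤ k, i ∈ curSet hs s → i ∈ curSet hs (s + 1)) ∧ curUse hs s k ≤ curUse hs (s + 1) k := by
  have h1 : pre (listFun (invStage hs (s + 1))) (curUse hs s k) =
      pre (listFun (invStage hs s)) (curUse hs s k) := by
    rcases invStage_cases hs s with he | ⟨k', hk', hne, he⟩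
    · rw [he]
    · have hkk : k ≤ k' := by
        by_contra hlt
        have := hhs.le_charFun s.unpair.2 k'
        have h1 := charFun_le_one haltingSet k'
        exact hne (h k' (by omega) (charFun_eq_one.1 (by omega)))
      rw [he]
      exact pre_listFun_cons ((opUse_mono hkk).trans (Nat.right_le_pair _ _))
  obtain ⟨hle, hag, hmin⟩ := opUse_spec (invStage hs s) s k
  have h2 : ∀ i ≤ k, i ∈ curSet hs s → i ∈ curSet hs (s + 1) := by
    intro i hi his
    have : i ∈ opSet (listFun (invStage hs s)) (curUse hs s k) := hag i (by omega) his
    rw [← opSet_congr h1] at this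
    exact opSet_mono _ (hle.trans (Nat.le_succ s)) this
  refine ⟨h1, h2, ?_⟩
  by_contra hlt
  push Not at hlt
  refine hmin _ hlt fun i hi his => ?_
  have h3 := (opUse_spec (invStage hs (s + 1)) (s + 1) k).2.1 i hi (h2 i (by omega) his)
  have h4 : pre (listFun (invStage hs (s + 1))) (curUse hs (s + 1) k) =
      pre (listFun (invStage hs s)) (curUse hs (s + 1) k) := by
    have := congrArg (List.take (curUse hs (s + 1) k)) h1
    rwa [take_pre _ hlt.le, take_pre _ hlt.le] at this
  rwa [show opUse (invStage hs (s + 1)) (s + 1) k = curUse hs (s + 1) k from rfl,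
    opSet_congr h4] at h3

theorem quiet_le {k s t : ℕ} (h : Quiet hs k s) (hst : s ≤ t) :
    pre (listFun (invStage hs t)) (curUse hs s k) =
      pre (listFun (invStage hs s)) (curUse hs s k) ∧
    (∀ i ≤ k, i ∈ curSet hs s → i ∈ curSet hs t) ∧ curUse hs s k ≤ curUse hs t k := by
  induction hst with
  | refl => exact ⟨rfl, fun _ _ h => h, le_rfl⟩
  | step hst ih =>
    rename_i t
    obtain ⟨h1, h2, h3⟩ := quiet_step hhs (h.mono le_rfl hst)
    refine ⟨?_, fun i hi his => h2 i hi (ih.2.1 i hi his), ih.2.2.trans h3⟩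
    have := congrArg (List.take (curUse hs s k)) h1
    rw [take_pre _ ih.2.2, take_pre _ ih.2.2] at this
    exact this.trans ih.1

omit hhs in
theorem exists_pre_listFun_eq (u : ℕ) : ∃ s, ∀ t ≥ s,
    pre (listFun (invStage hs t)) u = pre (charFun (invSet hs)) u := by
  obtain ⟨s, h⟩ := exists_bound_of_forall_lt
    (P := fun i s => i ∈ invSet hs → i ∈ invStage hs s)
    (fun _ _ _ h h' hi => invStage_mono hs h (h' hi)) u fun i _ => by
      by_cases hi : i ∈ invSet hs
      · obtain ⟨s, h⟩ := id hi
        exact ⟨s, fun _ => h⟩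
      · exact ⟨0, fun h => absurd h hi⟩
  refine ⟨s, fun t ht => pre_congr fun i hi => ?_⟩
  have : i ∈ invSet hs ↔ i ∈ invStage hs t :=
    ⟨fun h' => invStage_mono hs ht (h i hi h'), fun h => ⟨t, h⟩⟩
  by_cases hi : i ∈ invStage hs t <;> simp [listFun, charFun, this, hi]

/-- Below the use the oracle has its final value, so the enumeration is permanent. -/
theorem mem_opLim_of_quiet {k s : ℕ} (h : Quiet hs k s) {i : ℕ} (hi : i ≤ k)
    (his : i ∈ curSet hs s) : i ∈ opLim (charFun (invSet hs)) := by
  obtain ⟨t, ht⟩ := exists_pre_listFun_eq (hs := hs) (curUse hs s k)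
  have h1 := (quiet_le hhs h (le_max_left s t)).1
  rw [ht _ (le_max_right s t)] at h1
  refine ⟨curUse hs s k, ?_⟩
  rw [opSet_congr h1]
  exact (opUse_spec (invStage hs s) s k).2.1 i (by omega) his

-- The true enumeration has a finite use, on which the stages are eventually correct; no quietness
-- is needed.
omit hhs in
theorem exists_mem_curSet {i : ℕ} (hi : i ∈ opLim (charFun (invSet hs))) :
    ∃ s, ∀ t ≥ s, i ∈ curSet hs t := by
  obtain ⟨u, hu⟩ := hi
  obtain ⟨s, h⟩ := exists_pre_listFun_eq (hs := hs) u
  refine ⟨max s u, fun t ht => ?_⟩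
  rw [← opSet_congr (h t (by omega))] at hu
  exact opSet_mono _ (by omega) hu

/-- Coding of `∅'` into `A ⊕ W`. A stage at which the operator's set is correct up to `k` has final
uses as long as no smaller number acts; a later entry into `∅'` would put the marker computed from
such a use into `A`, and this can be checked. -/
theorem not_mem_haltingSet_iff {k : ℕ} : k ∉ haltingSet ↔ ∃ s, ¬ Entered hs s k ∧
    (∀ i < k + 1, Entered hs s i ∨ Nat.pair i (curUse hs s i) ∉ invSet hs) ∧
    ∀ i < k + 1, (i ∈ curSet hs s ∧ i ∈ opLim (charFun (invSet hs))) ∨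
      (i ∉ curSet hs s ∧ i ∉ opLim (charFun (invSet hs))) := by
  constructor
  · intro hk
    obtain ⟨s₀, h0⟩ := exists_quiet hhs (k + 1)
    obtain ⟨s₁, h1⟩ := exists_bound_of_forall_lt
      (P := fun i s => i ∈ opLim (charFun (invSet hs)) → ∀ t ≥ s, i ∈ curSet hs t)
      (fun _ _ _ h h' hi t ht => h' hi t (h.trans ht)) (k + 1) fun i _ => by
        by_cases hi : i ∈ opLim (charFun (invSet hs))
        · obtain ⟨s, h⟩ := exists_mem_curSet hi
          exact ⟨s, fun _ => h⟩
        · exact ⟨0, fun h => absurd h hi⟩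
    refine ⟨max s₀ s₁, fun h => hk (mem_haltingSet_of_entered hhs h), fun i hi => ?_,
      fun i hi => ?_⟩
    · by_cases hih : i ∈ haltingSet
      · exact Or.inl ((h0 i hi hih).mono (le_max_left _ _))
      · refine Or.inr ?_
        rintro ⟨t, ht⟩
        exact hih (mem_haltingSet_of_entered hhs ⟨_, ht, by simp⟩)
    · by_cases hiL : i ∈ opLim (charFun (invSet hs))
      · exact Or.inl ⟨h1 i hi hiL _ (le_max_right _ _), hiL⟩
      · exact Or.inr ⟨fun h => hiL (mem_opLim_of_quiet hhs
          (h0.mono (Nat.le_succ k) (le_max_left s₀ s₁)) (by omega) h), hiL⟩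
  · rintro ⟨s, hks, hA, hW⟩ hk
    classical
    -- The least number still to enter is considered, so that stage `s` is quiet for it.
    have hex : ∃ i, i ∈ haltingSet ∧ ¬ Entered hs s i := ⟨k, hk, hks⟩
    have hle : Nat.find hex ≤ k := Nat.find_le ⟨hk, hks⟩
    obtain ⟨hj, hjs⟩ := Nat.find_spec hex
    have hq : Quiet hs (Nat.find hex) s := by
      intro i hi hih
      by_contra hne
      exact Nat.find_min hex hi ⟨hih, hne⟩
    generalize Nat.find hex = j at hle hj hjs hq
    have hex' : ∃ t, Entered hs t j := exists_entered hhs hj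
    have hst : s < Nat.find hex' := by
      by_contra hlt
      exact hjs ((Nat.find_spec hex').mono (by omega))
    obtain ⟨t, ht⟩ : ∃ t, Nat.find hex' = t + 1 := ⟨_, (Nat.succ_pred_eq_of_pos (by omega)).symm⟩
    have hjt : ¬ Entered hs t j := Nat.find_min hex' (by omega)
    have hjt' : Entered hs (t + 1) j := ht ▸ Nat.find_spec hex'
    obtain ⟨h1, h2, h3⟩ := quiet_le hhs hq (show s ≤ t by omega)
    -- Whatever is enumerated by stage `t` is permanent, hence was present at the correct stage `s`.
    -- So the use has not grown, and the number put into `A` when `j` enters is the marker already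
    -- seen at stage `s`.
    have hagree : Agree (invStage hs t) t j (curUse hs s j) := by
      intro i hi hit
      have hiL := mem_opLim_of_quiet hhs (hq.mono le_rfl (show s ≤ t by omega)) (by omega) hit
      have his : i ∈ curSet hs s := by
        rcases hW i (by omega) with h | h
        · exact h.1
        · exact absurd hiL h.2
      rw [opSet_congr h1]
      exact (opUse_spec (invStage hs s) s j).2.1 i hi his
    have huse : curUse hs t j = curUse hs s j := le_antisymm (opUse_le_of_agree hagree) h3
    rcases hA j (by omega) with h | h
    · exact hjs h
    · refine h ⟨t + 1, ?_⟩
      rw [← huse]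
      rcases invStage_cases hs t with he | ⟨j', -, -, he⟩
      · obtain ⟨y, hy, hyj⟩ := hjt'
        exact absurd ⟨y, he ▸ hy, hyj⟩ hjt
      · obtain ⟨y, hy, hyj⟩ := hjt'
        rw [he] at hy
        rcases List.mem_cons.1 hy with rfl | hy
        · rw [Nat.unpair_pair] at hyj
          obtain rfl : j' = j := hyj
          rw [he]
          exact List.mem_cons_self
        · exact absurd ⟨y, hy, hyj⟩ hjt

theorem mem_opLim_iff {i s : ℕ} (h : Quiet hs i s) :
    i ∈ opLim (charFun (invSet hs)) ↔ ∃ d, i ∈ curSet hs (s + d) := by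
  constructor
  · intro hi
    obtain ⟨t, ht⟩ := exists_mem_curSet hi
    exact ⟨t, ht _ (by omega)⟩
  · rintro ⟨d, hd⟩
    exact mem_opLim_of_quiet hhs (h.mono le_rfl (Nat.le_add_right s d)) le_rfl hd

section Primrec

variable {α : Type*} [Primcodable α]

omit hhs in
theorem PR.opSet_listFun {L : α → List ℕ} {s : α → ℕ} (hL : Primrec L) (hs : Primrec s) :
    Primrec fun a => opSet (listFun (L a)) (s a) := by
  have := primrec_opRun
  unfold opSet pre listFun
  fun_prop

omit hhs in
theorem PR.opUse {L : α → List ℕ} {s k : α → ℕ} (hL : Primrec L) (hs : Primrec s)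
    (hk : Primrec k) : Primrec fun a => opUse (L a) (s a) (k a) := by
  have h1 : Primrec fun q : α × ℕ => opSet (listFun (L q.1)) (s q.1) :=
    PR.opSet_listFun (hL.comp Primrec.fst) (hs.comp Primrec.fst)
  have h2 : Primrec fun q : α × ℕ => opSet (listFun (L q.1)) q.2 :=
    PR.opSet_listFun (hL.comp Primrec.fst) Primrec.snd
  have h3 : PrimrecPred fun q : α × ℕ => Agree (L q.1) (s q.1) (k q.1) q.2 :=
    PR.forall_lt (by fun_prop) (PR.imp (PR.mem Primrec.snd (h1.comp Primrec.fst))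
      (PR.mem Primrec.snd (h2.comp Primrec.fst)))
  exact PR.getD (PR.filter (by fun_prop) h3.decide) (Primrec.const 0)

theorem primrec_invStage : Primrec (invStage hs) := by
  have h1 := hhs.primrec
  refine PR.natRec (f := fun s : ℕ => s) (z := fun _ => []) (s := fun _ s L =>
    if hs s.unpair.2 s.unpair.1 = 1 ∧ ¬ ∃ y ∈ L, y.unpair.1 = s.unpair.1 then
    Nat.pair s.unpair.1 (Cupping.opUse L s s.unpair.1) :: L else L) (by fun_prop) (by fun_prop) ?_
  have h2 : Primrec fun q : ℕ × ℕ × List ℕ => Cupping.opUse q.2.2 q.2.1 q.2.1.unpair.1 :=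
    PR.opUse (by fun_prop) (by fun_prop) (by fun_prop)
  fun_prop

theorem primrecPred_entered : PrimrecPred fun q : ℕ × ℕ => Entered hs q.1 q.2 := by
  have := primrec_invStage hhs
  unfold Entered
  fun_prop

theorem primrec_curUse : Primrec fun q : ℕ × ℕ => curUse hs q.1 q.2 := by
  have := primrec_invStage hhs
  exact PR.opUse (by fun_prop) (by fun_prop) (by fun_prop)

theorem primrecPred_mem_curSet : PrimrecPred fun q : ℕ × ℕ => q.2 ∈ curSet hs q.1 := by
  have := primrec_invStage hhs
  exact PR.mem (by fun_prop) (PR.opSet_listFun (by fun_prop) (by fun_prop))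

end Primrec

theorem isCE_invSet : IsCE (invSet hs) := by
  have := primrec_invStage hhs
  have h : REPred fun n : ℕ => ∃ s, decide (n ∈ invStage hs s) = true :=
    rePred_exists (p := fun n s => decide (n ∈ invStage hs s)) (by fun_prop)
  exact h.of_eq fun n => by simp [invSet]

/-- `A` is the low bit and the operator's set the high bit of the join; the complement of `∅'` is
enumerated through `not_mem_haltingSet_iff`. -/
theorem funIn_haltingSet_limJoin :
    FunIn (charFun haltingSet) (limJoin (charFun (invSet hs))) := by
  have hA : FunIn (charFun (invSet hs)) (limJoin (charFun (invSet hs))) := by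
    have := (FunIn.of_primrec (g := limJoin (charFun (invSet hs)))
      (by fun_prop : Primrec fun n : ℕ => n % 2)).comp FunIn.oracle
    refine this.of_iff fun q => ?_
    have := charFun_le_one (invSet hs) q.1
    rw [show charFun (invSet hs) q.1 = limJoin (charFun (invSet hs)) q.1 % 2 by
      unfold limJoin; omega]
  have hL : FunIn (charFun (opLim (charFun (invSet hs)))) (limJoin (charFun (invSet hs))) := by
    have := (FunIn.of_primrec (g := limJoin (charFun (invSet hs)))
      (by fun_prop : Primrec fun n : ℕ => n / 2)).comp FunIn.oracle
    refine this.of_iff fun q => ?_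
    have := charFun_le_one (invSet hs) q.1
    rw [show charFun (opLim (charFun (invSet hs))) q.1 = limJoin (charFun (invSet hs)) q.1 / 2 by
      unfold limJoin; omega]
  have hE := primrecPred_entered hhs
  have hU := primrec_curUse hhs
  have hC := primrecPred_mem_curSet hhs
  refine funIn_charFun_of_sigIn (SigIn.of_rePred isCE_haltingSet)
    (SigIn.of_iff (SigIn.ex ?_) fun k => not_mem_haltingSet_iff hhs)
  refine SigIn.and ?_ (SigIn.and (SigIn.forall_lt (by fun_prop) (SigIn.or ?_ ?_))
    (SigIn.forall_lt (by fun_prop) (SigIn.or (SigIn.and ?_ ?_) (SigIn.and ?_ ?_))))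
  · exact SigIn.comp_decide (p := fun q : ℕ × ℕ => ¬ Entered hs q.1 q.2) hE.not.decide
      (f := fun q : ℕ × ℕ => (q.2, q.1)) (by fun_prop)
  · exact SigIn.comp_decide hE.decide (f := fun q : (ℕ × ℕ) × ℕ => (q.1.2, q.2)) (by fun_prop)
  · exact (sigIn_charFun_not.trans hA).comp_primrec
      (f := fun q : (ℕ × ℕ) × ℕ => Nat.pair q.2 (curUse hs q.1.2 q.2)) (by fun_prop)
  · exact SigIn.comp_decide hC.decide (f := fun q : (ℕ × ℕ) × ℕ => (q.1.2, q.2)) (by fun_prop)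
  · exact (sigIn_charFun.trans hL).comp_primrec (f := fun q : (ℕ × ℕ) × ℕ => q.2) (by fun_prop)
  · exact SigIn.comp_decide (p := fun q : ℕ × ℕ => q.2 ∉ curSet hs q.1) hC.not.decide
      (f := fun q : (ℕ × ℕ) × ℕ => (q.1.2, q.2)) (by fun_prop)
  · exact (sigIn_charFun_not.trans hL).comp_primrec (f := fun q : (ℕ × ℕ) × ℕ => q.2) (by fun_prop)

/-- `∅'` can find a quiet stage, after which membership is a `Σ⁰₁` question that `∅'` answers. -/
theorem funIn_opLim_haltingSet :
    FunIn (charFun (opLim (charFun (invSet hs)))) (charFun haltingSet) := by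
  have hE := primrecPred_entered hhs
  have hC := primrecPred_mem_curSet hhs
  have hQ : SigIn (charFun haltingSet) fun q : ℕ × ℕ => Quiet hs q.1 q.2 := by
    refine (SigIn.forall_lt (f := fun q : ℕ × ℕ => q.1) (p := fun q i =>
      i ∉ haltingSet ∨ Entered hs q.2 i) (by fun_prop) (SigIn.or ?_ ?_)).of_iff fun q => ?_
    · exact sigIn_charFun_not.comp_primrec (f := fun q : (ℕ × ℕ) × ℕ => q.2) (by fun_prop)
    · exact SigIn.comp_decide hE.decide (f := fun q : (ℕ × ℕ) × ℕ => (q.1.2, q.2)) (by fun_prop)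
    · exact forall₂_congr fun i _ => imp_iff_not_or
  have hR : REPred fun q : ℕ × ℕ => ∃ d, decide (q.1 ∈ curSet hs (q.2 + d)) = true :=
    rePred_exists (p := fun (q : ℕ × ℕ) d => decide (q.1 ∈ curSet hs (q.2 + d)))
      (hC.comp (f := fun q : (ℕ × ℕ) × ℕ => (q.1.2 + q.2, q.1.1)) (by fun_prop)).decide
  simp only [decide_eq_true_eq] at hR
  refine funIn_charFun_of_sigIn
    ((SigIn.ex (p := fun i s => Quiet hs i s ∧ ∃ d, i ∈ curSet hs (s + d))
      (hQ.and (SigIn.of_rePred hR))).of_iff fun i => ?_)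
    ((SigIn.ex (p := fun i s => Quiet hs i s ∧ ¬ ∃ d, i ∈ curSet hs (s + d))
      (hQ.and (sigIn_haltingSet_not_of_re hR))).of_iff fun i => ?_)
  · constructor
    · intro hi
      obtain ⟨s, hs⟩ := exists_quiet hhs i
      exact ⟨s, hs, (mem_opLim_iff hhs hs).1 hi⟩
    · rintro ⟨s, hs, h⟩
      exact (mem_opLim_iff hhs hs).2 h
  · constructor
    · intro hi
      obtain ⟨s, hs⟩ := exists_quiet hhs i
      exact ⟨s, hs, mt (mem_opLim_iff hhs hs).2 hi⟩
    · rintro ⟨s, hs, h⟩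
      exact mt (mem_opLim_iff hhs hs).1 h

end Construction

/-- There is a Turing incomplete c.e. set that is LR-hard. -/
theorem exists_incomplete_lrHard :
    ∃ A : Set ℕ, IsCE A ∧ ¬ TuringLE haltingSet A ∧ LRHard A := by
  obtain ⟨hs, hhs⟩ := isCE_haltingSet.exists_isApprox
  refine ⟨invSet hs, isCE_invSet hhs, fun h => ?_,
    lrle_of_funIn_limJoin (funIn_haltingSet_limJoin hhs)⟩
  exact not_funIn_charFun_opLim _ ((funIn_opLim_haltingSet hhs).trans (turingLE_iff_funIn.1 h))

end Inversion
end Cupping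

theorem mainTheorem9 :
    (∀ A : Set ℕ, Cupping.IsCE A →
      (∃ f : ℕ → ℕ, Cupping.IsDelta2Fun f ∧
        ∃ c : ℕ, ∀ σ : List Bool,
          Cupping.K A σ ≤ f (Cupping.K Cupping.haltingSet σ) + c) →
      Cupping.JoinsDelta2DNR A) ∧
    (∀ A : Set ℕ, Cupping.IsCE A → Cupping.LRHard A → Cupping.JoinsDelta2DNR A) ∧
    (∃ A : Set ℕ, Cupping.IsCE A ∧ ¬ Cupping.TuringLE Cupping.haltingSet A ∧
      Cupping.LRHard A ∧ Cupping.JoinsDelta2DNR A) := by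
  refine ⟨fun A hA ⟨f, hf, c, h⟩ => Cupping.joinsDelta2DNR_of_K_le hA hf h,
    fun A hA h => Cupping.joinsDelta2DNR_of_lrHard hA h, ?_⟩
  obtain ⟨A, hA, hA', h⟩ := Cupping.exists_incomplete_lrHard
  exact ⟨A, hA, hA', h, Cupping.joinsDelta2DNR_of_lrHard hA h⟩
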